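/- Let $\mathfrak g=\mathfrak{sl}(2,\mathbb C)$ with root vector $x_\alpha$ (the matrix unit $E_{12}$) and form $\langle a,b\rangle=\operatorname{tr}(ab)$, and let $\widehat{\mathfrak g}=\mathfrak g\otimes\mathbb C[t,t^{-1}]\oplus\mathbb C\mathbf k$ be the affine Lie algebra with $\mathbf k$ central and $[a\otimes t^m,b\otimes t^n]=[a,b]\otimes t^{m+n}+m\langle a,b\rangle\delta_{m+n,0}\mathbf k$. Let $\widehat{\mathfrak g}_{\ge0}=\mathfrak g\otimes\mathbb C[t]\oplus\mathbb C\mathbf k$, $\bar{\mathfrak n}=\mathbb C x_\alpha\otimes\mathbb C[t,t^{-1}]$, $\bar{\mathfrak n}_-=\mathbb C x_\alpha\otimes t^{-1}\mathbb C[t^{-1}]$, $\bar{\mathfrak n}_{\le-2}=\mathbb C x_\alpha\otimes t^{-2}\mathbb C[t^{-1}]$, and write $x_\alpha(m)=x_\alpha\otimes t^m$. Let $U_0=\mathbb C$ be the trivial $\mathfrak g$-module and $U_1=\mathbb C^2$ the two-dimensional irreducible $\mathfrak g$-module. For $i=0,1$ let $N(\Lambda_i)=U(\widehat{\mathfrak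 g})\otimes_{U(\widehat{\mathfrak g}_{\ge0})}U_i$ be the generalized Verma module, where $\mathfrak g\otimes t\,\mathbb C[t]$ acts on $U_i$ as $0$ and $\mathbf k$ as $1$, and let $v^N_{\Lambda_i}=1\otimes u_i$ with $u_i$ a highest weight vector of $U_i$. Let $\Pi_{\Lambda_i}:N(\Lambda_i)\to L(\Lambda_i)$ be the projection onto the irreducible quotient of $N(\Lambda_i)$ by its maximal proper submodule (so $L(\Lambda_0)$, $L(\Lambda_1)$ are the level one standard $\widehat{\mathfrak g}$-modules), and let $v_{\Lambda_i}=\Pi_{\Lambda_i}(v^N_{\Lambda_i})$ and $N^1(\Lambda_i)=\operatorname{Ker}\Pi_{\Lambda_i}$. Put $W(\Lambda_i)=U(\bar{\mathfrak n})\cdot v_{\Lambda_i}$, $W(\Lambda_1)'=U(\bar{\mathfrak n}_{\le-2})\cdot v_{\Lambda_1}$, $W^N(\Lambda_i)=U(\bar{\mathfrak n})\cdot v^N_{\Lambda_i}$ and $W^N(\Lambda_1)'=U(\bar{\mathfrak n}_{\le-2})\cdot v^N_{\Lambda_1}$. Let $$f_{\Lambda_i}:U(\bar{\mathfrak n}_-)\to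 W(\Lambda_i),\qquad f'_{\Lambda_1}:U(\bar{\mathfrak n}_{\le-2})\to W(\Lambda_1)'$$ be the maps $a\mapsto a\cdot v_{\Lambda_i}$ (with $i=1$ for $f'_{\Lambda_1}$), and let $\pi_{\Lambda_i}:W^N(\Lambda_i)\to W(\Lambda_i)$ and $\pi'_{\Lambda_1}:W^N(\Lambda_1)'\to W(\Lambda_1)$ be the restrictions of $\Pi_{\Lambda_i}$, $\Pi_{\Lambda_1}$. Define $$R^0_t=\sum_{\substack{m_1,m_2\le-1\\ m_1+m_2=-t}}x_\alpha(m_1)x_\alpha(m_2)\in U(\bar{\mathfrak n}_-)\ (t\ge2),\qquad R^1_t=\sum_{\substack{m_1,m_2\le-2\\ m_1+m_2=-t}}x_\alpha(m_1)x_\alpha(m_2)\in U(\bar{\mathfrak n}_{\le-2})\ (t\ge4),$$ $$I_{\Lambda_0}=\sum_{t\ge2}U(\bar{\mathfrak n}_-)R^0_t,\qquad I_{\Lambda_1}=\sum_{t\ge2}U(\bar{\mathfrak n}_-)R^0_t+U(\bar{\mathfrak n}_-)x_\alpha(-1),\qquad I'_{\Lambda_1}=\sum_{t\ge4}U(\bar{\mathfrak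 n}_{\le-2})R^1_t.$$ Then: 1. $\operatorname{Ker}f_{\Lambda_0}=I_{\Lambda_0}$, and $\operatorname{Ker}f'_{\Lambda_1}=I'_{\Lambda_1}$, or equivalently $\operatorname{Ker}f_{\Lambda_1}=I_{\Lambda_1}$ (all three equalities hold). 2. $\operatorname{Ker}\pi_{\Lambda_0}=I_{\Lambda_0}\cdot v^N_{\Lambda_0}\ (\subset N^1(\Lambda_0))$, and $\operatorname{Ker}\pi'_{\Lambda_1}=I'_{\Lambda_1}\cdot v^N_{\Lambda_1}\ (\subset N^1(\Lambda_1))$, or equivalently $\operatorname{Ker}\pi_{\Lambda_1}=I_{\Lambda_1}\cdot v^N_{\Lambda_1}\ (\subset N^1(\Lambda_1))$ (all three equalities hold). -/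

import Mathlib

open scoped TensorProduct

noncomputable section

namespace AffineSl2

attribute [local instance 100] LieRing.ofAssociativeRing

/-! ### The affine Lie algebra of type `A_1^{(1)}` -/

/-- The complex Lie algebra `𝔤 = 𝔰𝔩(2)` of traceless `2 × 2` matrices. -/
abbrev Sl2 : Type := LieAlgebra.SpecialLinear.sl (Fin 2) ℂ

/-- The root vector `x_α`, the matrix unit `E₁₂`. -/
def xAlpha : Sl2 := LieAlgebra.SpecialLinear.single 0 1 (by decide) 1

/-- The standard invariant form `⟨a, b⟩ = tr (a b)`. -/
def form : LinearMap.BilinForm ℂ Sl2 :=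
  LinearMap.mk₂ ℂ (fun a b => Matrix.trace (a.1 * b.1))
    (fun a a' b => by simp [add_mul]) (fun c a b => by simp)
    (fun a b b' => by simp [mul_add]) (fun c a b => by simp)

theorem form_apply (a b : Sl2) : form a b = Matrix.trace (a.1 * b.1) := rfl

theorem form_isSymm : form.IsSymm :=
  ⟨fun a b => by simp only [form_apply]; exact Matrix.trace_mul_comm _ _⟩

theorem form_lieInvariant : form.lieInvariant Sl2 := fun a b c => by
  simp only [form_apply, LieAlgebra.SpecialLinear.sl_bracket, sub_mul, mul_sub,
    Matrix.trace_sub]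
  rw [Matrix.mul_assoc a.1, Matrix.trace_mul_comm a.1, ← Matrix.mul_assoc b.1 c.1 a.1,
    Matrix.mul_assoc b.1 a.1 c.1]
  ring

/-- The loop algebra `𝔤 ⊗ ℂ[t, t⁻¹]`. -/
abbrev Loop : Type := LieAlgebra.loopAlgebra ℂ ℤ Sl2

/-- The element `a ⊗ t^m` of the loop algebra. -/
def loopMonomial (a : Sl2) (m : ℤ) : Loop := AddMonoidAlgebra.single m (1 : ℂ) ⊗ₜ[ℂ] a

/-- The cocycle `(a ⊗ t^m, b ⊗ t^n) ↦ m ⟨a, b⟩ δ_{m+n,0}`. The form enters with a minus sign since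
Mathlib's residue pairing is `n ⟨a, b⟩ δ_{m+n,0}`; compare `lie_monomial` below. -/
def cocycle : LieModule.Cohomology.twoCocycle ℂ Loop (TrivialLieModule ℂ Loop ℂ) :=
  LieAlgebra.LoopAlgebra.twoCocycleOfBilinear ℂ ℤ Sl2 (-form)
    (fun a b c => by simp [form_lieInvariant a b c])
    ⟨fun a b => by simpa using congrArg Neg.neg (form_isSymm.eq a b)⟩

/-- The affine Lie algebra `𝔤̂ = 𝔤 ⊗ ℂ[t, t⁻¹] ⊕ ℂ k`, the central extension of the loop algebra by
`cocycle`. -/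
abbrev Affine : Type := LieAlgebra.ofTwoCocycle cocycle

/-- The element `a ⊗ t^m` of `𝔤̂`. -/
def monomial (a : Sl2) (m : ℤ) : Affine := LieAlgebra.ofProd cocycle (loopMonomial a m, 0)

/-- The central element `k` of `𝔤̂`. -/
def central : Affine :=
  LieAlgebra.ofProd cocycle (0, (TrivialLieModule.equiv ℂ Loop ℂ).symm 1)

theorem loopMonomial_lie (a b : Sl2) (m n : ℤ) :
    ⁅loopMonomial a m, loopMonomial b n⁆ = loopMonomial ⁅a, b⁆ (m + n) := by
  rw [loopMonomial, loopMonomial, LieAlgebra.ExtendScalars.bracket_tmul,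
    AddMonoidAlgebra.single_mul_single, one_mul]
  rfl

theorem toFinsupp_loopMonomial (a : Sl2) (m : ℤ) :
    LieAlgebra.LoopAlgebra.toFinsupp ℂ ℤ Sl2 (loopMonomial a m) = Finsupp.single m a :=
  LieAlgebra.LoopAlgebra.toFinsupp_single_tmul ℂ ℤ Sl2 m a

theorem residue_monomial (a b : Sl2) (m n : ℤ) :
    LieAlgebra.LoopAlgebra.residuePairing ℂ ℤ Sl2 (-form) (loopMonomial a m) (loopMonomial b n)
      = if m + n = 0 then (m : ℂ) * form a b else 0 := by
  rw [LieAlgebra.LoopAlgebra.residuePairing_apply_apply, toFinsupp_loopMonomial,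
    toFinsupp_loopMonomial, Finsupp.sum_single_index (by simp)]
  split_ifs with h
  · obtain rfl : n = -m := by omega
    simp
  · rw [Finsupp.single_eq_of_ne (by omega)]
    simp

/-- The bracket relations of `𝔤̂`. -/
theorem lie_monomial (a b : Sl2) (m n : ℤ) :
    ⁅monomial a m, monomial b n⁆ =
      monomial ⁅a, b⁆ (m + n) + (if m + n = 0 then (m : ℂ) * form a b else 0) • central := by
  rw [LieAlgebra.bracket_ofTwoCocycle, monomial, monomial, monomial, central,
    ← LieAlgebra.of_smul, ← LieAlgebra.of_add]
  refine congrArg _ ?_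
  simp only [Equiv.symm_apply_apply, loopMonomial_lie, lie_zero, add_zero, sub_zero,
    Prod.smul_mk, smul_zero, Prod.mk_add_mk, zero_add, ← map_smul, smul_eq_mul, mul_one]
  rw [← residue_monomial]
  rfl

theorem lie_central (x : Affine) : ⁅x, central⁆ = 0 := by
  rw [LieAlgebra.bracket_ofTwoCocycle, central, ← LieAlgebra.of_zero]
  refine congrArg _ ?_
  simp [LieModule.IsTrivial.trivial]

/-! ### Subalgebras -/

/-- The subalgebra `span {x_α ⊗ t^m | m ∈ S}` of `𝔤̂`. -/
def nilSub (S : Set ℤ) : LieSubalgebra ℂ Affine where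
  toSubmodule := Submodule.span ℂ (monomial xAlpha '' S)
  lie_mem' {x y} hx hy := by
    have key : ⁅x, y⁆ = 0 := by
      refine Submodule.span_induction ?_ (zero_lie y) (fun u v _ _ hu hv => ?_)
        (fun c u _ hu => ?_) hx
      · rintro _ ⟨m, -, rfl⟩
        refine Submodule.span_induction ?_ (lie_zero _) (fun u v _ _ hu hv => ?_)
          (fun c u _ hu => ?_) hy
        · rintro _ ⟨n, -, rfl⟩
          have h : form xAlpha xAlpha = 0 := by
            simp [form_apply, xAlpha]
          rw [lie_monomial, lie_self, h]
          simp [monomial, loopMonomial, ← Prod.zero_eq_mk]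
        · rw [lie_add, hu, hv, add_zero]
        · rw [lie_smul, hu, smul_zero]
      · rw [add_lie, hu, hv, add_zero]
      · rw [smul_lie, hu, smul_zero]
    rw [key]
    exact Submodule.zero_mem _

/-- The spanning set `{a ⊗ t^m | a ∈ 𝔤, m ≥ 0} ∪ {k}` of `𝔤̂_{≥ 0}`. -/
def nonnegGenerators : Set Affine := {x | ∃ a : Sl2, ∃ m : ℤ, 0 ≤ m ∧ x = monomial a m} ∪ {central}

/-- The subalgebra `𝔤̂_{≥ 0} = 𝔤 ⊗ ℂ[t] ⊕ ℂ k`. -/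
def nonneg : LieSubalgebra ℂ Affine where
  toSubmodule := Submodule.span ℂ nonnegGenerators
  lie_mem' {x y} hx hy := by
    refine Submodule.span_induction₂ (p := fun x y _ _ => ⁅x, y⁆ ∈ Submodule.span ℂ nonnegGenerators)
      ?_ ?_ ?_ ?_ ?_ ?_ ?_ hx hy
    · rintro x y (⟨a, m, hm, rfl⟩ | rfl) (⟨b, n, hn, rfl⟩ | rfl)
      · rw [lie_monomial]
        exact Submodule.add_mem _
          (Submodule.subset_span (Or.inl ⟨_, _, add_nonneg hm hn, rfl⟩))
          (Submodule.smul_mem _ _ (Submodule.subset_span (Or.inr rfl)))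
      · rw [lie_central]; exact Submodule.zero_mem _
      · rw [← lie_skew, lie_central, neg_zero]; exact Submodule.zero_mem _
      · rw [lie_central]; exact Submodule.zero_mem _
    · intro y _; rw [zero_lie]; exact Submodule.zero_mem _
    · intro y _; rw [lie_zero]; exact Submodule.zero_mem _
    · intro x y z _ _ _ h h'; rw [add_lie]; exact Submodule.add_mem _ h h'
    · intro x y z _ _ _ h h'; rw [lie_add]; exact Submodule.add_mem _ h h'
    · intro c x y _ _ h; rw [smul_lie]; exact Submodule.smul_mem _ _ h
    · intro c x y _ _ h; rw [lie_smul]; exact Submodule.smul_mem _ _ h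

/-! ### Universal enveloping algebras -/

/-- `U(𝔤̂)`. -/
abbrev UAffine : Type := UniversalEnvelopingAlgebra ℂ Affine

/-- The algebra map `U(𝔰) → U(𝔤̂)` induced by the inclusion of a subalgebra `𝔰`. -/
def inclU (s : LieSubalgebra ℂ Affine) : UniversalEnvelopingAlgebra ℂ s →ₐ[ℂ] UAffine :=
  UniversalEnvelopingAlgebra.lift ℂ ((UniversalEnvelopingAlgebra.ι ℂ).comp s.incl)

/-- The algebra map `U(𝔰) → U(𝔰')` induced by an inclusion `𝔰 ≤ 𝔰'` of subalgebras. -/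
def inclULe {s s' : LieSubalgebra ℂ Affine} (h : s ≤ s') :
    UniversalEnvelopingAlgebra ℂ s →ₐ[ℂ] UniversalEnvelopingAlgebra ℂ s' :=
  UniversalEnvelopingAlgebra.lift ℂ
    ((UniversalEnvelopingAlgebra.ι ℂ).comp (LieSubalgebra.inclusion h))

theorem inclU_inclULe {s s' : LieSubalgebra ℂ Affine} (h : s ≤ s')
    (a : UniversalEnvelopingAlgebra ℂ s) : inclU s' (inclULe h a) = inclU s a := by
  have : (inclU s').comp (inclULe h) = inclU s := by
    apply UniversalEnvelopingAlgebra.hom_ext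
    ext x
    simp only [LieHom.coe_comp, Function.comp_apply, AlgHom.coe_toLieHom, AlgHom.coe_comp,
      inclU, inclULe, UniversalEnvelopingAlgebra.lift_ι_apply]
    rfl
  exact DFunLike.congr_fun this a

/-! ### Level one generalized Verma modules and their irreducible quotients -/

/-- The value at `t = 0` of the loop part of an element of `𝔤̂`, i.e. the coefficient of `t^0`. -/
def coeffZero : Affine →ₗ[ℂ] Sl2 where
  toFun x := LieAlgebra.LoopAlgebra.toFinsupp ℂ ℤ Sl2 ((LieAlgebra.ofProd cocycle).symm x).1 0
  map_add' x y := by simp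
  map_smul' c x := by simp

/-- The coefficient of `k` in an element of `𝔤̂`. -/
def coeffCentral : Affine →ₗ[ℂ] ℂ where
  toFun x := TrivialLieModule.equiv ℂ Loop ℂ ((LieAlgebra.ofProd cocycle).symm x).2
  map_add' x y := by simp
  map_smul' c x := by simp

theorem coeffZero_monomial (a : Sl2) (m : ℤ) :
    coeffZero (monomial a m) = if m = 0 then a else 0 := by
  change LieAlgebra.LoopAlgebra.toFinsupp ℂ ℤ Sl2 (loopMonomial a m) 0 = _
  rw [toFinsupp_loopMonomial, Finsupp.single_apply]

theorem coeffZero_central : coeffZero central = 0 := by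
  change LieAlgebra.LoopAlgebra.toFinsupp ℂ ℤ Sl2 0 0 = _
  simp

theorem coeffCentral_monomial (a : Sl2) (m : ℤ) : coeffCentral (monomial a m) = 0 := by
  change TrivialLieModule.equiv ℂ Loop ℂ 0 = _
  simp

theorem coeffCentral_central : coeffCentral central = 1 := by
  change TrivialLieModule.equiv ℂ Loop ℂ ((TrivialLieModule.equiv ℂ Loop ℂ).symm 1) = _
  simp

theorem coeff_lie {x y : Affine} (hx : x ∈ nonneg) (hy : y ∈ nonneg) :
    coeffZero ⁅x, y⁆ = ⁅coeffZero x, coeffZero y⁆ ∧ coeffCentral ⁅x, y⁆ = 0 := by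
  refine Submodule.span_induction₂ (p := fun x y _ _ =>
    coeffZero ⁅x, y⁆ = ⁅coeffZero x, coeffZero y⁆ ∧ coeffCentral ⁅x, y⁆ = 0)
      ?_ ?_ ?_ ?_ ?_ ?_ ?_ hx hy
  · rintro x y (⟨a, m, hm, rfl⟩ | rfl) (⟨b, n, hn, rfl⟩ | rfl)
    · have h : (if m + n = 0 then (m : ℂ) * form a b else 0) = 0 := by
        split_ifs with h
        · obtain rfl : m = 0 := by omega
          simp
        · rfl
      rw [lie_monomial, h, zero_smul, add_zero, coeffZero_monomial, coeffZero_monomial,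
        coeffZero_monomial, coeffCentral_monomial]
      refine ⟨?_, rfl⟩
      split_ifs <;> first | omega | simp
    · simp [lie_central, coeffZero_central]
    · rw [← lie_skew, lie_central]; simp [coeffZero_central]
    · simp [coeffZero_central]
  · intro y _; simp
  · intro y _; simp
  · intro x y z _ _ _ h h'; simp [h.1, h.2, h'.1, h'.2]
  · intro x y z _ _ _ h h'; simp [h.1, h.2, h'.1, h'.2]
  · intro c x y _ _ h; simp [h.1, h.2]
  · intro c x y _ _ h; simp [h.1, h.2]

variable {M : Type} [AddCommGroup M] [Module ℂ M]

/-- A representation `ρ` of `𝔤` on `M`, extended to `𝔤̂_{≥ 0}`: `a ⊗ t^0` acts as `a`, `𝔤 ⊗ t ℂ[t]`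
acts trivially and `k` acts as `1`. -/
def levelOne (ρ : Sl2 →ₗ⁅ℂ⁆ Module.End ℂ M) : nonneg →ₗ⁅ℂ⁆ Module.End ℂ M where
  toFun x := ρ (coeffZero x) + coeffCentral x • 1
  map_add' x y := by simp [add_smul]; abel
  map_smul' c x := by simp [mul_smul]
  map_lie' {x y} := by
    change ρ (coeffZero ⁅x.1, y.1⁆) + coeffCentral ⁅x.1, y.1⁆ • 1 =
      ⁅ρ (coeffZero x.1) + coeffCentral x.1 • 1, ρ (coeffZero y.1) + coeffCentral y.1 • 1⁆
    rw [(coeff_lie x.2 y.2).1, (coeff_lie x.2 y.2).2, LieHom.map_lie]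
    simp only [LieRing.of_associative_ring_bracket, add_mul, mul_add, smul_mul_assoc,
      mul_smul_comm, mul_one, one_mul]
    module

/-- The action of `U(𝔤̂_{≥ 0})` on `M`. -/
def levelOneU (ρ : Sl2 →ₗ⁅ℂ⁆ Module.End ℂ M) :
    UniversalEnvelopingAlgebra ℂ nonneg →ₐ[ℂ] Module.End ℂ M :=
  UniversalEnvelopingAlgebra.lift ℂ (levelOne ρ)

/-- The relations `u b ⊗ m = u ⊗ b m`, `b ∈ U(𝔤̂_{≥ 0})`, which turn `U(𝔤̂) ⊗_ℂ M` into
`U(𝔤̂) ⊗_{U(𝔤̂_{≥ 0})} M`. -/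
def balanced (ρ : Sl2 →ₗ⁅ℂ⁆ Module.End ℂ M) : Submodule UAffine (UAffine ⊗[ℂ] M) :=
  Submodule.span UAffine {z | ∃ (u : UAffine) (b : UniversalEnvelopingAlgebra ℂ nonneg) (m : M),
    z = (u * inclU nonneg b) ⊗ₜ[ℂ] m - u ⊗ₜ[ℂ] levelOneU ρ b m}

/-- The generalized Verma module `U(𝔤̂) ⊗_{U(𝔤̂_{≥ 0})} M` of level one. -/
abbrev GenVerma (ρ : Sl2 →ₗ⁅ℂ⁆ Module.End ℂ M) : Type := (UAffine ⊗[ℂ] M) ⧸ balanced ρ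

/-- The vector `1 ⊗ w` of the generalized Verma module. -/
def GenVerma.vec (ρ : Sl2 →ₗ⁅ℂ⁆ Module.End ℂ M) (w : M) : GenVerma ρ :=
  Submodule.Quotient.mk (1 ⊗ₜ[ℂ] w)

/-- The sum of all proper submodules; for a generalized Verma module induced from an irreducible
`𝔤`-module it is the maximal proper submodule. -/
def maxProper (ρ : Sl2 →ₗ⁅ℂ⁆ Module.End ℂ M) : Submodule UAffine (GenVerma ρ) :=
  sSup {S | S ≠ ⊤}

/-- The irreducible quotient of a generalized Verma module. -/
abbrev Standard (ρ : Sl2 →ₗ⁅ℂ⁆ Module.End ℂ M) : Type := GenVerma ρ ⧸ maxProper ρ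

/-- The canonical projection of a generalized Verma module onto its irreducible quotient. -/
def toStandard (ρ : Sl2 →ₗ⁅ℂ⁆ Module.End ℂ M) : GenVerma ρ →ₗ[UAffine] Standard ρ :=
  (maxProper ρ).mkQ

/-- The trivial one-dimensional representation of `𝔤`. -/
def trivialRep : Sl2 →ₗ⁅ℂ⁆ Module.End ℂ ℂ := 0

/-- The two-dimensional irreducible representation of `𝔤`, on column vectors. -/
def vectorRep : Sl2 →ₗ⁅ℂ⁆ Module.End ℂ (Fin 2 → ℂ) :=
  (lieEquivMatrix' (R := ℂ) (n := Fin 2)).symm.toLieHom.comp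
    (LieAlgebra.SpecialLinear.sl (Fin 2) ℂ).incl

theorem vectorRep_apply (a : Sl2) (w : Fin 2 → ℂ) : vectorRep a w = a.1.mulVec w := by
  simp [vectorRep]

/-- `N(Λ₀)`. -/
abbrev N0 : Type := GenVerma trivialRep

/-- `N(Λ₁)`. -/
abbrev N1 : Type := GenVerma vectorRep

/-- The highest weight vector of `N(Λ₀)`. -/
def vN0 : N0 := GenVerma.vec trivialRep 1

/-- The highest weight vector of `N(Λ₁)`; `![1, 0]` is the highest weight vector for `𝔰𝔩(2)`. -/
def vN1 : N1 := GenVerma.vec vectorRep ![1, 0]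

/-- The standard module `L(Λ₀)`. -/
abbrev L0 : Type := Standard trivialRep

/-- The standard module `L(Λ₁)`. -/
abbrev L1 : Type := Standard vectorRep

/-- The projection `Π_{Λ₀} : N(Λ₀) → L(Λ₀)`. -/
def Pi0 : N0 →ₗ[UAffine] L0 := toStandard trivialRep

/-- The projection `Π_{Λ₁} : N(Λ₁) → L(Λ₁)`. -/
def Pi1 : N1 →ₗ[UAffine] L1 := toStandard vectorRep

/-- `N¹(Λ₀) = Ker Π_{Λ₀}`, as a subspace of `N(Λ₀)`. -/
def kerPi0 : Submodule ℂ N0 := (LinearMap.ker Pi0).restrictScalars ℂ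

/-- `N¹(Λ₁) = Ker Π_{Λ₁}`, as a subspace of `N(Λ₁)`. -/
def kerPi1 : Submodule ℂ N1 := (LinearMap.ker Pi1).restrictScalars ℂ

/-- The highest weight vector of `L(Λ₀)`. -/
def v0 : L0 := Pi0 vN0

/-- The highest weight vector of `L(Λ₁)`. -/
def v1 : L1 := Pi1 vN1

/-! ### Principal subspaces -/

section Principal

variable {V V' : Type} [AddCommGroup V] [Module ℂ V] [Module UAffine V]
  [IsScalarTower ℂ UAffine V] [AddCommGroup V'] [Module ℂ V'] [Module UAffine V']
  [IsScalarTower ℂ UAffine V']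

/-- The map `U(𝔤̂) → V`, `a ↦ a · v`. -/
def actOn (v : V) : UAffine →ₗ[ℂ] V := (LinearMap.toSpanSingleton UAffine V v).restrictScalars ℂ

/-- The subspace `U(𝔰) · v` of `V`. -/
def orbit (s : LieSubalgebra ℂ Affine) (v : V) : Submodule ℂ V :=
  LinearMap.range (actOn v ∘ₗ (inclU s).toLinearMap)

/-- The map `U(𝔰) → U(𝔰') · v`, `a ↦ a · v`, for subalgebras `𝔰 ≤ 𝔰'`. -/
def orbitMap {s s' : LieSubalgebra ℂ Affine} (h : s ≤ s') (v : V) :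
    UniversalEnvelopingAlgebra ℂ s →ₗ[ℂ] orbit s' v :=
  (actOn v ∘ₗ (inclU s).toLinearMap).codRestrict (orbit s' v) fun a =>
    ⟨inclULe h a, congrArg (actOn v) (inclU_inclULe h a)⟩

/-- The restriction `U(𝔰) · v → U(𝔰') · P v` of a `𝔤̂`-module map `P`, for subalgebras `𝔰 ≤ 𝔰'`. -/
def orbitProj {s s' : LieSubalgebra ℂ Affine} (h : s ≤ s') (P : V →ₗ[UAffine] V') (v : V) :
    orbit s v →ₗ[ℂ] orbit s' (P v) :=
  (P.restrictScalars ℂ).restrict fun x hx => by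
    obtain ⟨a, rfl⟩ := hx
    exact ⟨inclULe h a, by
      simp [actOn, inclU_inclULe h a]⟩

end Principal

/-- `𝔫̄ = 𝔫 ⊗ ℂ[t, t⁻¹]`. -/
abbrev nBar : LieSubalgebra ℂ Affine := nilSub Set.univ

/-- `𝔫̄_{≤ j} = 𝔫 ⊗ t^j ℂ[t⁻¹]`; in particular `𝔫̄₋ = 𝔫̄_{≤ -1}`. -/
abbrev nLe (j : ℤ) : LieSubalgebra ℂ Affine := nilSub (Set.Iic j)

theorem nLe_le_nBar (j : ℤ) : nLe j ≤ nBar :=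
  Submodule.span_mono (Set.image_mono (Set.subset_univ _))

/-- The map `f_{Λ₀} : U(𝔫̄₋) → W(Λ₀) = U(𝔫̄) · v_{Λ₀}`. -/
def f0 : UniversalEnvelopingAlgebra ℂ (nLe (-1)) →ₗ[ℂ] orbit nBar v0 :=
  orbitMap (nLe_le_nBar (-1)) v0

/-- The map `f_{Λ₁} : U(𝔫̄₋) → W(Λ₁) = U(𝔫̄) · v_{Λ₁}`. -/
def f1 : UniversalEnvelopingAlgebra ℂ (nLe (-1)) →ₗ[ℂ] orbit nBar v1 :=
  orbitMap (nLe_le_nBar (-1)) v1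

/-- The map `f'_{Λ₁} : U(𝔫̄_{≤ -2}) → W(Λ₁)' = U(𝔫̄_{≤ -2}) · v_{Λ₁}`. -/
def f1' : UniversalEnvelopingAlgebra ℂ (nLe (-2)) →ₗ[ℂ] orbit (nLe (-2)) v1 :=
  orbitMap le_rfl v1

/-- The map `U(𝔫̄₋) → W^N(Λ₀) = U(𝔫̄) · v^N_{Λ₀}`. -/
def fN0 : UniversalEnvelopingAlgebra ℂ (nLe (-1)) →ₗ[ℂ] orbit nBar vN0 :=
  orbitMap (nLe_le_nBar (-1)) vN0

/-- The map `U(𝔫̄₋) → W^N(Λ₁) = U(𝔫̄) · v^N_{Λ₁}`. -/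
def fN1 : UniversalEnvelopingAlgebra ℂ (nLe (-1)) →ₗ[ℂ] orbit nBar vN1 :=
  orbitMap (nLe_le_nBar (-1)) vN1

/-- The map `U(𝔫̄_{≤ -2}) → W^N(Λ₁)' = U(𝔫̄_{≤ -2}) · v^N_{Λ₁}`. -/
def fN1' : UniversalEnvelopingAlgebra ℂ (nLe (-2)) →ₗ[ℂ] orbit (nLe (-2)) vN1 :=
  orbitMap le_rfl vN1

/-- The projection `π_{Λ₀} : W^N(Λ₀) → W(Λ₀)`. -/
def pi0 : orbit nBar vN0 →ₗ[ℂ] orbit nBar v0 := orbitProj le_rfl Pi0 vN0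

/-- The projection `π_{Λ₁} : W^N(Λ₁) → W(Λ₁)`. -/
def pi1 : orbit nBar vN1 →ₗ[ℂ] orbit nBar v1 := orbitProj le_rfl Pi1 vN1

/-- The projection `π'_{Λ₁} : W^N(Λ₁)' → W(Λ₁)`. -/
def pi1' : orbit (nLe (-2)) vN1 →ₗ[ℂ] orbit nBar v1 := orbitProj (nLe_le_nBar (-2)) Pi1 vN1

/-! ### The ideals -/

/-- The generator `x_α(m) = x_α ⊗ t^m`, `m ≤ j`, of `U(𝔫̄_{≤ j})`. -/
def gen (j m : ℤ) (h : m ≤ j) : UniversalEnvelopingAlgebra ℂ (nLe j) :=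
  UniversalEnvelopingAlgebra.ι ℂ ⟨monomial xAlpha m, Submodule.subset_span ⟨m, h, rfl⟩⟩

/-- The element `∑ x_α(m₁) x_α(m₂)` of `U(𝔫̄_{≤ j})`, the sum over all `m₁, m₂ ≤ j` with
`m₁ + m₂ = -t`; that is, over `-t - j ≤ m₁ ≤ j` with `m₂ = -t - m₁`. -/
def quad (j t : ℤ) : UniversalEnvelopingAlgebra ℂ (nLe j) :=
  ∑ m ∈ (Finset.Icc (-t - j) j).attach,
    gen j m.1 (Finset.mem_Icc.1 m.2).2 *
      gen j (-t - m.1) (by have := (Finset.mem_Icc.1 m.2).1; omega)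

/-- `R⁰_t ∈ U(𝔫̄₋)`. -/
def R0 (t : ℤ) : UniversalEnvelopingAlgebra ℂ (nLe (-1)) := quad (-1) t

/-- `R¹_t ∈ U(𝔫̄_{≤ -2})`. -/
def R1 (t : ℤ) : UniversalEnvelopingAlgebra ℂ (nLe (-2)) := quad (-2) t

/-- The ideal `I_{Λ₀} = ∑_{t ≥ 2} U(𝔫̄₋) R⁰_t`. -/
def I0 : Ideal (UniversalEnvelopingAlgebra ℂ (nLe (-1))) := Ideal.span (R0 '' Set.Ici 2)

/-- The ideal `I_{Λ₁} = ∑_{t ≥ 2} U(𝔫̄₋) R⁰_t + U(𝔫̄₋) x_α(-1)`. -/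
def I1 : Ideal (UniversalEnvelopingAlgebra ℂ (nLe (-1))) :=
  Ideal.span (R0 '' Set.Ici 2) ⊔ Ideal.span {gen (-1) (-1) le_rfl}

/-- The ideal `I'_{Λ₁} = ∑_{t ≥ 4} U(𝔫̄_{≤ -2}) R¹_t`. -/
def I1' : Ideal (UniversalEnvelopingAlgebra ℂ (nLe (-2))) := Ideal.span (R1 '' Set.Ici 4)

/-- `I_{Λ₀} · v^N_{Λ₀}`, a subspace of `W^N(Λ₀)`. -/
def I0vN : Submodule ℂ (orbit nBar vN0) := (I0.restrictScalars ℂ).map fN0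

/-- `I_{Λ₁} · v^N_{Λ₁}`, a subspace of `W^N(Λ₁)`. -/
def I1vN : Submodule ℂ (orbit nBar vN1) := (I1.restrictScalars ℂ).map fN1

/-- `I'_{Λ₁} · v^N_{Λ₁}`, a subspace of `W^N(Λ₁)'`. -/
def I1'vN : Submodule ℂ (orbit (nLe (-2)) vN1) := (I1'.restrictScalars ℂ).map fN1'

end AffineSl2

end

/-! Both level one modules are realized in one fermionic Fock space. Two components of charged free
fermions give currents `J` spanning the affine 𝔤𝔩(2) at level one, and L(Λ₀), L(Λ₁) are the
submodules generated by `vac` and by `P 0 1 vac`. To see this, map each generalized Verma module to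
Fock space. A truncated Casimir operator separates energies, so a proper submodule meets no energy
zero component (`le_of_ne_top`). The currents are unitary for a positive definite Hermitian form, so
such a submodule is orthogonal to the image of the whole module, hence maps to zero
(`IsTop.le_ker`). The kernel is therefore the maximal proper submodule, and annihilators of v_Λ can
be computed in Fock space.

The quadratic relations hold because on the vacuum the field x_α(z) acts as a product of two
anticommuting fermion fields, and the square of such a product is zero (`sum_rootCreate`,
`sum_J_vac`).

There are no other relations because of the translation operators `trans 0` and `trans 1`, which
shift the modes of x_α by one in opposite directions. In the polynomial ring with `X k` standing for
x_α(-1-k), they show that the annihilator K of the vacuum is stable under lowering the indices, and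
that c X₀ ∈ K forces `down (down c)` ∈ K. By induction on the degree, an ideal with these properties
that contains the relations and no nonzero constant is the ideal of relations (`le_relIdeal`,
`vacIdeal_eq`). The algebraic input is that c X₀ is a combination of relations as soon as `down
(down c)` is (`mul_X_zero_mem`).

For Λ₁, `trans 0` carries `P 0 1 vac` to `vac` while lowering indices, so the annihilator is the
preimage of the ideal of relations under `down`, that is, the relations together with X₀
(`fockPoly_P_vac_eq_zero`). On modes at most -2 this is the Λ₀ answer shifted by one. The statements
on the Verma side follow formally, since the nonnegative modes of x_α kill the highest weight
vectors (`orbit_nBar_le`, `ker_orbitProj`). -/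

noncomputable section

namespace AffineSl2

/-! ### Fermionic Fock space -/

/-- The one-particle states: a component in `Fin 2` and an energy level, ordered
lexicographically. -/
abbrev Site : Type := Fin 2 ×ₗ ℤ

/-- The site of component `a` and level `i`. -/
abbrev site (a : Fin 2) (i : ℤ) : Site := toLex (a, i)

theorem site_inj {a b : Fin 2} {i j : ℤ} : site a i = site b j ↔ a = b ∧ i = j := by
  simp [site]

/-- Fermionic Fock space, with a basis indexed by finite sets of excitations. -/
def Fock : Type := Finset Site →₀ ℂ

instance : AddCommGroup Fock := inferInstanceAs (AddCommGroup (Finset Site →₀ ℂ))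
instance : Module ℂ Fock := inferInstanceAs (Module ℂ (Finset Site →₀ ℂ))

/-- The coordinate with index `D`. -/
def coord (D : Finset Site) : Fock →ₗ[ℂ] ℂ :=
  Finsupp.lapply (R := ℂ) (M := ℂ) (α := Finset Site) D

theorem Fock.ext {x y : Fock} (h : ∀ D, coord D x = coord D y) : x = y := Finsupp.ext h

theorem exists_coord_support (x : Fock) :
    ∃ s : Finset (Finset Site), ∀ D ∉ s, coord D x = 0 :=
  ⟨Finsupp.support (M := ℂ) x, fun _ h => Finsupp.notMem_support_iff.1 h⟩

/-- The basis vector indexed by `D`. -/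
def state (D : Finset Site) : Fock := Finsupp.single D (1 : ℂ)

/-- The vacuum. -/
def vac : Fock := state ∅

/-- The linear map with prescribed values on the basis. -/
def Fock.lift {V : Type*} [AddCommGroup V] [Module ℂ V] (f : Finset Site → V) : Fock →ₗ[ℂ] V :=
  Finsupp.linearCombination ℂ f

@[simp]
theorem Fock.lift_state {V : Type*} [AddCommGroup V] [Module ℂ V] (f : Finset Site → V)
    (D : Finset Site) : Fock.lift f (state D) = f D :=
  (Finsupp.linearCombination_single ℂ (1 : ℂ) D).trans (one_smul _ _)

theorem Fock.hom_ext {V : Type*} [AddCommGroup V] [Module ℂ V] {f g : Fock →ₗ[ℂ] V}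
    (h : ∀ D, f (state D) = g (state D)) : f = g :=
  Finsupp.lhom_ext' fun D => LinearMap.ext_ring (h D)

theorem Fock.span_state : Submodule.span ℂ (Set.range state) = ⊤ := by
  rw [eq_top_iff]
  rintro x -
  induction x using Finsupp.induction_linear with
  | zero => exact Submodule.zero_mem _
  | add x y hx hy => exact Submodule.add_mem _ hx hy
  | single D c =>
    rw [show (Finsupp.single D c : Fock) = c • state D from
      (Finsupp.smul_single_one D c).symm]
    exact Submodule.smul_mem _ _ (Submodule.subset_span ⟨D, rfl⟩)

/-- The Jordan–Wigner sign. -/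
def sgn (n : Site) (D : Finset Site) : ℂ := (-1) ^ (D.filter (· < n)).card

theorem sgn_mul_self (n : Site) (D : Finset Site) : sgn n D * sgn n D = 1 := by
  rw [sgn, ← mul_pow]; simp

theorem sgn_insert {m n : Site} {D : Finset Site} (hm : m ∉ D) :
    sgn n (insert m D) = if m < n then -sgn n D else sgn n D := by
  unfold sgn
  rw [Finset.filter_insert]
  split_ifs with h
  · rw [Finset.card_insert_of_notMem (by simp [hm]), pow_succ]; ring
  · rfl

theorem sgn_erase {m n : Site} {D : Finset Site} (hm : m ∈ D) :
    sgn n (D.erase m) = if m < n then -sgn n D else sgn n D := by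
  conv_rhs => rw [← Finset.insert_erase hm, sgn_insert (Finset.notMem_erase m D)]
  split_ifs <;> simp

/-- The creation operator at the site `n`. -/
def cre (n : Site) : Module.End ℂ Fock :=
  Fock.lift fun D => if n ∈ D then 0 else sgn n D • state (insert n D)

/-- The annihilation operator at the site `n`. -/
def ann (n : Site) : Module.End ℂ Fock :=
  Fock.lift fun D => if n ∈ D then sgn n D • state (D.erase n) else 0

theorem cre_state_of_mem {n : Site} {D : Finset Site} (h : n ∈ D) : cre n (state D) = 0 := by
  simp [cre, h]

theorem cre_state {n : Site} {D : Finset Site} (h : n ∉ D) :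
    cre n (state D) = sgn n D • state (insert n D) := by
  simp [cre, h]

theorem ann_state_of_notMem {n : Site} {D : Finset Site} (h : n ∉ D) : ann n (state D) = 0 := by
  simp [ann, h]

theorem ann_state {n : Site} {D : Finset Site} (h : n ∈ D) :
    ann n (state D) = sgn n D • state (D.erase n) := by
  simp [ann, h]

theorem cre_mul_cre (m n : Site) : cre m * cre n = -(cre n * cre m) := by
  refine Fock.hom_ext fun D => ?_
  simp only [Module.End.mul_apply, LinearMap.neg_apply]
  by_cases hm : m ∈ D
  · rw [cre_state_of_mem hm, map_zero, neg_zero]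
    by_cases hn : n ∈ D
    · rw [cre_state_of_mem hn, map_zero]
    · rw [cre_state hn, map_smul, cre_state_of_mem (by simp [hm]), smul_zero]
  by_cases hn : n ∈ D
  · rw [cre_state_of_mem hn, map_zero, cre_state hm, map_smul, cre_state_of_mem (by simp [hn]),
      smul_zero, neg_zero]
  rcases eq_or_ne m n with rfl | hmn
  · rw [cre_state hn, map_smul, cre_state_of_mem (by simp), smul_zero, neg_zero]
  rw [cre_state hn, map_smul, cre_state (by simp [hm, hmn]), cre_state hm, map_smul,
    cre_state (by simp [hn, hmn.symm]), sgn_insert hn, sgn_insert hm, Finset.insert_comm,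
    smul_smul, smul_smul, ← neg_smul]
  congr 1
  rcases lt_or_gt_of_ne hmn with h | h
  · rw [if_neg h.asymm, if_pos h]; ring
  · rw [if_neg h.asymm, if_pos h]; ring

theorem ann_mul_cre (m n : Site) :
    ann m * cre n = (if m = n then 1 else 0) - cre n * ann m := by
  rcases eq_or_ne m n with rfl | hmn
  · rw [if_pos rfl]
    refine Fock.hom_ext fun D => ?_
    simp only [Module.End.mul_apply, LinearMap.sub_apply, Module.End.one_apply]
    by_cases hm : m ∈ D
    · rw [cre_state_of_mem hm, ann_state hm, map_zero, map_smul, cre_state (by simp),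
        Finset.insert_erase hm, sgn_erase hm, if_neg (lt_irrefl m), smul_smul, sgn_mul_self,
        one_smul, sub_self]
    · rw [cre_state hm, ann_state_of_notMem hm, map_smul, ann_state (by simp),
        Finset.erase_insert hm, sgn_insert hm, if_neg (lt_irrefl m), smul_smul, sgn_mul_self,
        one_smul, map_zero, sub_zero]
  · rw [if_neg hmn]
    rw [zero_sub]
    refine Fock.hom_ext fun D => ?_
    simp only [Module.End.mul_apply, LinearMap.neg_apply]
    by_cases hn : n ∈ D
    · rw [cre_state_of_mem hn, map_zero]
      by_cases hm : m ∈ D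
      · rw [ann_state hm, map_smul, cre_state_of_mem (by simp [hn, hmn.symm]), smul_zero, neg_zero]
      · rw [ann_state_of_notMem hm, map_zero, neg_zero]
    · rw [cre_state hn, map_smul]
      by_cases hm : m ∈ D
      · rw [ann_state hm, map_smul, ann_state (by simp [hm]), cre_state (by simp [hn]),
          sgn_insert hn, sgn_erase hm, Finset.erase_insert_of_ne hmn.symm, smul_smul, smul_smul,
          ← neg_smul]
        congr 1
        rcases lt_or_gt_of_ne hmn with h | h
        · rw [if_neg h.asymm, if_pos h]; ring
        · rw [if_neg h.asymm, if_pos h]; ring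
      · rw [ann_state_of_notMem hm, ann_state_of_notMem (by simp [hm, hmn]), map_zero, smul_zero,
          neg_zero]

/-! ### The Hermitian form -/

/-- The Hermitian form for which the basis states are orthonormal. -/
def herm (x y : Fock) : ℂ := ∑ᶠ D, star (coord D x) * coord D y

theorem herm_eq_sum {x : Fock} (y : Fock) {s : Finset (Finset Site)}
    (hs : ∀ D ∉ s, coord D x = 0) :
    herm x y = ∑ D ∈ s, star (coord D x) * coord D y :=
  finsum_eq_sum_of_support_subset _ fun D hD => by
    by_contra h
    exact hD (by simp [hs D h])

theorem herm_add_left (x x' y : Fock) : herm (x + x') y = herm x y + herm x' y := by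
  classical
  obtain ⟨s, hs⟩ := exists_coord_support x
  obtain ⟨t, ht⟩ := exists_coord_support x'
  rw [herm_eq_sum (s := s ∪ t) y, herm_eq_sum (s := s ∪ t) y, herm_eq_sum (s := s ∪ t) y,
    ← Finset.sum_add_distrib]
  · simp only [map_add, star_add, add_mul]
  all_goals intro D hD; simp only [Finset.mem_union, not_or] at hD; simp [hs D, ht D, hD]

theorem herm_smul_left (c : ℂ) (x y : Fock) : herm (c • x) y = star c * herm x y := by
  obtain ⟨s, hs⟩ := exists_coord_support x
  rw [herm_eq_sum y hs, herm_eq_sum (s := s) y fun D hD => by simp [hs D hD], Finset.mul_sum]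
  refine Finset.sum_congr rfl fun D _ => ?_
  rw [map_smul, smul_eq_mul, star_mul]; ring

theorem herm_zero_left (y : Fock) : herm 0 y = 0 := by simp [herm]

theorem herm_add_right (x y z : Fock) : herm x (y + z) = herm x y + herm x z := by
  obtain ⟨s, hs⟩ := exists_coord_support x
  simp only [herm_eq_sum _ hs, map_add, mul_add, Finset.sum_add_distrib]

theorem herm_smul_right (c : ℂ) (x y : Fock) : herm x (c • y) = c * herm x y := by
  obtain ⟨s, hs⟩ := exists_coord_support x
  simp only [herm_eq_sum _ hs, map_smul, smul_eq_mul, Finset.mul_sum]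
  exact Finset.sum_congr rfl fun D _ => by ring

theorem herm_zero_right (x : Fock) : herm x 0 = 0 := by simp [herm]

theorem coord_state (D E : Finset Site) : coord D (state E) = if E = D then 1 else 0 :=
  Finsupp.single_apply

theorem herm_state_left (D : Finset Site) (y : Fock) : herm (state D) y = coord D y := by
  rw [herm_eq_sum (s := {D}) y fun E hE => ?_]
  · simp [coord_state]
  · rw [coord_state, if_neg]; rintro rfl; simp at hE

theorem herm_state (D E : Finset Site) : herm (state D) (state E) = if E = D then 1 else 0 := by
  rw [herm_state_left, coord_state]

theorem herm_conj (x y : Fock) : star (herm x y) = herm y x := by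
  classical
  obtain ⟨s, hs⟩ := exists_coord_support x
  obtain ⟨t, ht⟩ := exists_coord_support y
  rw [herm_eq_sum (x := x) (s := s ∪ t) y, herm_eq_sum (x := y) (s := s ∪ t) x, star_sum]
  · exact Finset.sum_congr rfl fun D _ => by rw [star_mul, star_star]
  all_goals intro D hD; simp only [Finset.mem_union, not_or] at hD; simp [hs D, ht D, hD]

/-- Positivity is what makes the image of a generalized Verma module in Fock space irreducible; it
is used at the end of `IsTop.le_ker`. -/
theorem eq_zero_of_herm_self {x : Fock} (h : herm x x = 0) : x = 0 := by
  obtain ⟨s, hs⟩ := exists_coord_support x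
  have key : ((∑ D ∈ s, Complex.normSq (coord D x) : ℝ) : ℂ) = 0 := by
    rw [← h, herm_eq_sum x hs]
    push_cast
    exact Finset.sum_congr rfl fun D _ => Complex.normSq_eq_conj_mul_self
  have key' := Complex.ofReal_eq_zero.1 key
  rw [Finset.sum_eq_zero_iff_of_nonneg fun _ _ => Complex.normSq_nonneg _] at key'
  refine Fock.ext fun D => ?_
  by_cases hD : D ∈ s
  · simpa using Complex.normSq_eq_zero.1 (key' D hD)
  · simpa using hs D hD

theorem eq_of_herm {x y : Fock} (h : ∀ D, herm (state D) x = herm (state D) y) : x = y :=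
  Fock.ext fun D => by rw [← herm_state_left, ← herm_state_left, h]

/-- `B` is the adjoint of `A`. -/
def IsAdj (A B : Module.End ℂ Fock) : Prop := ∀ x y, herm (A x) y = herm x (B y)

theorem isAdj_of_state {A B : Module.End ℂ Fock}
    (h : ∀ D E, herm (A (state D)) (state E) = herm (state D) (B (state E))) : IsAdj A B := by
  intro x y
  have hx : x ∈ Submodule.span ℂ (Set.range state) := Fock.span_state ▸ Submodule.mem_top
  have hy : y ∈ Submodule.span ℂ (Set.range state) := Fock.span_state ▸ Submodule.mem_top
  induction hx using Submodule.span_induction with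
  | zero => simp [herm_zero_left]
  | add u v _ _ hu hv => rw [map_add, herm_add_left, herm_add_left, hu, hv]
  | smul c u _ hu => rw [map_smul, herm_smul_left, herm_smul_left, hu]
  | mem u hu =>
    obtain ⟨D, rfl⟩ := hu
    induction hy using Submodule.span_induction with
    | zero => simp [herm_zero_right]
    | add u v _ _ hu hv => rw [map_add, herm_add_right, herm_add_right, hu, hv]
    | smul c u _ hu => rw [map_smul, herm_smul_right, herm_smul_right, hu]
    | mem u hu => obtain ⟨E, rfl⟩ := hu; exact h D E

theorem IsAdj.symm {A B : Module.End ℂ Fock} (h : IsAdj A B) : IsAdj B A := fun x y => by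
  rw [← herm_conj, ← h, herm_conj]

theorem IsAdj.mul {A B A' B' : Module.End ℂ Fock} (h : IsAdj A B) (h' : IsAdj A' B') :
    IsAdj (A * A') (B' * B) := fun x y => by
  simp only [Module.End.mul_apply]; rw [h, h']

theorem IsAdj.neg {A B : Module.End ℂ Fock} (h : IsAdj A B) : IsAdj (-A) (-B) := fun x y => by
  rw [← neg_one_smul ℂ A, ← neg_one_smul ℂ B]
  simp only [LinearMap.smul_apply, herm_smul_left, herm_smul_right, h x y]; simp

theorem isAdj_cre_ann (n : Site) : IsAdj (cre n) (ann n) := by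
  refine isAdj_of_state fun D E => ?_
  by_cases hD : n ∈ D
  · rw [cre_state_of_mem hD, herm_zero_left]
    by_cases hE : n ∈ E
    · rw [ann_state hE, herm_smul_right, herm_state, if_neg, mul_zero]
      rintro rfl; simp at hD
    · rw [ann_state_of_notMem hE, herm_zero_right]
  · rw [cre_state hD, herm_smul_left, herm_state]
    by_cases hE : n ∈ E
    · rw [ann_state hE, herm_smul_right, herm_state]
      by_cases h : E = insert n D
      · subst h
        rw [if_pos rfl, if_pos (Finset.erase_insert hD), sgn_insert hD, if_neg (lt_irrefl n)]
        simp [sgn]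
      · rw [if_neg h, if_neg, mul_zero, mul_zero]
        rintro rfl; exact h (Finset.insert_erase hE).symm
    · rw [ann_state_of_notMem hE, herm_zero_right, if_neg, mul_zero]
      rintro rfl; simp at hE

/-- This is the adjoint of `cre_mul_cre`. -/
theorem ann_mul_ann (m n : Site) : ann m * ann n = -(ann n * ann m) := by
  refine LinearMap.ext fun x => eq_of_herm fun D => ?_
  have h := ((isAdj_cre_ann n).mul (isAdj_cre_ann m)) (state D) x
  have h' := ((isAdj_cre_ann m).mul (isAdj_cre_ann n)).neg (state D) x
  rw [← h, ← h', cre_mul_cre n m]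

theorem cre_mul_ann (m n : Site) :
    cre m * ann n = (if m = n then 1 else 0) - ann n * cre m := by
  rw [ann_mul_cre]; simp only [eq_comm (a := n)]; abel

/-! ### Fermion modes -/

/-- The fermion mode raising a particle of component `a` to level `i`; the levels `i ≤ 0` are
filled in the vacuum. -/
def P (a : Fin 2) (i : ℤ) : Module.End ℂ Fock :=
  if 1 ≤ i then cre (site a i) else ann (site a i)

/-- The fermion mode adjoint to `P a i`. -/
def Q (a : Fin 2) (i : ℤ) : Module.End ℂ Fock :=
  if 1 ≤ i then ann (site a i) else cre (site a i)

/-- Kronecker's delta with values in `ℂ`. -/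
def delta {α : Type*} [DecidableEq α] (a b : α) : ℂ := if a = b then 1 else 0

@[simp] theorem delta_self {α : Type*} [DecidableEq α] (a : α) : delta a a = 1 := if_pos rfl

theorem delta_of_ne {α : Type*} [DecidableEq α] {a b : α} (h : a ≠ b) : delta a b = 0 := if_neg h

theorem P_mul_P (a b : Fin 2) (i j : ℤ) : P a i * P b j = -(P b j * P a i) := by
  unfold P
  split_ifs with hi hj hj
  · exact cre_mul_cre _ _
  · rw [cre_mul_ann, if_neg, zero_sub]
    rw [site_inj]; omega
  · rw [ann_mul_cre, if_neg, zero_sub]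
    rw [site_inj]; omega
  · exact ann_mul_ann _ _

theorem Q_mul_Q (a b : Fin 2) (i j : ℤ) : Q a i * Q b j = -(Q b j * Q a i) := by
  unfold Q
  split_ifs with hi hj hj
  · exact ann_mul_ann _ _
  · rw [ann_mul_cre, if_neg, zero_sub]
    rw [site_inj]; omega
  · rw [cre_mul_ann, if_neg, zero_sub]
    rw [site_inj]; omega
  · exact cre_mul_cre _ _

/-- Filling the levels `i ≤ 0` exchanges creation and annihilation there, which preserves the
canonical anticommutation relations. When `i` and `j` lie on different sides of the cut, the sites
differ and the delta vanishes. -/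
theorem Q_mul_P (a b : Fin 2) (i j : ℤ) :
    Q a i * P b j = (delta a b * delta i j) • 1 - P b j * Q a i := by
  have hd : (if site a i = site b j then (1 : Module.End ℂ Fock) else 0) =
      (delta a b * delta i j) • 1 := by
    simp only [site_inj, delta]
    split_ifs <;> simp_all
  rw [← hd]
  by_cases hi : 1 ≤ i <;> by_cases hj : 1 ≤ j <;> simp only [P, Q, hi, hj, if_true, if_false]
  · exact ann_mul_cre _ _
  · rw [ann_mul_ann, if_neg (by rw [site_inj]; omega), zero_sub]
  · rw [cre_mul_cre, if_neg (by rw [site_inj]; omega), zero_sub]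
  · exact cre_mul_ann _ _

theorem P_vac (a : Fin 2) {i : ℤ} (hi : i ≤ 0) : P a i vac = 0 := by
  rw [P, if_neg (by omega)]; exact ann_state_of_notMem (by simp)

theorem Q_vac (a : Fin 2) {i : ℤ} (hi : 1 ≤ i) : Q a i vac = 0 := by
  rw [Q, if_pos hi]; exact ann_state_of_notMem (by simp)

theorem isAdj_P_Q (a : Fin 2) (i : ℤ) : IsAdj (P a i) (Q a i) := by
  unfold P Q
  split_ifs
  · exact isAdj_cre_ann _
  · exact (isAdj_cre_ann _).symm

/-! ### Locally finite sums of operators -/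

/-- Local finiteness of a family of operators. -/
def LocFin (T : ℤ → Module.End ℂ Fock) : Prop :=
  ∀ x, (Function.support fun i => T i x).Finite

/-- The sum of a locally finite family of operators. -/
def locSum (T : ℤ → Module.End ℂ Fock) (h : LocFin T) : Module.End ℂ Fock where
  toFun x := ∑ᶠ i, T i x
  map_add' x y := by
    simp only [map_add]; exact finsum_add_distrib (h x) (h y)
  map_smul' c x := by
    simp only [map_smul, RingHom.id_apply]; exact (smul_finsum' c (h x)).symm

theorem locSum_apply (T : ℤ → Module.End ℂ Fock) (h : LocFin T) (x : Fock) :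
    locSum T h x = ∑ᶠ i, T i x := rfl

theorem locFin_of_state {T : ℤ → Module.End ℂ Fock}
    (h : ∀ D, (Function.support fun i => T i (state D)).Finite) : LocFin T := by
  intro x
  have hx : x ∈ Submodule.span ℂ (Set.range state) := Fock.span_state ▸ Submodule.mem_top
  induction hx using Submodule.span_induction with
  | zero => simp
  | add u v _ _ hu hv =>
    refine (hu.union hv).subset fun i hi => ?_
    by_contra hc
    simp only [Set.mem_union, Function.mem_support, not_or, not_not] at hc
    exact hi (by simp [hc.1, hc.2])
  | smul c u _ hu =>
    refine hu.subset fun i hi => ?_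
    by_contra hc
    simp only [Function.mem_support, not_not] at hc
    exact hi (by simp [hc])
  | mem u hu => obtain ⟨D, rfl⟩ := hu; exact h D

theorem finsum_smul_right {f : ℤ → Fock} (c : ℂ) : ∑ᶠ i, c • f i = c • ∑ᶠ i, f i :=
  (smul_finsum c f).symm

theorem map_locSum {V : Type*} [AddCommMonoid V] (g : Fock →+ V) (T : ℤ → Module.End ℂ Fock)
    (h : LocFin T) (x : Fock) : g (locSum T h x) = ∑ᶠ i, g (T i x) := by
  rw [locSum_apply, g.map_finsum (h x)]

/-- If `A` commutes with the members of a family up to `E i`, it commutes with their sum up to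
`∑ E i`. -/
theorem locSum_comm {T E : ℤ → Module.End ℂ Fock} (h : LocFin T) {A : Module.End ℂ Fock}
    (hE : ∀ i, T i * A = A * T i + E i) (x : Fock) :
    locSum T h (A x) = A (locSum T h x) + ∑ᶠ i, E i x := by
  -- The error family inherits finite support from this difference of two finitely supported
  -- families.
  have hT : ∀ i, E i x = T i (A x) - A (T i x) := fun i => by
    have := LinearMap.congr_fun (hE i) x
    simp only [Module.End.mul_apply, LinearMap.add_apply] at this
    rw [this]; abel
  have h2 : (Function.support fun i => A (T i x)).Finite :=
    (h x).subset fun i hi hc => hi (by simp only [hc, map_zero])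
  simp only [hT]
  have h3 : A (locSum T h x) = ∑ᶠ i, A (T i x) := map_locSum A.toAddMonoidHom T h x
  rw [finsum_sub_distrib (h _) h2, ← h3, locSum_apply, add_sub_cancel]

/-! ### Currents -/

/-- The normally ordered product of `P a (i - m)` and `Q b i`. -/
def pairOp (a b : Fin 2) (m i : ℤ) : Module.End ℂ Fock :=
  if 1 ≤ i then P a (i - m) * Q b i else -(Q b i * P a (i - m))

/-- Normal ordering changes the product by a scalar only, so commutators with `pairOp` can be
computed from the plain product. -/
theorem P_mul_Q (a b : Fin 2) (m i : ℤ) :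
    P a (i - m) * Q b i =
      pairOp a b m i + (delta b a * delta m 0 * if i ≤ 0 then 1 else 0) • 1 := by
  unfold pairOp
  have hd : delta i (i - m) = delta m 0 := by
    unfold delta; congr 1; apply propext; omega
  split_ifs with h h' h'
  · omega
  · simp
  · rw [Q_mul_P, hd, mul_one]; abel
  · omega

theorem pairOp_of_ne {a b : Fin 2} (hab : b ≠ a) (m i : ℤ) :
    pairOp a b m i = P a (i - m) * Q b i := by
  rw [P_mul_Q, delta_of_ne hab]; simp

/-- A term contributes on a basis state only if `Q` or `P` finds an excitation to remove, or if both
operators create, which confines `i` to `(m, 0]`. Without normal ordering every filled level would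
contribute to the diagonal currents at `m = 0`. -/
theorem locFin_pairOp (a b : Fin 2) (m : ℤ) : LocFin (pairOp a b m) := by
  refine locFin_of_state fun D => ?_
  have h1 : {i : ℤ | site b i ∈ D}.Finite :=
    D.finite_toSet.preimage fun i _ j _ h => (site_inj.1 h).2
  have h2 : {i : ℤ | site a (i - m) ∈ D}.Finite :=
    D.finite_toSet.preimage fun i _ j _ h => by simpa using (site_inj.1 h).2
  refine ((h1.union h2).union (Set.finite_Ioc m 0)).subset fun i hi => ?_
  by_contra hc
  simp only [Set.mem_union, Set.mem_ofPred_eq, Set.mem_Ioc, not_or] at hc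
  refine hi ?_
  change pairOp a b m i (state D) = 0
  unfold pairOp
  split_ifs with h
  · rw [Module.End.mul_apply, Q, if_pos h, ann_state_of_notMem hc.1.1, map_zero]
  · rw [LinearMap.neg_apply, Module.End.mul_apply, P, if_neg (by omega),
      ann_state_of_notMem hc.1.2, map_zero, neg_zero]

/-- The current modes, generating `𝔤𝔩(2)^` at level one. -/
def J (a b : Fin 2) (m : ℤ) : Module.End ℂ Fock := locSum (pairOp a b m) (locFin_pairOp a b m)

theorem pairOp_mul_P (a b c : Fin 2) (m i k : ℤ) :
    pairOp a b m i * P c k =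
      P c k * pairOp a b m i + (delta b c * delta i k) • P a (k - m) := by
  have h : pairOp a b m i = P a (i - m) * Q b i -
      (delta b a * delta m 0 * if i ≤ 0 then 1 else 0) • 1 := by
    rw [P_mul_Q]; abel
  have h2 : P a (i - m) * Q b i * P c k =
      P c k * (P a (i - m) * Q b i) + (delta b c * delta i k) • P a (k - m) := by
    rw [mul_assoc, Q_mul_P, mul_sub, ← mul_assoc, ← mul_assoc, P_mul_P a c, mul_smul_comm, mul_one,
      neg_mul, sub_neg_eq_add, add_comm]
    congr 1
    rcases eq_or_ne i k with rfl | hik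
    · rfl
    · rw [delta_of_ne hik]; simp
  rw [h, sub_mul, mul_sub, h2]
  simp only [smul_mul_assoc, mul_smul_comm, one_mul, mul_one]
  abel

theorem pairOp_mul_Q (a b c : Fin 2) (m i k : ℤ) :
    pairOp a b m i * Q c k =
      Q c k * pairOp a b m i - (delta c a * delta i (k + m)) • Q b (k + m) := by
  have h : pairOp a b m i = P a (i - m) * Q b i -
      (delta b a * delta m 0 * if i ≤ 0 then 1 else 0) • 1 := by
    rw [P_mul_Q]; abel
  have h2 : P a (i - m) * Q b i * Q c k =
      Q c k * (P a (i - m) * Q b i) - (delta c a * delta i (k + m)) • Q b (k + m) := by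
    have h3 : Q c k * (P a (i - m) * Q b i) =
        (delta c a * delta k (i - m)) • Q b i - P a (i - m) * (Q c k * Q b i) := by
      rw [← mul_assoc, Q_mul_P, sub_mul, smul_mul_assoc, one_mul, mul_assoc]
    have h4 : (delta c a * delta k (i - m)) • Q b i =
        (delta c a * delta i (k + m)) • Q b (k + m) := by
      rcases eq_or_ne i (k + m) with rfl | hik
      · simp
      · rw [delta_of_ne hik, delta_of_ne (a := k) (by omega)]; simp
    rw [h3, h4, mul_assoc, Q_mul_Q b c, mul_neg]
    abel
  rw [h, sub_mul, mul_sub, h2]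
  simp only [smul_mul_assoc, mul_smul_comm, one_mul, mul_one]
  abel

theorem finsum_delta (c : ℂ) (k : ℤ) (y : Fock) :
    ∑ᶠ i, (c * delta i k) • y = c • y := by
  rw [finsum_eq_single _ k fun i hi => by rw [delta_of_ne hi]; simp]
  simp

theorem J_mul_P (a b c : Fin 2) (m k : ℤ) :
    J a b m * P c k = P c k * J a b m + delta b c • P a (k - m) := by
  ext1 x
  exact (locSum_comm _ (fun i => pairOp_mul_P a b c m i k) x).trans
    (congrArg _ (finsum_delta (delta b c) k (P a (k - m) x)))

theorem J_mul_Q (a b c : Fin 2) (m k : ℤ) :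
    J a b m * Q c k = Q c k * J a b m - delta c a • Q b (k + m) := by
  ext1 x
  refine (locSum_comm (E := fun i => (-delta c a * delta i (k + m)) • Q b (k + m))
    (locFin_pairOp a b m) (fun i => ?_) x).trans ?_
  · rw [pairOp_mul_Q, sub_eq_add_neg, ← neg_smul, neg_mul]
  · simp only [LinearMap.smul_apply, finsum_delta]
    rw [neg_smul, ← sub_eq_add_neg]
    rfl

/-- The Schwinger term: the sum counts, with sign, the levels that a shift by `m` carries across the
cut. This is the source of the central charge. -/
theorem finsum_step (m : ℤ) (y : Fock) :
    ∑ᶠ i : ℤ, ((if i ≤ 0 then (1 : ℂ) else 0) - (if i + m ≤ 0 then 1 else 0)) • y =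
      (m : ℂ) • y := by
  rcases le_total 0 m with hm | hm
  · rw [finsum_eq_sum_of_support_subset (s := Finset.Ioc (-m) 0)]
    · rw [Finset.sum_congr rfl (g := fun _ => y) fun i hi => ?_, Finset.sum_const, Int.card_Ioc,
        ← Nat.cast_smul_eq_nsmul ℂ]
      · congr 1
        rw [zero_sub, neg_neg, ← Int.cast_natCast, Int.toNat_of_nonneg hm]
      · rw [Finset.mem_Ioc] at hi
        rw [if_pos hi.2, if_neg (by omega)]; simp
    · intro i hi
      by_contra hc
      simp only [Finset.coe_Ioc, Set.mem_Ioc] at hc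
      refine hi ?_
      simp only
      split_ifs <;> first | omega | simp
  · rw [finsum_eq_sum_of_support_subset (s := Finset.Ioc 0 (-m))]
    · rw [Finset.sum_congr rfl (g := fun _ => -y) fun i hi => ?_, Finset.sum_const, Int.card_Ioc,
        ← Nat.cast_smul_eq_nsmul ℂ, smul_neg, ← neg_smul]
      · congr 1
        rw [sub_zero, ← Int.cast_natCast, Int.toNat_of_nonneg (by omega)]; simp
      · rw [Finset.mem_Ioc] at hi
        rw [if_neg (by omega), if_pos (by omega)]; simp
    · intro i hi
      by_contra hc
      simp only [Finset.coe_Ioc, Set.mem_Ioc] at hc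
      refine hi ?_
      simp only
      split_ifs <;> first | omega | simp

/-- The scalar is the difference of the normal ordering constants of the two new products. The two
constants must stay together, since neither is finitely supported in `i` by itself. -/
theorem J_mul_pairOp (a b c d : Fin 2) (m n i : ℤ) :
    J a b m * pairOp c d n i = pairOp c d n i * J a b m +
      (delta b c • pairOp a d (m + n) i - delta d a • pairOp c b (m + n) (i + m) +
        (delta b c * delta d a * delta (m + n) 0 *
          ((if i ≤ 0 then (1 : ℂ) else 0) - (if i + m ≤ 0 then 1 else 0))) • 1) := by
  have h : pairOp c d n i = P c (i - n) * Q d i -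
      (delta d c * delta n 0 * if i ≤ 0 then 1 else 0) • 1 := by
    rw [P_mul_Q]; abel
  have h2 : J a b m * (P c (i - n) * Q d i) = P c (i - n) * Q d i * J a b m +
      (delta b c • (P a (i - (m + n)) * Q d i) -
        delta d a • (P c (i + m - (m + n)) * Q b (i + m))) := by
    rw [← mul_assoc, J_mul_P, add_mul, mul_assoc, J_mul_Q, mul_sub, smul_mul_assoc, mul_smul_comm,
      mul_assoc, show i - n - m = i - (m + n) by ring, show i + m - (m + n) = i - n by ring]
    abel
  have h3 : J a b m * pairOp c d n i = pairOp c d n i * J a b m +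
      (delta b c • (P a (i - (m + n)) * Q d i) -
        delta d a • (P c (i + m - (m + n)) * Q b (i + m))) := by
    rw [h, sub_mul, mul_sub, h2]
    simp only [smul_mul_assoc, mul_smul_comm, one_mul, mul_one]
    abel
  rw [h3, P_mul_Q, P_mul_Q]
  have hs : delta b c * delta d a = delta d a * delta b c := mul_comm _ _
  simp only [smul_add, smul_smul]
  module

theorem J_mul_J (a b c d : Fin 2) (m n : ℤ) :
    J a b m * J c d n = J c d n * J a b m + (delta b c • J a d (m + n) - delta d a • J c b (m + n) +
      (delta b c * delta d a * delta (m + n) 0 * m) • 1) := by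
  ext1 x
  have hx := locFin_pairOp c d n x
  have h1 : J a b m (J c d n x) = ∑ᶠ i, J a b m (pairOp c d n i x) :=
    map_locSum (J a b m).toAddMonoidHom _ (locFin_pairOp c d n) x
  have s1 : (Function.support fun i => delta b c • pairOp a d (m + n) i x).Finite :=
    (locFin_pairOp a d (m + n) x).subset fun i hi hc => hi (by simp only [hc, smul_zero])
  have s2 : (Function.support fun i => delta d a • pairOp c b (m + n) (i + m) x).Finite := by
    refine ((locFin_pairOp c b (m + n) x).preimage
      (f := fun i => i + m) (add_left_injective m).injOn).subset fun i hi hc => hi ?_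
    simp only at hc
    simp only [hc, smul_zero]
  have s3 : (Function.support fun i : ℤ => (delta b c * delta d a * delta (m + n) 0) •
      ((if i ≤ 0 then (1 : ℂ) else 0) - (if i + m ≤ 0 then 1 else 0)) • x).Finite := by
    refine ((Set.finite_Ioc (-m) 0).union (Set.finite_Ioc 0 (-m))).subset fun i hi => ?_
    by_contra hc
    simp only [Set.mem_union, Set.mem_Ioc] at hc
    refine hi ?_
    simp only
    split_ifs <;> first | omega | simp
  have e1 : ∀ i, J a b m (pairOp c d n i x) = pairOp c d n i (J a b m x) +
      ((delta b c • pairOp a d (m + n) i x - delta d a • pairOp c b (m + n) (i + m) x) +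
        (delta b c * delta d a * delta (m + n) 0) •
          ((if i ≤ 0 then (1 : ℂ) else 0) - (if i + m ≤ 0 then 1 else 0)) • x) := fun i => by
    rw [← Module.End.mul_apply, J_mul_pairOp, smul_smul]
    rfl
  have s12 : (Function.support fun i => delta b c • pairOp a d (m + n) i x -
      delta d a • pairOp c b (m + n) (i + m) x).Finite :=
    (s1.union s2).subset (Function.support_sub _ _)
  rw [Module.End.mul_apply, h1]
  simp only [e1]
  rw [finsum_add_distrib (locFin_pairOp c d n _) ((s12.union s3).subset (Function.support_add _ _)),
    finsum_add_distrib s12 s3, finsum_sub_distrib s1 s2, finsum_smul_right, finsum_smul_right,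
    finsum_smul_right, finsum_step, smul_smul]
  have h5 : ∑ᶠ i, pairOp c b (m + n) (i + m) x = J c b (m + n) x :=
    finsum_comp_equiv (Equiv.addRight m) (f := fun i => pairOp c b (m + n) i x)
  rw [h5]
  rfl

theorem J_vac (a b : Fin 2) {m : ℤ} (hm : 0 ≤ m) : J a b m vac = 0 := by
  refine (finsum_congr fun i => ?_).trans finsum_zero
  unfold pairOp
  split_ifs with h
  · rw [Module.End.mul_apply, Q_vac b h, map_zero]
  · rw [LinearMap.neg_apply, Module.End.mul_apply, P_vac a (by omega), map_zero, neg_zero]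

/-- The cut may be moved from `i - m` to `i`: the two orderings differ only when `m = 0`, and then
the two cuts agree. -/
theorem pairOp_neg (a b : Fin 2) (m i : ℤ) :
    pairOp b a (-m) (i - m) =
      if 1 ≤ i then P b i * Q a (i - m) else -(Q a (i - m) * P b i) := by
  unfold pairOp
  rw [show i - m - -m = i by ring]
  have h : (delta a b * delta (i - m) i = 0) ∨ m = 0 := by
    rcases eq_or_ne m 0 with h | h
    · exact Or.inr h
    · left; rw [delta_of_ne (a := i - m) (by omega), mul_zero]
  rcases h with h | rfl
  · have : Q a (i - m) * P b i = -(P b i * Q a (i - m)) := by rw [Q_mul_P, h, zero_smul, zero_sub]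
    rw [this]; simp
  · simp

theorem isAdj_pairOp (a b : Fin 2) (m i : ℤ) :
    IsAdj (pairOp a b m i) (pairOp b a (-m) (i - m)) := by
  rw [pairOp_neg, pairOp]
  split_ifs with h
  · exact (isAdj_P_Q a (i - m)).mul (isAdj_P_Q b i).symm
  · exact ((isAdj_P_Q b i).symm.mul (isAdj_P_Q a (i - m))).neg

theorem isAdj_J (a b : Fin 2) (m : ℤ) : IsAdj (J a b m) (J b a (-m)) := by
  intro x y
  have h1 := map_locSum (AddMonoidHom.mk' (fun z => herm z y) fun u v => herm_add_left u v y)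
    _ (locFin_pairOp a b m) x
  have h2 := map_locSum (AddMonoidHom.mk' (fun z => herm x z) fun u v => herm_add_right x u v)
    _ (locFin_pairOp b a (-m)) y
  refine h1.trans (Eq.trans ?_ h2.symm)
  refine Eq.trans (finsum_congr fun i => isAdj_pairOp a b m i x y) ?_
  exact finsum_comp_equiv (Equiv.subRight m) (f := fun i => herm x (pairOp b a (-m) i y))

/-! ### Translation operators -/

/-- The relabelling of basis states by an order embedding of sites. -/
def relabel (f : Site ↪o Site) : Module.End ℂ Fock :=
  Fock.lift fun D => state (D.map f.toEmbedding)

theorem relabel_state (f : Site ↪o Site) (D : Finset Site) :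
    relabel f (state D) = state (D.map f.toEmbedding) := Fock.lift_state _ _

/-- Jordan–Wigner signs survive a relabelling because it preserves the order. The lexicographic
order keeps the components in separate blocks, so that the levels of one component can be shifted
alone. -/
theorem sgn_map (f : Site ↪o Site) (n : Site) (D : Finset Site) :
    sgn (f n) (D.map f.toEmbedding) = sgn n D := by
  unfold sgn
  rw [Finset.filter_map, Finset.card_map]
  congr 2
  refine Finset.filter_congr fun m _ => ?_
  exact f.lt_iff_lt

theorem relabel_mul_cre (f : Site ↪o Site) (n : Site) :
    relabel f * cre n = cre (f n) * relabel f := by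
  refine Fock.hom_ext fun D => ?_
  simp only [Module.End.mul_apply, relabel_state]
  by_cases h : n ∈ D
  · rw [cre_state_of_mem h, cre_state_of_mem (by simpa using h), map_zero]
  · rw [cre_state h, cre_state (by simpa using h), map_smul, relabel_state, sgn_map,
      Finset.map_insert]
    rfl

theorem relabel_mul_ann (f : Site ↪o Site) (n : Site) :
    relabel f * ann n = ann (f n) * relabel f := by
  refine Fock.hom_ext fun D => ?_
  simp only [Module.End.mul_apply, relabel_state]
  by_cases h : n ∈ D
  · rw [ann_state h, ann_state (by simpa using h), map_smul, relabel_state, sgn_map,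
      Finset.map_erase]
    rfl
  · rw [ann_state_of_notMem h, ann_state_of_notMem (by simpa using h), map_zero]

theorem relabel_vac (f : Site ↪o Site) : relabel f vac = vac := by
  rw [vac, relabel_state, Finset.map_empty]

theorem relabel_injective (f : Site ↪o Site) : Function.Injective (relabel f) := by
  classical
  have h : Fock.lift (fun D => state (D.preimage f f.injective.injOn)) ∘ₗ relabel f =
      LinearMap.id := by
    refine Fock.hom_ext fun D => ?_
    simp only [LinearMap.comp_apply, relabel_state, Fock.lift_state, LinearMap.id_apply]
    congr 1
    exact Finset.preimage_map f.toEmbedding D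
  exact Function.LeftInverse.injective (g := Fock.lift _) (LinearMap.congr_fun h)

/-- The embedding lowering the levels of component `c` by one. -/
def lower (c : Fin 2) : Site ↪o Site :=
  OrderEmbedding.ofStrictMono
    (fun n => site (ofLex n).1 (if (ofLex n).1 = c then (ofLex n).2 - 1 else (ofLex n).2))
    (by
      intro m n h
      obtain ⟨⟨a, i⟩, rfl⟩ := toLex.surjective m
      obtain ⟨⟨b, j⟩, rfl⟩ := toLex.surjective n
      rw [Prod.Lex.toLex_lt_toLex] at h ⊢
      simp only [ofLex_toLex] at h ⊢
      rcases h with h | ⟨rfl, h⟩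
      · exact Or.inl h
      · refine Or.inr ⟨rfl, ?_⟩
        split_ifs <;> omega)

theorem lower_self (c : Fin 2) (i : ℤ) : lower c (site c i) = site c (i - 1) :=
  congrArg (site c) (if_pos rfl)

theorem lower_of_ne {a c : Fin 2} (h : a ≠ c) (i : ℤ) : lower c (site a i) = site a i :=
  congrArg (site a) (if_neg h)

/-- The translation operator of the component `c`. -/
def trans (c : Fin 2) : Module.End ℂ Fock :=
  relabel (lower c) * (ann (site c 1) - cre (site c 1))

theorem eq_zero_of_eq_neg {V : Type*} [AddCommGroup V] [Module ℂ V] {x : V} (h : x = -x) :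
    x = 0 := by
  have h2 : (2 : ℂ) • x = 0 := by rw [two_smul]; exact add_eq_zero_iff_eq_neg.2 h
  have h3 : x = (2 : ℂ)⁻¹ • (2 : ℂ) • x := by rw [smul_smul]; norm_num
  rw [h3, h2, smul_zero]

theorem flip_mul_self (n : Site) : (ann n - cre n) * (ann n - cre n) = -1 := by
  have h1 : ann n * ann n = 0 := by
    have := ann_mul_ann n n
    exact eq_zero_of_eq_neg this
  have h2 : cre n * cre n = 0 := by
    have := cre_mul_cre n n
    exact eq_zero_of_eq_neg this
  rw [sub_mul, mul_sub, mul_sub, h1, h2, ann_mul_cre, if_pos rfl]; abel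

theorem trans_injective (c : Fin 2) : Function.Injective (trans c) := by
  refine (relabel_injective (lower c)).comp ?_
  refine Function.LeftInverse.injective (g := -(ann (site c 1) - cre (site c 1))) fun x => ?_
  rw [LinearMap.neg_apply, ← Module.End.mul_apply, flip_mul_self]; simp

theorem flip_mul_cre {m n : Site} (h : m ≠ n) :
    (ann m - cre m) * cre n = -(cre n * (ann m - cre m)) := by
  rw [sub_mul, ann_mul_cre, if_neg h, cre_mul_cre m, mul_sub]; abel

theorem flip_mul_ann {m n : Site} (h : m ≠ n) :
    (ann m - cre m) * ann n = -(ann n * (ann m - cre m)) := by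
  rw [sub_mul, cre_mul_ann, if_neg h, ann_mul_ann m, mul_sub]; abel

theorem flip_mul_cre_self (n : Site) :
    (ann n - cre n) * cre n = -(ann n * (ann n - cre n)) := by
  have h1 : ann n * ann n = 0 := eq_zero_of_eq_neg (ann_mul_ann n n)
  have h2 : cre n * cre n = 0 := eq_zero_of_eq_neg (cre_mul_cre n n)
  rw [sub_mul, mul_sub, h1, h2]; abel

theorem flip_mul_ann_self (n : Site) :
    (ann n - cre n) * ann n = -(cre n * (ann n - cre n)) := by
  have h1 : ann n * ann n = 0 := eq_zero_of_eq_neg (ann_mul_ann n n)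
  have h2 : cre n * cre n = 0 := eq_zero_of_eq_neg (cre_mul_cre n n)
  rw [sub_mul, mul_sub, h1, h2]; abel

theorem trans_mul_cre {c : Fin 2} {n : Site} (h : site c 1 ≠ n) :
    trans c * cre n = -(cre (lower c n) * trans c) := by
  rw [trans, mul_assoc, flip_mul_cre h, mul_neg, ← mul_assoc, relabel_mul_cre, mul_assoc]

theorem trans_mul_ann {c : Fin 2} {n : Site} (h : site c 1 ≠ n) :
    trans c * ann n = -(ann (lower c n) * trans c) := by
  rw [trans, mul_assoc, flip_mul_ann h, mul_neg, ← mul_assoc, relabel_mul_ann, mul_assoc]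

theorem trans_mul_P_of_ne {a c : Fin 2} (h : a ≠ c) (i : ℤ) :
    trans c * P a i = -(P a i * trans c) := by
  have hs : site c 1 ≠ site a i := by rw [Ne, site_inj]; exact fun hc => h hc.1.symm
  unfold P
  split_ifs
  · rw [trans_mul_cre hs, lower_of_ne h]
  · rw [trans_mul_ann hs, lower_of_ne h]

theorem trans_mul_Q_of_ne {a c : Fin 2} (h : a ≠ c) (i : ℤ) :
    trans c * Q a i = -(Q a i * trans c) := by
  have hs : site c 1 ≠ site a i := by rw [Ne, site_inj]; exact fun hc => h hc.1.symm
  unfold Q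
  split_ifs
  · rw [trans_mul_ann hs, lower_of_ne h]
  · rw [trans_mul_cre hs, lower_of_ne h]

/-- Lowering component `c` carries level 1 across the cut, so at `site c 1` a creation operator has
to become an annihilation operator. The factor `ann - cre` in `trans` performs this exchange; at
every other site it contributes only an anticommutation sign. -/
theorem trans_mul_P_self (c : Fin 2) (i : ℤ) :
    trans c * P c i = -(P c (i - 1) * trans c) := by
  rcases eq_or_ne i 1 with rfl | hi
  · rw [P, if_pos le_rfl, P, if_neg (by omega), trans, mul_assoc, flip_mul_cre_self, mul_neg,
      ← mul_assoc, relabel_mul_ann, lower_self, mul_assoc]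
  · have hs : site c 1 ≠ site c i := by rw [Ne, site_inj]; exact fun hc => hi hc.2.symm
    unfold P
    split_ifs
    · rw [trans_mul_cre hs, lower_self]
    · omega
    · omega
    · rw [trans_mul_ann hs, lower_self]

theorem trans_mul_Q_self (c : Fin 2) (i : ℤ) :
    trans c * Q c i = -(Q c (i - 1) * trans c) := by
  rcases eq_or_ne i 1 with rfl | hi
  · rw [Q, if_pos le_rfl, Q, if_neg (by omega), trans, mul_assoc, flip_mul_ann_self, mul_neg,
      ← mul_assoc, relabel_mul_cre, lower_self, mul_assoc]
  · have hs : site c 1 ≠ site c i := by rw [Ne, site_inj]; exact fun hc => hi hc.2.symm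
    unfold Q
    split_ifs
    · rw [trans_mul_ann hs, lower_self]
    · omega
    · omega
    · rw [trans_mul_cre hs, lower_self]

/-! ### The action of the root vectors -/

theorem locSum_intertwine {T T' : ℤ → Module.End ℂ Fock} (h : LocFin T) (h' : LocFin T')
    (A : Module.End ℂ Fock) (s : ℤ ≃ ℤ) (hA : ∀ i, A * T i = T' (s i) * A) :
    A * locSum T h = locSum T' h' * A := by
  ext1 x
  have h1 : A (locSum T h x) = ∑ᶠ i, A (T i x) := map_locSum A.toAddMonoidHom T h x
  rw [Module.End.mul_apply, h1, Module.End.mul_apply, locSum_apply,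
    ← finsum_comp_equiv s (f := fun i => T' i (A x))]
  exact finsum_congr fun i => LinearMap.congr_fun (hA i) x

/-- Spectral flow: shifting component 0 moves the factor `P` but not `Q`, so the mode changes by one
and the two signs cancel. Shifting component 1 moves only `Q`, hence the opposite direction in
`trans_one_mul_J`. -/
theorem trans_zero_mul_J (m : ℤ) : trans 0 * J 0 1 m = J 0 1 (m + 1) * trans 0 := by
  refine locSum_intertwine _ _ _ (Equiv.refl ℤ) fun i => ?_
  rw [pairOp_of_ne (by decide), pairOp_of_ne (by decide), ← mul_assoc, trans_mul_P_self, neg_mul,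
    mul_assoc, trans_mul_Q_of_ne (by decide), mul_neg, neg_neg, mul_assoc, Equiv.refl_apply,
    sub_sub]

theorem trans_one_mul_J (m : ℤ) : trans 1 * J 0 1 m = J 0 1 (m - 1) * trans 1 := by
  refine locSum_intertwine _ _ _ (Equiv.subRight 1) fun i => ?_
  rw [pairOp_of_ne (by decide), pairOp_of_ne (by decide), ← mul_assoc,
    trans_mul_P_of_ne (by decide), neg_mul, mul_assoc, trans_mul_Q_self, mul_neg, neg_neg,
    mul_assoc, Equiv.subRight_apply, show i - 1 - (m - 1) = i - m by ring]

theorem trans_zero_P_vac : trans 0 (P 0 1 vac) = vac := by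
  have h : ann (site 0 1) (cre (site 0 1) vac) = vac := by
    rw [← Module.End.mul_apply, ann_mul_cre, if_pos rfl, LinearMap.sub_apply,
      Module.End.mul_apply, vac, ann_state_of_notMem (by simp)]; simp
  have h2 : cre (site 0 1) (cre (site 0 1) vac) = 0 := by
    rw [← Module.End.mul_apply, eq_zero_of_eq_neg (cre_mul_cre (site 0 1) (site 0 1))]; simp
  rw [P, if_pos le_rfl, trans, Module.End.mul_apply, LinearMap.sub_apply, h, h2, sub_zero,
    relabel_vac]

theorem trans_one_vac : trans 1 vac = -(Q 1 0 vac) := by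
  have h : ann (site 1 1) vac = 0 := ann_state_of_notMem (by simp)
  rw [trans, Module.End.mul_apply, LinearMap.sub_apply, h, zero_sub, map_neg,
    ← Module.End.mul_apply, relabel_mul_cre, lower_self, Module.End.mul_apply, relabel_vac, Q,
    if_neg (by omega)]
  rfl

theorem commute_J (m n : ℤ) : Commute (J 0 1 m) (J 0 1 n) := by
  rw [Commute, SemiconjBy, J_mul_J, delta_of_ne (a := (1 : Fin 2)) (by decide)]
  simp

theorem commute_J_P (m k : ℤ) : Commute (J 0 1 m) (P 0 k) := by
  rw [Commute, SemiconjBy, J_mul_P, delta_of_ne (by decide)]; simp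

theorem commute_J_Q (m k : ℤ) : Commute (J 0 1 m) (Q 1 k) := by
  rw [Commute, SemiconjBy, J_mul_Q, delta_of_ne (by decide)]; simp

/-- The creation part of the root vector `x_α(-1-k)`. -/
def rootCreate (k : ℕ) : Module.End ℂ Fock :=
  ∑ p ∈ Finset.HasAntidiagonal.antidiagonal k, P 0 (1 + p.1) * Q 1 (-p.2)

/-- On the vacuum `Q` forces `i ≤ 0` and `P` forces `-k ≤ i`, leaving the terms in which both
factors create. -/
theorem J_neg_vac (k : ℕ) : J 0 1 (-1 - k) vac = rootCreate k vac := by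
  rw [J, locSum_apply, finsum_eq_sum_of_support_subset
    (s := (Finset.range (k + 1)).map ⟨fun l : ℕ => -(l : ℤ), fun a b h => by simpa using h⟩)]
  · rw [Finset.sum_map, rootCreate, ← Finset.Nat.sum_antidiagonal_swap,
      Finset.Nat.sum_antidiagonal_eq_sum_range_succ_mk, LinearMap.sum_apply]
    refine Finset.sum_congr rfl fun l hl => ?_
    rw [Finset.mem_range] at hl
    rw [pairOp_of_ne (by decide)]
    change (P 0 (-(l : ℤ) - (-1 - k)) * Q 1 (-(l : ℤ))) vac =
      (P 0 (1 + (k - l : ℕ)) * Q 1 (-(l : ℤ))) vac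
    rw [Nat.cast_sub (Nat.lt_succ_iff.1 hl), show -(l : ℤ) - (-1 - k) = 1 + (k - l) by ring]
  · intro i hi
    by_contra hc
    refine hi ?_
    simp only
    rcases le_or_gt 1 i with h | h
    · rw [pairOp, if_pos h, Module.End.mul_apply, Q_vac _ h, map_zero]
    · rw [pairOp, if_neg (by omega), LinearMap.neg_apply, Module.End.mul_apply, P_vac, map_zero,
        neg_zero]
      by_contra h'
      refine hc ?_
      simp only [Finset.coe_map, Finset.coe_range, Set.mem_image,
        Set.mem_Iio]
      exact ⟨(-i).toNat, by omega, show -((-i).toNat : ℤ) = i by omega⟩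

/-- The square of the generating function of the operators `rootCreate` vanishes. -/
theorem sum_rootCreate (t : ℕ) :
    ∑ p ∈ Finset.HasAntidiagonal.antidiagonal t, rootCreate p.1 * rootCreate p.2 = 0 := by
  -- The operator `rootCreate k` is the `k`th coefficient of `p * q`. The fields `p` and `q`
  -- anticommute since their components differ, and `p * p = 0` since each of its coefficients is
  -- antisymmetric under exchange of the two indices.
  let p : PowerSeries (Module.End ℂ Fock) := PowerSeries.mk fun i => P 0 (1 + i)
  let q : PowerSeries (Module.End ℂ Fock) := PowerSeries.mk fun i => Q 1 (-i)
  have hpp : p * p = 0 := by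
    ext1 n
    rw [PowerSeries.coeff_mul, map_zero]
    refine eq_zero_of_eq_neg ?_
    conv_rhs => rw [← Finset.Nat.sum_antidiagonal_swap]
    rw [← Finset.sum_neg_distrib]
    refine Finset.sum_congr rfl fun x _ => ?_
    simp only [p, PowerSeries.coeff_mk, Prod.swap]
    exact P_mul_P _ _ _ _
  have hqp : q * p = -(p * q) := by
    ext1 n
    rw [map_neg, PowerSeries.coeff_mul, PowerSeries.coeff_mul]
    conv_rhs => rw [← Finset.Nat.sum_antidiagonal_swap]
    rw [← Finset.sum_neg_distrib]
    refine Finset.sum_congr rfl fun x _ => ?_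
    simp only [p, q, PowerSeries.coeff_mk, Prod.swap]
    rw [Q_mul_P, delta_of_ne (by decide)]; simp
  have hr : ∀ k, PowerSeries.coeff k (p * q) = rootCreate k := fun k => by
    rw [PowerSeries.coeff_mul]
    simp only [p, q, PowerSeries.coeff_mk]; rfl
  have h : p * q * (p * q) = 0 := by
    rw [mul_assoc, ← mul_assoc q, hqp, neg_mul, mul_neg, ← mul_assoc, ← mul_assoc, hpp]; simp
  have := congrArg (PowerSeries.coeff t) h
  rw [PowerSeries.coeff_mul, map_zero] at this
  simpa only [hr] using this

/-- The currents `J 0 1 m` commute with `rootCreate`, so the second current can also be moved to the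
vacuum and replaced by its creation part. -/
theorem sum_J_vac (t : ℕ) :
    ∑ p ∈ Finset.HasAntidiagonal.antidiagonal t, J 0 1 (-1 - p.1) (J 0 1 (-1 - p.2) vac) = 0 := by
  have hc : ∀ (m : ℤ) (k : ℕ), Commute (J 0 1 m) (rootCreate k) := fun m k =>
    Commute.sum_right _ _ _ fun p _ => (commute_J_P _ _).mul_right (commute_J_Q _ _)
  have := LinearMap.congr_fun (sum_rootCreate t) vac
  rw [LinearMap.sum_apply, LinearMap.zero_apply, ← Finset.Nat.sum_antidiagonal_swap] at this
  refine Eq.trans (Finset.sum_congr rfl fun p _ => ?_) this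
  rw [J_neg_vac, ← Module.End.mul_apply, hc, Module.End.mul_apply, J_neg_vac]
  rfl

theorem J_neg_one_vac : J 0 1 (-1) vac = P 0 1 (Q 1 0 vac) := by
  have := J_neg_vac 0
  simpa [rootCreate] using this

end AffineSl2

end

noncomputable section

namespace AffineSl2

/-! ### The ideal of relations in the polynomial ring -/

/-- The polynomial ring in variables indexed by `ℕ`; the variable `X k` stands for
`x_α(-1-k)`. -/
abbrev Poly : Type := MvPolynomial ℕ ℂ

open MvPolynomial in
/-- The quadratic relations. -/
def rel (t : ℕ) : Poly := ∑ p ∈ Finset.HasAntidiagonal.antidiagonal t, X p.1 * X p.2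

/-- The ideal generated by the quadratic relations. -/
def relIdeal : Ideal Poly := Ideal.span (Set.range rel)

/-- The endomorphism raising the indices of the variables by one. -/
def up : Poly →ₐ[ℂ] Poly := MvPolynomial.aeval fun k => MvPolynomial.X (k + 1)

/-- The endomorphism lowering the indices of the variables by one and sending the first variable
to zero. -/
def down : Poly →ₐ[ℂ] Poly :=
  MvPolynomial.aeval fun k => match k with
    | 0 => 0
    | k + 1 => MvPolynomial.X k

open MvPolynomial

@[simp] theorem up_X (k : ℕ) : up (X k) = X (k + 1) := by simp [up]
@[simp] theorem down_X_zero : down (X 0) = 0 := by simp [down]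
@[simp] theorem down_X_succ (k : ℕ) : down (X (k + 1)) = X k := by simp [down]

theorem down_up (a : Poly) : down (up a) = a := by
  have : down.comp up = AlgHom.id ℂ Poly := by ext k; simp
  exact DFunLike.congr_fun this a

theorem sub_up_down_mem (a : Poly) : a - up (down a) ∈ Ideal.span {(X 0 : Poly)} := by
  rw [← Ideal.Quotient.eq_zero_iff_mem, map_sub, sub_eq_zero]
  have : (Ideal.Quotient.mkₐ ℂ (Ideal.span {(X 0 : Poly)})) =
      ((Ideal.Quotient.mkₐ ℂ (Ideal.span {(X 0 : Poly)})).comp up).comp down := by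
    ext k
    cases k with
    | zero =>
      simp only [AlgHom.comp_apply, down_X_zero, map_zero]
      exact Ideal.Quotient.eq_zero_iff_mem.2 (Ideal.mem_span_singleton_self _)
    | succ k => simp
  exact DFunLike.congr_fun this a

theorem exists_eq_up_down_add (a : Poly) : ∃ c, a = up (down a) + c * X 0 := by
  obtain ⟨c, hc⟩ := Ideal.mem_span_singleton'.1 (sub_up_down_mem a)
  exact ⟨c, by rw [hc]; ring⟩

/-- The two extreme terms of the sum contain `X 0`; the remaining ones form a shifted relation. -/
theorem rel_succ_succ (t : ℕ) : rel (t + 2) = up (rel t) + 2 * X (t + 2) * X 0 := by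
  have h : up (rel t) = ∑ p ∈ Finset.HasAntidiagonal.antidiagonal t,
      (X (p.1 + 1) * X (p.2 + 1) : Poly) := by
    simp [rel]
  rw [h, rel, Finset.Nat.antidiagonal_succ, Finset.sum_cons, Finset.sum_map,
    Finset.Nat.antidiagonal_succ', Finset.sum_cons, Finset.sum_map]
  simp only [Function.Embedding.prodMap, Function.Embedding.coeFn_mk, Prod.map,
    Function.Embedding.refl_apply]
  simp
  ring

theorem up_mem {a : Poly} (h : a ∈ relIdeal) : up a ∈ relIdeal ⊔ Ideal.span {(X 0 : Poly)} := by
  suffices relIdeal ≤ (relIdeal ⊔ Ideal.span {(X 0 : Poly)}).comap up from this h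
  refine Ideal.span_le.2 ?_
  rintro _ ⟨t, rfl⟩
  change up (rel t) ∈ relIdeal ⊔ Ideal.span {(X 0 : Poly)}
  rw [show up (rel t) = rel (t + 2) + (-2 * X (t + 2)) * X 0 by rw [rel_succ_succ]; ring]
  exact Ideal.add_mem _ (Ideal.mem_sup_left (Ideal.subset_span ⟨_, rfl⟩))
    (Ideal.mem_sup_right (Ideal.mul_mem_left _ _ (Ideal.mem_span_singleton_self _)))

theorem X_zero_sq_mem : (X 0 * X 0 : Poly) ∈ relIdeal := by
  have : rel 0 = X 0 * X 0 := by simp [rel]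
  exact this ▸ Ideal.subset_span ⟨0, rfl⟩

theorem X_one_mul_X_zero_mem : (X 1 * X 0 : Poly) ∈ relIdeal := by
  have : (X 1 * X 0 : Poly) = C (1 / 2) * rel 1 := by
    have h : rel 1 = C 2 * (X 1 * X 0) := by
      rw [rel, Finset.Nat.antidiagonal_succ]
      rw [show (C 2 : Poly) = 2 from map_ofNat C 2]
      simp
      ring
    rw [h, ← mul_assoc, ← C_mul]; norm_num
  rw [this]
  exact Ideal.mul_mem_left _ _ (Ideal.subset_span ⟨1, rfl⟩)

/-- Shifting `rel t` twice gives `rel (t + 4)` up to multiples of `X 0` and `X 1`, and both of these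
are killed by `X 0` modulo `rel 0` and `rel 1`. -/
theorem up_up_mul_mem {a : Poly} (h : a ∈ relIdeal) : up (up a) * X 0 ∈ relIdeal := by
  suffices relIdeal ≤ Ideal.comap (up.comp up) (Submodule.comap (LinearMap.mulRight Poly (X 0 : Poly)) relIdeal)
      from this h
  refine Ideal.span_le.2 ?_
  rintro _ ⟨t, rfl⟩
  change up (up (rel t)) * X 0 ∈ relIdeal
  have h1 : up (up (rel t)) =
      rel (t + 4) - 2 * X (t + 4) * X 0 - 2 * X (t + 3) * X 1 := by
    have h2 : up 2 = 2 := map_ofNat up 2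
    rw [rel_succ_succ (t + 2), rel_succ_succ t]
    simp only [map_add, map_mul, up_X, h2]
    ring
  rw [h1, show (rel (t + 4) - 2 * X (t + 4) * X 0 - 2 * X (t + 3) * X 1) * X 0 =
    X 0 * rel (t + 4) - (2 * X (t + 4)) * (X 0 * X 0) - (2 * X (t + 3)) * (X 1 * X 0) by ring]
  exact Ideal.sub_mem _ (Ideal.sub_mem _ (Ideal.mul_mem_left _ _ (Ideal.subset_span ⟨_, rfl⟩))
    (Ideal.mul_mem_left _ _ X_zero_sq_mem)) (Ideal.mul_mem_left _ _ X_one_mul_X_zero_mem)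

/-- Modulo relations `c * X 0` depends only on `down (down c)`, because `X 0 * X 0` and `X 1 * X 0`
are relations. This is the counterpart of the hypothesis `hmul` in `le_relIdeal`. -/
theorem mul_X_zero_mem {c : Poly} (h : down (down c) ∈ relIdeal) : c * X 0 ∈ relIdeal := by
  obtain ⟨d, hd⟩ := exists_eq_up_down_add c
  obtain ⟨d', hd'⟩ := exists_eq_up_down_add (down c)
  have : c * X 0 = up (up (down (down c))) * X 0 + up d' * (X 1 * X 0) + d * (X 0 * X 0) := by
    conv_lhs => rw [hd, hd']
    simp
    ring
  rw [this]
  exact Ideal.add_mem _ (Ideal.add_mem _ (up_up_mul_mem h)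
    (Ideal.mul_mem_left _ _ X_one_mul_X_zero_mem)) (Ideal.mul_mem_left _ _ X_zero_sq_mem)

/-! ### Truncation by polynomial degree -/

/-- Truncation in degrees at most `n`. -/
def trunc (n : ℕ) : Poly →ₗ[ℂ] Poly :=
  ∑ m ∈ Finset.range (n + 1), homogeneousComponent m

theorem coeff_trunc (n : ℕ) (d : ℕ →₀ ℕ) (a : Poly) :
    coeff d (trunc n a) = if d.degree ≤ n then coeff d a else 0 := by
  rw [trunc, LinearMap.sum_apply, coeff_sum]
  simp only [coeff_homogeneousComponent]
  rw [Finset.sum_ite_eq]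
  simp

theorem trunc_mem {n : ℕ} {a : Poly} (h : a ∈ relIdeal) : trunc n a ∈ relIdeal := by
  rw [trunc, LinearMap.sum_apply]
  refine Ideal.sum_mem _ fun m _ => ?_
  refine homogeneousComponent_mem_of_mem ?_ h m
  let := gradedAlgebra (σ := ℕ) (R := ℂ)
  refine Ideal.homogeneous_span _ _ ?_
  rintro _ ⟨t, rfl⟩
  refine ⟨2, ?_⟩
  refine Submodule.sum_mem _ fun p _ => ?_
  exact (isHomogeneous_X ℂ p.1).mul (isHomogeneous_X ℂ p.2)

theorem trunc_of_totalDegree_le {n : ℕ} {a : Poly} (h : a.totalDegree ≤ n) : trunc n a = a := by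
  ext d
  rw [coeff_trunc]
  split_ifs with hd
  · rfl
  · refine (coeff_eq_zero_of_totalDegree_lt ?_).symm
    rw [← Finsupp.degree_apply]
    omega

theorem totalDegree_trunc_le (n : ℕ) (a : Poly) : (trunc n a).totalDegree ≤ n := by
  refine Finset.sup_le fun d hd => ?_
  rw [mem_support_iff, coeff_trunc] at hd
  by_contra h
  exact hd (if_neg h)

theorem trunc_mul_X (n k : ℕ) (a : Poly) : trunc (n + 1) (a * X k) = trunc n a * X k := by
  ext d
  rw [coeff_trunc, coeff_mul_X', coeff_mul_X']
  by_cases hk : k ∈ d.support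
  · obtain ⟨e, rfl⟩ : ∃ e, d = e + Finsupp.single k 1 :=
      ⟨d - Finsupp.single k 1, (tsub_add_cancel_of_le (Finsupp.single_le_iff.2
        (Nat.one_le_iff_ne_zero.2 (Finsupp.mem_support_iff.1 hk)))).symm⟩
    rw [if_pos hk, if_pos hk, add_tsub_cancel_right, coeff_trunc]
    simp
  · rw [if_neg hk, if_neg hk, ite_self]

theorem totalDegree_down_le (a : Poly) : (down a).totalDegree ≤ a.totalDegree := by
  conv_lhs => rw [a.as_sum, map_sum]
  refine totalDegree_finsetSum_le fun d hd => ?_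
  refine le_trans ?_ (le_totalDegree hd)
  rw [down, aeval_monomial, Finsupp.prod]
  refine (totalDegree_mul _ _).trans ?_
  rw [algebraMap_eq, totalDegree_C, zero_add]
  refine (totalDegree_finsetProd _ _).trans (Finset.sum_le_sum fun k _ => ?_)
  refine (totalDegree_pow _ _).trans ?_
  cases k with
  | zero => simp
  | succ k => simp

theorem iterate_down_C (n : ℕ) (c : ℂ) : down^[n] (C c) = C c :=
  Function.iterate_fixed (by simp [down]) n

theorem iterate_down_X (k : ℕ) : down^[k + 1] (X k) = 0 := by
  induction k with
  | zero => simp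
  | succ k ih => rw [Function.iterate_succ_apply, down_X_succ, ih]

/-- Each variable disappears after enough lowerings, so only the constant term survives. -/
theorem exists_iterate_down (a : Poly) : ∃ n c, down^[n] a = C c := by
  induction a using MvPolynomial.induction_on with
  | C c => exact ⟨0, c, rfl⟩
  | add a b ha hb =>
    obtain ⟨m, c, hm⟩ := ha
    obtain ⟨n, d, hn⟩ := hb
    refine ⟨m + n, c + d, ?_⟩
    rw [iterate_map_add, add_comm m n, Function.iterate_add_apply, hm, add_comm n m,
      Function.iterate_add_apply, hn, iterate_down_C, iterate_down_C, C_add]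
  | mul_X a k ha =>
    refine ⟨k + 1, 0, ?_⟩
    rw [iterate_map_mul, iterate_down_X, mul_zero, C_0]

/-- An ideal containing the quadratic relations and compatible with lowering of indices is equal
to the ideal of relations. -/
theorem le_relIdeal {K : Ideal Poly} (hI : relIdeal ≤ K) (hC : ∀ c, C c ∈ K → c = 0)
    (hdown : ∀ a ∈ K, down a ∈ K) (hmul : ∀ c, c * X 0 ∈ K → down (down c) ∈ K) :
    K ≤ relIdeal := by
  suffices H : ∀ k (a : Poly), a.totalDegree < k → a ∈ K → a ∈ relIdeal from
    fun a ha => H _ a (Nat.lt_succ_self _) ha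
  intro k
  induction k with
  | zero => intro a h; omega
  | succ k ih =>
    -- If `down a` is a combination of relations, then so is `a` up to a multiple of `X 0`. The
    -- cofactor can be taken of smaller degree, and `hmul` makes it accessible to the outer
    -- induction.
    have step : ∀ a : Poly, a.totalDegree < k + 1 → a ∈ K → down a ∈ relIdeal → a ∈ relIdeal := by
      intro a hk ha hd
      obtain ⟨c, hc⟩ := exists_eq_up_down_add a
      obtain ⟨i, hi, e, he, hie⟩ := Submodule.mem_sup.1 (up_mem hd)
      obtain ⟨d, rfl⟩ := Ideal.mem_span_singleton'.1 he
      -- The degrees of `i` and `d` are not controlled; truncation fixes `a` and bounds the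
      -- cofactor.
      have h1 : a = trunc k i + trunc k ((d + c) * X 0) := by
        rw [← map_add, add_mul, ← add_assoc, hie, ← hc, trunc_of_totalDegree_le (by omega)]
      have hi' := trunc_mem (n := k) hi
      rw [h1]
      refine Ideal.add_mem _ hi' ?_
      cases k with
      | zero =>
        have : trunc 0 ((d + c) * X 0) = 0 := by
          ext d
          rw [coeff_trunc, coeff_mul_X']
          split_ifs with h0 h1
          · rw [Nat.le_zero, Finsupp.degree_eq_zero_iff] at h0
            simp [h0] at h1
          all_goals simp
        rw [this]
        exact Ideal.zero_mem _
      | succ k =>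
        rw [trunc_mul_X] at h1 ⊢
        refine mul_X_zero_mem (ih _ ?_ (hmul _ ?_))
        · have := totalDegree_down_le (down (trunc k (d + c)))
          have := totalDegree_down_le (trunc k (d + c))
          have := totalDegree_trunc_le k (d + c)
          omega
        · rw [← sub_eq_of_eq_add' h1]
          exact Ideal.sub_mem _ ha (hI hi')
    intro a hk ha
    -- Inner induction on the number of lowerings that turn `a` into a constant.
    obtain ⟨n, c, hn⟩ := exists_iterate_down a
    induction n generalizing a with
    | zero =>
      rw [Function.iterate_zero, id] at hn
      rw [hn] at ha ⊢
      rw [hC c ha]; simp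
    | succ n ihn =>
      refine step a hk ha (ihn (down a) ?_ (hdown a ha) hn)
      exact (totalDegree_down_le a).trans_lt hk

end AffineSl2

end

noncomputable section

namespace AffineSl2

attribute [local instance 100] LieRing.ofAssociativeRing

/-! ### Generalities on the affine Lie algebra and its enveloping algebra -/

theorem monomial_add (a b : Sl2) (m : ℤ) : monomial (a + b) m = monomial a m + monomial b m := by
  simp only [monomial, loopMonomial, TensorProduct.tmul_add, ← LieAlgebra.of_add, Prod.mk_add_mk,
    add_zero]

theorem monomial_smul (c : ℂ) (a : Sl2) (m : ℤ) : monomial (c • a) m = c • monomial a m := by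
  simp only [monomial, loopMonomial, TensorProduct.tmul_smul, ← LieAlgebra.of_smul, Prod.smul_mk,
    smul_zero]

theorem span_monomial_central :
    Submodule.span ℂ ({x | ∃ a m, x = monomial a m} ∪ {central}) = (⊤ : Submodule ℂ Affine) := by
  rw [eq_top_iff]
  rintro x -
  obtain ⟨⟨y, c⟩, rfl⟩ := (LieAlgebra.ofProd cocycle).surjective x
  have h : LieAlgebra.ofProd cocycle (y, c) = LieAlgebra.ofProd cocycle (y, 0) +
      (TrivialLieModule.equiv ℂ Loop ℂ c) • central := by
    rw [central, ← LieAlgebra.of_smul, ← LieAlgebra.of_add]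
    congr 1
    simp only [Prod.smul_mk, smul_zero, Prod.mk_add_mk, add_zero, zero_add, ← map_smul,
      smul_eq_mul, mul_one, LinearEquiv.symm_apply_apply]
  rw [h]
  refine Submodule.add_mem _ ?_ (Submodule.smul_mem _ _ (Submodule.subset_span (Or.inr rfl)))
  clear h
  induction y using TensorProduct.induction_on with
  | zero => exact Submodule.zero_mem _
  | add u v hu hv =>
    have : LieAlgebra.ofProd cocycle (u + v, 0) = LieAlgebra.ofProd cocycle (u, 0) +
        LieAlgebra.ofProd cocycle (v, 0) := by
      rw [← LieAlgebra.of_add, Prod.mk_add_mk, add_zero]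
    rw [this]
    exact Submodule.add_mem _ hu hv
  | tmul p a =>
    induction p using AddMonoidAlgebra.induction_linear with
    | zero =>
      rw [TensorProduct.zero_tmul]
      exact Submodule.zero_mem _
    | add p q hp hq =>
      have : LieAlgebra.ofProd cocycle ((p + q) ⊗ₜ[ℂ] a, 0) =
          LieAlgebra.ofProd cocycle (p ⊗ₜ[ℂ] a, 0) + LieAlgebra.ofProd cocycle (q ⊗ₜ[ℂ] a, 0) := by
        rw [← LieAlgebra.of_add, Prod.mk_add_mk, add_zero, TensorProduct.add_tmul]
      rw [this]
      exact Submodule.add_mem _ hp hq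
    | single m c =>
      refine Submodule.subset_span (Or.inl ⟨c • a, m, ?_⟩)
      rw [monomial, loopMonomial, ← TensorProduct.smul_tmul]
      rw [AddMonoidAlgebra.smul_single, smul_eq_mul, mul_one]

theorem affine_induction {p : Affine → Prop} (hm : ∀ a m, p (monomial a m)) (hc : p central)
    (h0 : p 0) (ha : ∀ x y, p x → p y → p (x + y)) (hs : ∀ (c : ℂ) x, p x → p (c • x))
    (x : Affine) : p x := by
  have hx : x ∈ Submodule.span ℂ ({x | ∃ a m, x = monomial a m} ∪ {central}) :=
    span_monomial_central ▸ Submodule.mem_top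
  induction hx using Submodule.span_induction with
  | mem x hx =>
    rcases hx with ⟨a, m, rfl⟩ | rfl
    · exact hm a m
    · exact hc
  | zero => exact h0
  | add x y _ _ hx hy => exact ha x y hx hy
  | smul c x _ hx => exact hs c x hx

theorem subalgebra_eq_top {L : Type} [LieRing L] [LieAlgebra ℂ L]
    (S : Subalgebra ℂ (UniversalEnvelopingAlgebra ℂ L))
    (h : ∀ x, UniversalEnvelopingAlgebra.ι ℂ x ∈ S) : S = ⊤ := by
  let g : L →ₗ⁅ℂ⁆ S :=
    { toFun := fun x => ⟨UniversalEnvelopingAlgebra.ι ℂ x, h x⟩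
      map_add' := fun x y => Subtype.ext (map_add _ x y)
      map_smul' := fun c x => Subtype.ext (map_smul _ c x)
      map_lie' := fun {x y} => Subtype.ext (LieHom.map_lie _ x y) }
  have : S.val.comp (UniversalEnvelopingAlgebra.lift ℂ g) = AlgHom.id ℂ _ := by
    apply UniversalEnvelopingAlgebra.hom_ext
    ext x
    simp only [LieHom.coe_comp, Function.comp_apply, AlgHom.coe_toLieHom, AlgHom.coe_comp,
      UniversalEnvelopingAlgebra.lift_ι_apply]
    rfl
  refine eq_top_iff.2 fun u _ => ?_
  have hu := DFunLike.congr_fun this u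
  rw [AlgHom.id_apply] at hu
  rw [← hu]
  exact (UniversalEnvelopingAlgebra.lift ℂ g u).2

section Modules

variable {V : Type} [AddCommGroup V] [Module ℂ V] [Module UAffine V] [IsScalarTower ℂ UAffine V]

/-- The subalgebra of elements preserving a subspace. -/
def stabilizer (W : Submodule ℂ V) : Subalgebra ℂ UAffine where
  carrier := {u | ∀ w ∈ W, u • w ∈ W}
  mul_mem' {u v} hu hv w hw := by rw [mul_smul]; exact hu _ (hv _ hw)
  add_mem' {u v} hu hv w hw := by rw [add_smul]; exact W.add_mem (hu _ hw) (hv _ hw)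
  algebraMap_mem' c w hw := by rw [algebraMap_smul]; exact W.smul_mem c hw

theorem smul_mem_of_affine {W : Submodule ℂ V}
    (h : ∀ x : Affine, ∀ w ∈ W, UniversalEnvelopingAlgebra.ι ℂ x • w ∈ W) (u : UAffine) {w : V}
    (hw : w ∈ W) : u • w ∈ W := by
  have : u ∈ stabilizer W := by rw [subalgebra_eq_top (stabilizer W) h]; trivial
  exact this w hw

/-- The action of `a ⊗ t^m` on a module. -/
def mode (a : Sl2) (m : ℤ) : Module.End ℂ V where
  toFun v := UniversalEnvelopingAlgebra.ι ℂ (monomial a m) • v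
  map_add' v w := smul_add _ v w
  map_smul' c v := by
    rw [RingHom.id_apply, ← algebraMap_smul UAffine c v, ← mul_smul,
      ← algebraMap_smul UAffine c (_ • v), ← mul_smul, Algebra.commutes]

theorem mode_apply (a : Sl2) (m : ℤ) (v : V) :
    mode a m v = UniversalEnvelopingAlgebra.ι ℂ (monomial a m) • v := rfl

theorem mode_add (a b : Sl2) (m : ℤ) : (mode (a + b) m : Module.End ℂ V) = mode a m + mode b m := by
  ext v
  rw [mode_apply, monomial_add, map_add, add_smul]; rfl

theorem mode_smul (c : ℂ) (a : Sl2) (m : ℤ) :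
    (mode (c • a) m : Module.End ℂ V) = c • mode a m := by
  ext v
  rw [mode_apply, monomial_smul, map_smul, smul_assoc]; rfl

/-- A module on which the central element acts as `1`. -/
def LevelOne (V : Type) [AddCommGroup V] [Module UAffine V] : Prop :=
  ∀ v : V, UniversalEnvelopingAlgebra.ι ℂ central • v = v

theorem mode_mode (hV : LevelOne V) (a b : Sl2) (m n : ℤ) (v : V) :
    mode a m (mode b n v) = mode b n (mode a m v) + mode ⁅a, b⁆ (m + n) v +
      (if m + n = 0 then (m : ℂ) * form a b else 0) • v := by
  have h := (UniversalEnvelopingAlgebra.ι ℂ (L := Affine)).map_lie (monomial a m) (monomial b n)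
  rw [lie_monomial, map_add, map_smul, LieRing.of_associative_ring_bracket] at h
  have h2 := congrArg (fun u => u • v) h
  simp only [add_smul, sub_smul, mul_smul, smul_assoc, hV v] at h2
  simp only [mode_apply]
  rw [add_assoc, h2]; abel

theorem smul_mem_of_mode (hV : LevelOne V) {W : Submodule ℂ V}
    (h : ∀ a m, ∀ w ∈ W, mode a m w ∈ W) (u : UAffine) {w : V} (hw : w ∈ W) : u • w ∈ W := by
  refine smul_mem_of_affine (fun x => ?_) u hw
  induction x using affine_induction with
  | hm a m => exact h a m
  | hc => intro w hw; rwa [hV w]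
  | h0 => intro w _; rw [map_zero, zero_smul]; exact W.zero_mem
  | ha x y hx hy => intro w hw; rw [map_add, add_smul]; exact W.add_mem (hx w hw) (hy w hw)
  | hs c x hx => intro w hw; rw [map_smul, smul_assoc]; exact W.smul_mem c (hx w hw)

end Modules

/-! ### Dual bases of `𝔰𝔩(2)` -/

/-- The matrix unit `E₂₁`. -/
def sl2F : Sl2 := LieAlgebra.SpecialLinear.single 1 0 (by decide) 1

/-- The coroot `E₁₁ - E₂₂`. -/
def sl2H : Sl2 := ⟨!![1, 0; 0, -1], by
  rw [LieAlgebra.SpecialLinear.sl]; simp [Matrix.trace_fin_two]⟩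

theorem coe_xAlpha : xAlpha.1 = !![0, 1; 0, 0] := by
  ext i j; fin_cases i <;> fin_cases j <;> simp [xAlpha, Matrix.single]

theorem coe_sl2F : sl2F.1 = !![0, 0; 1, 0] := by
  ext i j; fin_cases i <;> fin_cases j <;> simp [sl2F, Matrix.single]

theorem coe_sl2H : sl2H.1 = !![1, 0; 0, -1] := rfl

theorem sl2_trace (a : Sl2) : a.1 0 0 + a.1 1 1 = 0 := by
  obtain ⟨m, h⟩ := a
  change m 0 0 + m 1 1 = 0
  rw [LieAlgebra.SpecialLinear.sl] at h
  simpa [Matrix.trace_fin_two] using h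

theorem sl2_eq (a : Sl2) : a = a.1 0 1 • xAlpha + a.1 1 0 • sl2F + a.1 0 0 • sl2H := by
  apply Subtype.ext
  have h : a.1 1 1 = -a.1 0 0 := by linear_combination sl2_trace a
  change a.1 = a.1 0 1 • xAlpha.1 + a.1 1 0 • sl2F.1 + a.1 0 0 • sl2H.1
  rw [coe_xAlpha, coe_sl2F, coe_sl2H]
  ext i j; fin_cases i <;> fin_cases j <;> simp [h]

theorem lie_E_F : ⁅xAlpha, sl2F⁆ = sl2H := by
  apply Subtype.ext
  rw [LieAlgebra.SpecialLinear.sl_bracket, coe_xAlpha, coe_sl2F, coe_sl2H]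
  ext i j; fin_cases i <;> fin_cases j <;> simp

theorem lie_H_E : ⁅sl2H, xAlpha⁆ = (2 : ℂ) • xAlpha := by
  apply Subtype.ext
  change _ = (2 : ℂ) • xAlpha.1
  rw [LieAlgebra.SpecialLinear.sl_bracket, coe_xAlpha, coe_sl2H]
  ext i j; fin_cases i <;> fin_cases j <;> simp; norm_num

theorem lie_H_F : ⁅sl2H, sl2F⁆ = (-2 : ℂ) • sl2F := by
  apply Subtype.ext
  change _ = (-2 : ℂ) • sl2F.1
  rw [LieAlgebra.SpecialLinear.sl_bracket, coe_sl2F, coe_sl2H]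
  ext i j; fin_cases i <;> fin_cases j <;> simp; norm_num

theorem lie_F_E : ⁅sl2F, xAlpha⁆ = -sl2H := by rw [← lie_skew, lie_E_F]
theorem lie_E_H : ⁅xAlpha, sl2H⁆ = (-2 : ℂ) • xAlpha := by rw [← lie_skew, lie_H_E, neg_smul]
theorem lie_F_H : ⁅sl2F, sl2H⁆ = (2 : ℂ) • sl2F := by rw [← lie_skew, lie_H_F, neg_smul, neg_neg]

/-- A basis of `𝔰𝔩(2)`. -/
def basisL : Fin 3 → Sl2 := ![xAlpha, sl2F, sl2H]

/-- The basis dual to `basisL` with respect to the form. -/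
def basisR : Fin 3 → Sl2 := ![sl2F, xAlpha, (1 / 2 : ℂ) • sl2H]

theorem lie_sl2_E (x : Sl2) : ⁅xAlpha, x⁆ = x.1 1 0 • sl2H + (-2 * x.1 0 0) • xAlpha := by
  conv_lhs => rw [sl2_eq x]
  simp only [lie_add, lie_smul, lie_self, lie_E_F, lie_E_H]; module

theorem lie_sl2_F (x : Sl2) : ⁅sl2F, x⁆ = (-x.1 0 1) • sl2H + (2 * x.1 0 0) • sl2F := by
  conv_lhs => rw [sl2_eq x]
  simp only [lie_add, lie_smul, lie_self, lie_F_E, lie_F_H]; module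

theorem lie_sl2_H (x : Sl2) :
    ⁅sl2H, x⁆ = (2 * x.1 0 1) • xAlpha + (-2 * x.1 1 0) • sl2F := by
  conv_lhs => rw [sl2_eq x]
  simp only [lie_add, lie_smul, lie_self, lie_H_E, lie_H_F]; module

/-- Invariance of the Casimir tensor under the adjoint action. -/
theorem sum_lie_left {V : Type} [AddCommGroup V] [Module ℂ V] (B : Sl2 →ₗ[ℂ] Sl2 →ₗ[ℂ] V)
    (x : Sl2) :
    ∑ i, B ⁅basisL i, x⁆ (basisR i) = -∑ i, B (basisL i) ⁅basisR i, x⁆ := by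
  simp only [Fin.sum_univ_three, basisL, basisR, Matrix.cons_val_zero, Matrix.cons_val_one,
    Matrix.cons_val, smul_lie, lie_sl2_E, lie_sl2_F, lie_sl2_H, map_add, map_smul,
    LinearMap.add_apply, LinearMap.smul_apply]
  module

theorem sum_lie_right {V : Type} [AddCommGroup V] [Module ℂ V] (B : Sl2 →ₗ[ℂ] Sl2 →ₗ[ℂ] V)
    (x : Sl2) :
    ∑ i, B ⁅basisR i, x⁆ (basisL i) = -∑ i, B (basisL i) ⁅basisR i, x⁆ := by
  simp only [Fin.sum_univ_three, basisL, basisR, Matrix.cons_val_zero, Matrix.cons_val_one,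
    Matrix.cons_val, smul_lie, lie_sl2_E, lie_sl2_F, lie_sl2_H, map_add, map_smul,
    LinearMap.add_apply, LinearMap.smul_apply]
  module

/-- The Casimir eigenvalue on the adjoint representation, twice the dual Coxeter number 2. -/
theorem sum_lie_lie (x : Sl2) : ∑ i, ⁅basisL i, ⁅basisR i, x⁆⁆ = (4 : ℂ) • x := by
  conv_rhs => rw [sl2_eq x]
  simp only [Fin.sum_univ_three, basisL, basisR, Matrix.cons_val_zero, Matrix.cons_val_one,
    Matrix.cons_val, smul_lie, lie_sl2_E x, lie_sl2_F x, lie_sl2_H x, lie_add, lie_smul,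
    lie_E_F, lie_F_E, lie_E_H, lie_F_H, lie_H_E, lie_H_F]
  module

theorem sum_form_smul (x : Sl2) : ∑ i, form (basisR i) x • basisL i = x := by
  have hE : form xAlpha x = x.1 1 0 := by
    rw [form_apply, coe_xAlpha, Matrix.trace_fin_two]; simp [Matrix.mul_apply]
  have hF : form sl2F x = x.1 0 1 := by
    rw [form_apply, coe_sl2F, Matrix.trace_fin_two]; simp [Matrix.mul_apply]
  have hH : form sl2H x = 2 * x.1 0 0 := by
    rw [form_apply, coe_sl2H, Matrix.trace_fin_two]
    simp [Matrix.mul_apply]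
    linear_combination -sl2_trace x
  conv_rhs => rw [sl2_eq x]
  simp only [Fin.sum_univ_three, basisL, basisR, Matrix.cons_val_zero, Matrix.cons_val_one,
    Matrix.cons_val, map_smul, LinearMap.smul_apply, hE, hF, hH, smul_eq_mul]
  module

/-! ### The Casimir operator -/

section Casimir

variable {V : Type} [AddCommGroup V] [Module ℂ V] [Module UAffine V] [IsScalarTower ℂ UAffine V]

/-- The bilinear map `(a, b) ↦ a(m) b(n) v`. -/
def modePair (m n : ℤ) (v : V) : Sl2 →ₗ[ℂ] Sl2 →ₗ[ℂ] V :=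
  LinearMap.mk₂ ℂ (fun a b => mode a m (mode b n v))
    (fun a a' b => by rw [mode_add]; rfl) (fun c a b => by rw [mode_smul]; rfl)
    (fun a b b' => by rw [mode_add, LinearMap.add_apply, map_add])
    (fun c a b => by rw [mode_smul, LinearMap.smul_apply, map_smul])

theorem modePair_apply (m n : ℤ) (v : V) (a b : Sl2) :
    modePair m n v a b = mode a m (mode b n v) := rfl

theorem mode_sum {ι : Type} (s : Finset ι) (c : ι → ℂ) (a : ι → Sl2) (m : ℤ) (v : V) :
    mode (∑ i ∈ s, c i • a i) m v = ∑ i ∈ s, c i • mode (a i) m v := by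
  let g : Sl2 →ₗ[ℂ] V :=
    { toFun := fun a => mode a m v
      map_add' := fun a b => by rw [mode_add]; rfl
      map_smul' := fun c a => by rw [mode_smul]; rfl }
  have : g (∑ i ∈ s, c i • a i) = ∑ i ∈ s, c i • g (a i) := by rw [map_sum]; simp
  exact this

/-- A truncated Casimir operator: a multiple of the energy operator on vectors of energy at
most `D`. -/
def casimir (D : ℕ) (v : V) : V :=
  (1 / 2 : ℂ) • ∑ i, mode (basisL i) 0 (mode (basisR i) 0 v) +
    ∑ k ∈ Finset.range D, ∑ i, mode (basisL i) (-(k + 1)) (mode (basisR i) (k + 1) v)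

/-- `casimir` as a linear map. -/
def casimirL (D : ℕ) : Module.End ℂ V :=
  (1 / 2 : ℂ) • ∑ i, mode (basisL i) 0 * mode (basisR i) 0 +
    ∑ k ∈ Finset.range D, ∑ i, mode (basisL i) (-(k + 1)) * mode (basisR i) (k + 1)

theorem casimirL_apply (D : ℕ) (v : V) : casimirL D v = casimir D v := by
  simp [casimirL, casimir, LinearMap.sum_apply]

/-- The terms of the telescoping sum for the commutator of `casimir` with `x(-1)`. -/
def casimirBoundary (x : Sl2) (k : ℕ) (v : V) : V :=
  ∑ i, mode (basisL i) (-(k + 1)) (mode ⁅basisR i, x⁆ k v)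

theorem casimir_zero_term (hV : LevelOne V) (x : Sl2) (v : V) :
    (1 / 2 : ℂ) • ∑ i, mode (basisL i) 0 (mode (basisR i) 0 (mode x (-1) v)) =
      mode x (-1) ((1 / 2 : ℂ) • ∑ i, mode (basisL i) 0 (mode (basisR i) 0 v)) +
        (2 : ℂ) • mode x (-1) v - casimirBoundary x 0 v := by
  have h1 : ∀ i, mode (basisL i) 0 (mode (basisR i) 0 (mode x (-1) v)) =
      mode x (-1) (mode (basisL i) 0 (mode (basisR i) 0 v)) +
        modePair (-1) 0 v ⁅basisL i, x⁆ (basisR i) +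
        modePair (-1) 0 v ⁅basisR i, x⁆ (basisL i) + mode ⁅basisL i, ⁅basisR i, x⁆⁆ (-1) v := by
    intro i
    rw [mode_mode hV (basisR i) x, map_add, map_add, mode_mode hV (basisL i) x,
      mode_mode hV (basisL i) ⁅basisR i, x⁆]
    simp [modePair_apply]
    abel
  have h2 : ∑ i, mode ⁅basisL i, ⁅basisR i, x⁆⁆ (-1) v = (4 : ℂ) • mode x (-1) v := by
    have := mode_sum Finset.univ (fun _ => 1) (fun i => ⁅basisL i, ⁅basisR i, x⁆⁆) (-1) v
    simp only [one_smul] at this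
    rw [← this, sum_lie_lie, mode_smul]; rfl
  have h3 : casimirBoundary x 0 v = ∑ i, modePair (-1) 0 v (basisL i) ⁅basisR i, x⁆ := by
    simp [casimirBoundary, modePair_apply]
  simp only [h1, Finset.sum_add_distrib]
  rw [sum_lie_left, sum_lie_right, h2, h3, map_smul, map_sum]
  module

theorem casimir_succ_term (hV : LevelOne V) (x : Sl2) (k : ℕ) (v : V) :
    ∑ i, mode (basisL i) (-(k + 1)) (mode (basisR i) (k + 1) (mode x (-1) v)) =
      mode x (-1) (∑ i, mode (basisL i) (-(k + 1)) (mode (basisR i) (k + 1) v)) +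
        (casimirBoundary x k v - casimirBoundary x (k + 1) v) +
        if k = 0 then mode x (-1) v else 0 := by
  have h1 : ∀ i, mode (basisL i) (-(k + 1)) (mode (basisR i) (k + 1) (mode x (-1) v)) =
      mode x (-1) (mode (basisL i) (-(k + 1)) (mode (basisR i) (k + 1) v)) +
        mode (basisL i) (-(k + 1)) (mode ⁅basisR i, x⁆ k v) +
        modePair (-(k + 1) - 1) (k + 1) v ⁅basisL i, x⁆ (basisR i) +
        if k = 0 then form (basisR i) x • mode (basisL i) (-1) v else 0 := by
    intro i
    rw [mode_mode hV (basisR i) x, map_add, map_add, mode_mode hV (basisL i) x,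
      if_neg (by omega : ¬ (-((k : ℤ) + 1) + -1 = 0))]
    simp only [modePair_apply, ← sub_eq_add_neg, zero_smul, add_zero]
    rcases eq_or_ne k 0 with rfl | hk
    · simp
      abel
    · rw [if_neg (by omega), if_neg hk]
      simp
      abel
  have h2 : casimirBoundary x (k + 1) v =
      ∑ i, modePair (-(k + 1) - 1) (k + 1) v (basisL i) ⁅basisR i, x⁆ := by
    unfold casimirBoundary
    push_cast
    simp only [modePair_apply]
    rw [show -((k : ℤ) + 1 + 1) = -(k + 1) - 1 by ring]
  have h3 : (∑ i, if k = 0 then form (basisR i) x • mode (basisL i) (-1) v else 0) =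
      if k = 0 then mode x (-1) v else 0 := by
    split_ifs
    · rw [← mode_sum, sum_form_smul]
    · simp
  simp only [h1, Finset.sum_add_distrib]
  rw [h3, sum_lie_left, h2, casimirBoundary, map_sum]
  abel

/-- The Sugawara computation. The constant 3 is the level plus the dual Coxeter number: 2 is half
the adjoint Casimir eigenvalue, and 1 comes from the central term of the summand `k = 0`. The cross
terms telescope, leaving the boundary term in `hb`. -/
theorem casimir_mode (hV : LevelOne V) (x : Sl2) (D : ℕ) (v : V)
    (hb : casimirBoundary x (D + 1) v = 0) :
    casimir (D + 1) (mode x (-1) v) = mode x (-1) (casimir (D + 1) v) + (3 : ℂ) • mode x (-1) v := by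
  unfold casimir
  simp only [casimir_zero_term hV, casimir_succ_term hV, Finset.sum_add_distrib]
  rw [Finset.sum_range_sub', hb, Finset.sum_ite_eq' , if_pos (by simp), map_add,
    map_sum (mode x (-1))]
  module

end Casimir

/-! ### The energy filtration of a generalized Verma module -/

section Verma

variable {M : Type} [AddCommGroup M] [Module ℂ M] (ρ : Sl2 →ₗ⁅ℂ⁆ Module.End ℂ M)

/-- The inclusion of `M` as a linear map. -/
def vecL : M →ₗ[ℂ] GenVerma ρ where
  toFun := GenVerma.vec ρ
  map_add' v w := by
    rw [GenVerma.vec, TensorProduct.tmul_add]; rfl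
  map_smul' c v := by
    rw [GenVerma.vec, TensorProduct.tmul_smul]; rfl

theorem vecL_apply (w : M) : vecL ρ w = GenVerma.vec ρ w := rfl

theorem mk_tmul (u : UAffine) (w : M) :
    (Submodule.Quotient.mk (u ⊗ₜ[ℂ] w) : GenVerma ρ) = u • GenVerma.vec ρ w := by
  rw [GenVerma.vec, ← Submodule.Quotient.mk_smul, TensorProduct.smul_tmul', smul_eq_mul, mul_one]

theorem smul_vec {x : Affine} (hx : x ∈ nonneg) (w : M) :
    UniversalEnvelopingAlgebra.ι ℂ x • GenVerma.vec ρ w =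
      GenVerma.vec ρ (ρ (coeffZero x) w + coeffCentral x • w) := by
  rw [← mk_tmul, GenVerma.vec, Submodule.Quotient.eq]
  refine Submodule.subset_span ⟨1, UniversalEnvelopingAlgebra.ι ℂ ⟨x, hx⟩, w, ?_⟩
  rw [one_mul, inclU, UniversalEnvelopingAlgebra.lift_ι_apply, levelOneU,
    UniversalEnvelopingAlgebra.lift_ι_apply]
  rfl

theorem monomial_mem_nonneg (a : Sl2) {m : ℤ} (hm : 0 ≤ m) : monomial a m ∈ nonneg :=
  Submodule.subset_span (Or.inl ⟨a, m, hm, rfl⟩)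

theorem central_mem_nonneg : central ∈ nonneg := Submodule.subset_span (Or.inr rfl)

theorem mode_vec (a : Sl2) {m : ℤ} (hm : 0 ≤ m) (w : M) :
    mode a m (vecL ρ w) = if m = 0 then vecL ρ (ρ a w) else 0 := by
  rw [mode_apply, vecL_apply, smul_vec ρ (monomial_mem_nonneg a hm), coeffZero_monomial,
    coeffCentral_monomial, zero_smul, add_zero]
  split_ifs
  · rfl
  · rw [map_zero, LinearMap.zero_apply, ← vecL_apply, map_zero]

theorem verma_eq_top {W : Submodule ℂ (GenVerma ρ)}
    (h : ∀ (u : UAffine) (w : M), u • GenVerma.vec ρ w ∈ W) : W = ⊤ := by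
  rw [eq_top_iff]
  rintro x -
  obtain ⟨z, rfl⟩ := Submodule.Quotient.mk_surjective _ x
  induction z using TensorProduct.induction_on with
  | zero => exact W.zero_mem
  | tmul u w => rw [mk_tmul]; exact h u w
  | add y z hy hz => exact W.add_mem hy hz

theorem levelOne_verma : LevelOne (GenVerma ρ) := by
  let W : Submodule ℂ (GenVerma ρ) :=
    { carrier := {v | UniversalEnvelopingAlgebra.ι ℂ central • v = v}
      zero_mem' := smul_zero _
      add_mem' := fun {v w} hv hw => by
        change _ • (v + w) = v + w
        rw [smul_add, hv, hw]
      smul_mem' := fun c v hv => by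
        change _ • (c • v) = c • v
        rw [← algebraMap_smul UAffine c v, ← mul_smul, ← Algebra.commutes, mul_smul, hv] }
  have hcomm : ∀ u : UAffine, u * UniversalEnvelopingAlgebra.ι ℂ central =
      UniversalEnvelopingAlgebra.ι ℂ central * u := by
    intro u
    have : u ∈ Subalgebra.centralizer ℂ {UniversalEnvelopingAlgebra.ι ℂ central} := by
      rw [subalgebra_eq_top (Subalgebra.centralizer ℂ _) fun x => ?_]
      · trivial
      · rw [Subalgebra.mem_centralizer_iff]
        rintro _ rfl
        have h := (UniversalEnvelopingAlgebra.ι ℂ (L := Affine)).map_lie x central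
        rw [lie_central, map_zero, LieRing.of_associative_ring_bracket] at h
        exact (sub_eq_zero.1 h.symm).symm
    exact (Subalgebra.mem_centralizer_iff ℂ |>.1 this _ rfl).symm
  have hW : W = ⊤ := verma_eq_top ρ fun u w => by
    change _ • (u • GenVerma.vec ρ w) = u • GenVerma.vec ρ w
    rw [← mul_smul, ← hcomm, mul_smul, smul_vec ρ central_mem_nonneg, coeffZero_central,
      coeffCentral_central, map_zero, LinearMap.zero_apply, one_smul, zero_add]
  intro v
  have : v ∈ W := hW ▸ Submodule.mem_top
  exact this

/-- The subspace of energy `d`. -/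
def energy : ℕ → Submodule ℂ (GenVerma ρ)
  | 0 => LinearMap.range (vecL ρ)
  | d + 1 => ⨆ x : Sl2, (energy d).map (mode x (-1))

theorem mode_neg_mem {d : ℕ} (x : Sl2) {v : GenVerma ρ} (hv : v ∈ energy ρ d) :
    mode x (-1) v ∈ energy ρ (d + 1) :=
  Submodule.mem_iSup_of_mem x (Submodule.mem_map_of_mem hv)

theorem energy_succ_le {d : ℕ} {W : Submodule ℂ (GenVerma ρ)}
    (h : ∀ x, ∀ v ∈ energy ρ d, mode x (-1) v ∈ W) : energy ρ (d + 1) ≤ W :=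
  iSup_le fun x => Submodule.map_le_iff_le_comap.2 fun v hv => h x v hv

theorem mode_zero_mem {d : ℕ} (a : Sl2) {v : GenVerma ρ} (hv : v ∈ energy ρ d) :
    mode a 0 v ∈ energy ρ d := by
  induction d generalizing a v with
  | zero =>
    obtain ⟨w, rfl⟩ := hv
    rw [mode_vec ρ a le_rfl, if_pos rfl]
    exact ⟨_, rfl⟩
  | succ d ih =>
    suffices energy ρ (d + 1) ≤ (energy ρ (d + 1)).comap (mode a 0) from this hv
    refine energy_succ_le ρ fun x v hv => ?_
    rw [Submodule.mem_comap, mode_mode (levelOne_verma ρ), if_neg (by omega), zero_smul, add_zero,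
      zero_add]
    exact Submodule.add_mem _ (mode_neg_mem ρ x (ih a hv)) (mode_neg_mem ρ _ hv)

theorem mode_eq_zero {d : ℕ} (a : Sl2) {m : ℕ} (hm : d < m) {v : GenVerma ρ}
    (hv : v ∈ energy ρ d) : mode a m v = 0 := by
  induction d generalizing a m v with
  | zero =>
    obtain ⟨w, rfl⟩ := hv
    rw [mode_vec ρ a (by omega), if_neg (by omega)]
  | succ d ih =>
    suffices energy ρ (d + 1) ≤ LinearMap.ker (mode a m) from this hv
    refine energy_succ_le ρ fun x v hv => ?_
    have h1 : mode ⁅a, x⁆ ((m : ℤ) + -1) v = 0 := by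
      have := ih ⁅a, x⁆ (m := m - 1) (by omega) hv
      rwa [Nat.cast_sub (by omega)] at this
    rw [LinearMap.mem_ker, mode_mode (levelOne_verma ρ), if_neg (by omega), ih a (by omega) hv, h1]
    simp

theorem mode_one_mem {d : ℕ} (a : Sl2) {v : GenVerma ρ} (hv : v ∈ energy ρ (d + 1)) :
    mode a 1 v ∈ energy ρ d := by
  induction d generalizing a v with
  | zero =>
    suffices energy ρ (0 + 1) ≤ (energy ρ 0).comap (mode a 1) from this hv
    refine energy_succ_le ρ fun x v hv => ?_
    have h0 : mode a 1 v = 0 := mode_eq_zero ρ a (m := 1) (by omega) hv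
    rw [Submodule.mem_comap, mode_mode (levelOne_verma ρ), h0, map_zero, zero_add]
    exact Submodule.add_mem _ (mode_zero_mem ρ _ hv) (Submodule.smul_mem _ _ hv)
  | succ d ih =>
    suffices energy ρ (d + 1 + 1) ≤ (energy ρ (d + 1)).comap (mode a 1) from this hv
    refine energy_succ_le ρ fun x v hv => ?_
    rw [Submodule.mem_comap, mode_mode (levelOne_verma ρ)]
    exact Submodule.add_mem _ (Submodule.add_mem _ (mode_neg_mem ρ x (ih a hv))
      (mode_zero_mem ρ _ hv)) (Submodule.smul_mem _ _ hv)

theorem exists_lie_eq (z : Sl2) : ∃ a b : Fin 3 → Sl2, z = ∑ i, ⁅a i, b i⁆ := by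
  refine ⟨![sl2H, sl2H, xAlpha], ![(z.1 0 1 / 2) • xAlpha, (-z.1 1 0 / 2) • sl2F,
    z.1 0 0 • sl2F], ?_⟩
  conv_lhs => rw [sl2_eq z]
  simp only [Fin.sum_univ_three, Matrix.cons_val_zero, Matrix.cons_val_one, Matrix.cons_val,
    lie_smul, lie_H_E, lie_H_F, lie_E_F]
  module

/-- The layers are built with the modes x(-1) alone. Since 𝔰𝔩(2) is perfect, brackets of the modes 0
and ±1 produce all modes, so the sum of the layers is a submodule, and it contains the top. -/
theorem iSup_energy : ⨆ d, energy ρ d = ⊤ := by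
  have hl := levelOne_verma ρ
  set W := ⨆ d, energy ρ d with hW
  have key : ∀ {a : Sl2} {m : ℤ}, (∀ d, ∀ v ∈ energy ρ d, mode a m v ∈ W) →
      ∀ w ∈ W, mode a m w ∈ W := fun {a m} h w hw => by
    suffices W ≤ W.comap (mode a m) from this hw
    exact iSup_le fun d v hv => h d v hv
  have hE : ∀ d, energy ρ d ≤ W := le_iSup _
  have h0 : ∀ a, ∀ w ∈ W, mode a 0 w ∈ W := fun a =>
    key fun d v hv => hE d (mode_zero_mem ρ a hv)
  have hm1 : ∀ a, ∀ w ∈ W, mode a (-1) w ∈ W := fun a =>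
    key fun d v hv => hE (d + 1) (mode_neg_mem ρ a hv)
  have h1 : ∀ a, ∀ w ∈ W, mode a 1 w ∈ W := fun a => key fun d v hv => by
    cases d with
    | zero =>
      have : mode a 1 v = 0 := mode_eq_zero ρ a (m := 1) (by omega) hv
      rw [this]; exact W.zero_mem
    | succ d => exact hE d (mode_one_mem ρ a hv)
  have hstep : ∀ m e : ℤ, (∀ a, ∀ w ∈ W, mode a m w ∈ W) → (∀ a, ∀ w ∈ W, mode a e w ∈ W) →
      ∀ a, ∀ w ∈ W, mode a (m + e) w ∈ W := by
    intro m e hm he a w hw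
    obtain ⟨p, q, hs⟩ := exists_lie_eq a
    have h2 : mode a (m + e) w = ∑ i, mode ⁅p i, q i⁆ (m + e) w := by
      have := mode_sum Finset.univ (fun _ => 1) (fun i => ⁅p i, q i⁆) (m + e) w
      simpa only [one_smul, ← hs] using this
    rw [h2]
    refine Submodule.sum_mem _ fun i _ => ?_
    have h3 := mode_mode hl (p i) (q i) m e w
    rw [add_assoc] at h3
    have h4 : mode ⁅p i, q i⁆ (m + e) w =
        mode (p i) m (mode (q i) e w) - mode (q i) e (mode (p i) m w) -
        (if m + e = 0 then (m : ℂ) * form (p i) (q i) else 0) • w := by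
      rw [h3]; abel
    rw [h4]
    exact W.sub_mem (W.sub_mem (hm _ _ (he _ _ hw)) (he _ _ (hm _ _ hw))) (W.smul_mem _ hw)
  have hall : ∀ (m : ℤ) a, ∀ w ∈ W, mode a m w ∈ W := by
    intro m
    induction m using Int.induction_on with
    | zero => exact h0
    | succ i ih => exact hstep _ _ ih h1
    | pred i ih => exact hstep _ _ ih hm1
  refine verma_eq_top ρ fun u w => smul_mem_of_mode hl (fun a m => hall m a) u ?_
  exact hE 0 ⟨w, rfl⟩

/-- The Casimir element of `𝔤` acts on `M` by the scalar `c`. -/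
def HasCasimir (c : ℂ) : Prop := ∀ w, ∑ i, ρ (basisL i) (ρ (basisR i) w) = c • w

/-- The eigenvalues for different `d` are distinct, so `casimir` separates the layers. -/
theorem casimir_energy {c : ℂ} (hc : HasCasimir ρ c) {d D : ℕ} (hd : d ≤ D) {v : GenVerma ρ}
    (hv : v ∈ energy ρ d) : casimir (D + 1) v = (c / 2 + 3 * d) • v := by
  induction d generalizing v with
  | zero =>
    obtain ⟨w, rfl⟩ := hv
    have h1 : ∀ k : ℕ, ∀ i, mode (basisR i) ((k : ℤ) + 1) (vecL ρ w) = 0 := fun k i => by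
      rw [mode_vec ρ _ (by omega), if_neg (by omega)]
    simp only [casimir, h1, map_zero, Finset.sum_const_zero, add_zero, mode_vec ρ _ le_rfl,
      if_true]
    rw [← map_sum, hc w, map_smul, smul_smul]
    congr 1
    push_cast
    ring
  | succ d ih =>
    suffices energy ρ (d + 1) ≤
        LinearMap.ker (casimirL (D + 1) - (c / 2 + 3 * (d + 1 : ℕ)) • LinearMap.id) by
      have := this hv
      rw [LinearMap.mem_ker, LinearMap.sub_apply, casimirL_apply, sub_eq_zero] at this
      exact this
    refine energy_succ_le ρ fun x v hv => ?_
    have hb : casimirBoundary x (D + 1) v = 0 := by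
      refine Finset.sum_eq_zero fun i _ => ?_
      rw [mode_eq_zero ρ _ (by omega) hv, map_zero]
    rw [LinearMap.mem_ker, LinearMap.sub_apply, casimirL_apply, sub_eq_zero,
      casimir_mode (levelOne_verma ρ) x D v hb, ih (by omega) hv, map_smul, LinearMap.smul_apply,
      LinearMap.id_apply, ← add_smul]
    congr 1
    push_cast
    ring

/-- `M` is irreducible. -/
def IsIrred : Prop :=
  ∀ W : Submodule ℂ M, (∀ a, ∀ w ∈ W, ρ a w ∈ W) → W ≠ ⊥ → W = ⊤

/-- A submodule contains the energy zero part of each of its vectors. If such a part were nonzero,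
irreducibility of `M` would put the whole top, and then the whole module, into `S`. -/
theorem le_of_ne_top {c : ℂ} (hc : HasCasimir ρ c) (hirr : IsIrred ρ)
    {S : Submodule UAffine (GenVerma ρ)} (hS : S ≠ ⊤) :
    S.restrictScalars ℂ ≤ ⨆ d, energy ρ (d + 1) := by
  intro s hs
  have hsc : ∀ (c : ℂ), ∀ v ∈ S, c • v ∈ S := fun c v hv => (S.restrictScalars ℂ).smul_mem c hv
  have hcas : ∀ D, ∀ v ∈ S, casimir D v ∈ S := fun D v hv =>
    S.add_mem (hsc _ _ (S.sum_mem fun i _ => S.smul_mem _ (S.smul_mem _ hv)))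
      (S.sum_mem fun k _ => S.sum_mem fun i _ => S.smul_mem _ (S.smul_mem _ hv))
  -- Subtracting from `casimir` its eigenvalue on the highest layer removes the last term and
  -- multiplies `f 0` by `-3 (D + 1)`, which is nonzero. Directness of the sum of the layers is not
  -- needed.
  have key : ∀ (D : ℕ) (f : ℕ → GenVerma ρ), (∀ d, f d ∈ energy ρ d) →
      ∑ d ∈ Finset.range (D + 1), f d ∈ S → f 0 ∈ S := by
    intro D
    induction D with
    | zero => intro f _ h; simpa using h
    | succ D ih =>
      intro f hf h
      have h1 : casimir (D + 1 + 1) (∑ d ∈ Finset.range (D + 1 + 1), f d) =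
          ∑ d ∈ Finset.range (D + 1 + 1), (c / 2 + 3 * d) • f d := by
        rw [← casimirL_apply, map_sum]
        refine Finset.sum_congr rfl fun d hd => ?_
        rw [Finset.mem_range] at hd
        rw [casimirL_apply, casimir_energy ρ hc (by omega) (hf d)]
      have h2 := S.sub_mem (hcas (D + 1 + 1) _ h) (hsc (c / 2 + 3 * (D + 1 : ℕ)) _ h)
      rw [h1, Finset.smul_sum, ← Finset.sum_sub_distrib, Finset.sum_range_succ, sub_self,
        add_zero] at h2
      simp only [← sub_smul] at h2
      have h3 := ih _ (fun d => (energy ρ d).smul_mem _ (hf d)) h2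
      have h4 := hsc (c / 2 + 3 * (0 : ℕ) - (c / 2 + 3 * (D + 1 : ℕ)))⁻¹ _ h3
      rwa [smul_smul, inv_mul_cancel₀, one_smul] at h4
      push_cast
      have : (D : ℂ) + 1 ≠ 0 := Nat.cast_add_one_ne_zero D
      intro h5
      apply this
      linear_combination -(1 / 3 : ℂ) * h5
  have hs' : s ∈ ⨆ d, energy ρ d := iSup_energy ρ ▸ Submodule.mem_top
  obtain ⟨f, hf, rfl⟩ := (Submodule.mem_iSup_iff_exists_finsupp _ _).1 hs'
  have hsub : f.support ⊆ Finset.range (f.support.sup id + 1) := fun d hd =>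
    Finset.mem_range.2 (Nat.lt_succ_of_le (Finset.le_sup (f := id) hd))
  have hsum : (f.sum fun _ x => x) = ∑ d ∈ Finset.range (f.support.sup id + 1), f d :=
    Finset.sum_subset hsub fun d _ hd => Finsupp.notMem_support_iff.1 hd
  rw [hsum] at hs ⊢
  have hf0 : f 0 ∈ S := key _ f hf hs
  have hzero : f 0 = 0 := by
    obtain ⟨w, hw⟩ := hf 0
    by_contra hne
    refine hS ?_
    have hW := hirr ((S.restrictScalars ℂ).comap (vecL ρ)) (fun a w hw => ?_) ?_
    · have := verma_eq_top ρ (W := S.restrictScalars ℂ) fun u w => S.smul_mem u (by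
        have : w ∈ (S.restrictScalars ℂ).comap (vecL ρ) := hW ▸ Submodule.mem_top
        exact this)
      exact Submodule.restrictScalars_eq_top_iff ℂ UAffine _ |>.1 this
    · change vecL ρ (ρ a w) ∈ S
      have := mode_vec ρ a le_rfl w
      rw [if_pos rfl] at this
      rw [← this]
      exact S.smul_mem _ hw
    · intro hbot
      have : w ∈ (S.restrictScalars ℂ).comap (vecL ρ) := by
        change vecL ρ w ∈ S
        rwa [hw]
      rw [hbot, Submodule.mem_bot] at this
      exact hne (by rw [← hw, this, map_zero])
  rw [Finset.sum_range_succ', hzero, add_zero]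
  exact Submodule.sum_mem _ fun d _ => Submodule.mem_iSup_of_mem d (hf (d + 1))

end Verma

/-! ### The level one representation on Fock space -/

/-- The action of `a ⊗ t^m` on Fock space. -/
def current (m : ℤ) : Sl2 →ₗ[ℂ] Module.End ℂ Fock where
  toFun x := ∑ a, ∑ b, x.1 a b • J a b m
  map_add' x y := by
    simp only [← Finset.sum_add_distrib, ← add_smul]; rfl
  map_smul' c x := by
    simp only [Finset.smul_sum, smul_smul]; rfl

theorem current_apply (m : ℤ) (x : Sl2) : current m x = ∑ a, ∑ b, x.1 a b • J a b m := rfl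

theorem current_xAlpha (m : ℤ) : current m xAlpha = J 0 1 m := by
  rw [current_apply, coe_xAlpha]; simp [Fin.sum_univ_two]

theorem current_comm (x y : Sl2) (m n : ℤ) :
    current m x * current n y - current n y * current m x =
      current (m + n) ⁅x, y⁆ + (if m + n = 0 then (m : ℂ) * form x y else 0) • 1 := by
  have h1 : current m x * current n y - current n y * current m x =
      ∑ a, ∑ b, ∑ c, ∑ d, (x.1 a b * y.1 c d) • (J a b m * J c d n - J c d n * J a b m) := by
    simp only [current_apply, Fin.sum_univ_two, add_mul, mul_add, smul_mul_assoc, mul_smul_comm,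
      smul_sub]
    module
  have h2 : ∀ a b c d, J a b m * J c d n - J c d n * J a b m =
      delta b c • J a d (m + n) - delta d a • J c b (m + n) +
        (delta b c * delta d a * delta (m + n) 0 * m) • 1 := fun a b c d => by
    rw [J_mul_J, add_sub_cancel_left]
  have h3 : (if m + n = 0 then (m : ℂ) * form x y else 0) = delta (m + n) 0 * m * form x y := by
    unfold delta; split_ifs <;> simp
  rw [h1, h3, form_apply, current_apply, LieAlgebra.SpecialLinear.sl_bracket, Matrix.trace_fin_two]
  simp only [h2, Fin.sum_univ_two, Matrix.sub_apply, Matrix.mul_apply, delta_self,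
    delta_of_ne (zero_ne_one : (0 : Fin 2) ≠ 1), delta_of_ne (one_ne_zero : (1 : Fin 2) ≠ 0)]
  module

/-- The linear map underlying the representation of `𝔤̂` on Fock space. -/
def fockLin : Affine →ₗ[ℂ] Module.End ℂ Fock where
  toFun x := Finsupp.lsum ℂ current
    (LieAlgebra.LoopAlgebra.toFinsupp ℂ ℤ Sl2 ((LieAlgebra.ofProd cocycle).symm x).1) +
      coeffCentral x • 1
  map_add' x y := by
    rw [LieAlgebra.of_symm_add, Prod.fst_add, map_add, map_add, map_add, add_smul]; abel
  map_smul' c x := by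
    rw [LieAlgebra.of_symm_smul, Prod.smul_fst, map_smul, map_smul, map_smul, smul_assoc,
      ← smul_add]; rfl

theorem fockLin_monomial (a : Sl2) (m : ℤ) : fockLin (monomial a m) = current m a := by
  change Finsupp.lsum ℂ current (LieAlgebra.LoopAlgebra.toFinsupp ℂ ℤ Sl2 (loopMonomial a m)) +
    coeffCentral (monomial a m) • 1 = _
  rw [toFinsupp_loopMonomial, coeffCentral_monomial, zero_smul, add_zero]
  simp

theorem fockLin_central : fockLin central = 1 := by
  change Finsupp.lsum ℂ current (LieAlgebra.LoopAlgebra.toFinsupp ℂ ℤ Sl2 0) +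
    coeffCentral central • 1 = _
  rw [map_zero, map_zero, coeffCentral_central, one_smul, zero_add]

/-- The level one representation of `𝔤̂` on Fock space. -/
def fockRep : Affine →ₗ⁅ℂ⁆ Module.End ℂ Fock where
  toLinearMap := fockLin
  map_lie' {x y} := by
    change fockLin ⁅x, y⁆ = fockLin x * fockLin y - fockLin y * fockLin x
    have hc : ∀ x, fockLin ⁅x, central⁆ = fockLin x * fockLin central -
        fockLin central * fockLin x := fun x => by
      rw [lie_central, map_zero, fockLin_central, mul_one, one_mul, sub_self]
    induction x using affine_induction with
    | hm a m =>
      induction y using affine_induction with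
      | hm b n =>
        rw [lie_monomial, map_add, map_smul, fockLin_monomial, fockLin_monomial, fockLin_monomial,
          fockLin_central, current_comm]
      | hc => exact hc _
      | h0 => simp
      | ha u v hu hv => rw [lie_add, map_add, hu, hv, map_add, mul_add, add_mul]; abel
      | hs c u hu => rw [lie_smul, map_smul, hu, map_smul, mul_smul_comm, smul_mul_assoc, smul_sub]
    | hc =>
      rw [← lie_skew, map_neg, hc]; abel
    | h0 => simp
    | ha u v hu hv => rw [add_lie, map_add, hu, hv, map_add, mul_add, add_mul]; abel
    | hs c u hu => rw [smul_lie, map_smul, hu, map_smul, mul_smul_comm, smul_mul_assoc, smul_sub]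

theorem fockRep_apply (x : Affine) : fockRep x = fockLin x := rfl

instance : Module UAffine Fock :=
  Module.compHom Fock (UniversalEnvelopingAlgebra.lift ℂ fockRep).toRingHom

theorem smul_fock (u : UAffine) (v : Fock) :
    u • v = UniversalEnvelopingAlgebra.lift ℂ fockRep u v := rfl

instance : IsScalarTower ℂ UAffine Fock :=
  ⟨fun c u v => by rw [smul_fock, map_smul]; rfl⟩

theorem mode_fock (a : Sl2) (m : ℤ) (v : Fock) : mode a m v = current m a v := by
  rw [mode_apply, smul_fock, UniversalEnvelopingAlgebra.lift_ι_apply, fockRep_apply,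
    fockLin_monomial]

theorem levelOne_fock : LevelOne Fock := fun v => by
  rw [smul_fock, UniversalEnvelopingAlgebra.lift_ι_apply, fockRep_apply, fockLin_central]; rfl

theorem mem_sl2 {m : Matrix (Fin 2) (Fin 2) ℂ} (h : m 0 0 + m 1 1 = 0) :
    m ∈ LieAlgebra.SpecialLinear.sl (Fin 2) ℂ := by
  rw [LieAlgebra.SpecialLinear.sl]
  simpa [Matrix.trace_fin_two] using h

/-- The conjugate transpose of an element of `𝔰𝔩(2)`. -/
def conjT (x : Sl2) : Sl2 := ⟨x.1.conjTranspose, mem_sl2 (by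
  simpa using congrArg star (sl2_trace x))⟩

/-- Unitarity of the Fock representation; the complex conjugates in `conjT` come from antilinearity
of `herm` in its first argument. -/
theorem isAdj_current (x : Sl2) (m : ℤ) : IsAdj (current m x) (current (-m) (conjT x)) := by
  intro u v
  simp only [current_apply, conjT, Fin.sum_univ_two, LinearMap.add_apply, LinearMap.smul_apply,
    herm_add_left, herm_add_right, herm_smul_left, herm_smul_right, isAdj_J _ _ m u v,
    Matrix.conjTranspose_apply]
  ring

/-! ### Realization of the standard modules -/

section Realization

variable {M : Type} [AddCommGroup M] [Module ℂ M] (ρ : Sl2 →ₗ⁅ℂ⁆ Module.End ℂ M)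
  (j : M →ₗ[ℂ] Fock)

/-- The map `j` is compatible with the action of `𝔤̂_{≥ 0}`. -/
def IsTop : Prop :=
  ∀ (a : Sl2) (m : ℤ), 0 ≤ m → ∀ w, current m a (j w) = if m = 0 then j (ρ a w) else 0

variable {ρ j}

theorem IsTop.fockRep_apply (h : IsTop ρ j) (x : nonneg) (w : M) :
    fockRep x.1 (j w) = j (levelOne ρ x w) := by
  obtain ⟨x, hx⟩ := x
  change fockLin x (j w) = j (ρ (coeffZero x) w + coeffCentral x • w)
  have hx' : x ∈ Submodule.span ℂ nonnegGenerators := hx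
  clear hx
  induction hx' using Submodule.span_induction with
  | mem x hx =>
    rcases hx with ⟨a, m, hm, rfl⟩ | rfl
    · rw [fockLin_monomial, h a m hm, coeffZero_monomial, coeffCentral_monomial]
      split_ifs <;> simp
    · rw [fockLin_central, coeffZero_central, coeffCentral_central]; simp
  | zero => simp
  | add x y _ _ hx hy =>
    simp only [map_add, LinearMap.add_apply, hx, hy, add_smul]; abel
  | smul c x _ hx => simp [hx, mul_smul]

theorem IsTop.inclU_smul (h : IsTop ρ j) (b : UniversalEnvelopingAlgebra ℂ nonneg) (w : M) :
    inclU nonneg b • j w = j (levelOneU ρ b w) := by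
  let S : Subalgebra ℂ (UniversalEnvelopingAlgebra ℂ nonneg) :=
    { carrier := {b | ∀ w, inclU nonneg b • j w = j (levelOneU ρ b w)}
      mul_mem' := fun {b c} hb hc w => by
        rw [map_mul, mul_smul, hc, hb, map_mul]; rfl
      add_mem' := fun {b c} hb hc w => by
        rw [map_add, add_smul, hc, hb, map_add, LinearMap.add_apply, map_add]
      algebraMap_mem' := fun c w => by
        rw [AlgHom.commutes, AlgHom.commutes, algebraMap_smul, Module.algebraMap_end_apply,
          map_smul] }
  have hS : b ∈ S := by
    rw [subalgebra_eq_top S fun x w => ?_]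
    · trivial
    · rw [inclU, UniversalEnvelopingAlgebra.lift_ι_apply, levelOneU,
        UniversalEnvelopingAlgebra.lift_ι_apply, smul_fock]
      change UniversalEnvelopingAlgebra.lift ℂ fockRep (UniversalEnvelopingAlgebra.ι ℂ x.1) _ = _
      rw [UniversalEnvelopingAlgebra.lift_ι_apply, h.fockRep_apply]
  exact hS w

/-- The map from the generalized Verma module to Fock space extending `j`. -/
def IsTop.toFock (h : IsTop ρ j) : GenVerma ρ →ₗ[UAffine] Fock :=
  (balanced ρ).liftQ
    (TensorProduct.AlgebraTensorModule.lift
      { toFun := fun u : UAffine =>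
          { toFun := fun w => u • j w
            map_add' := fun v w => by rw [map_add, smul_add]
            map_smul' := fun c w => by
              rw [map_smul, RingHom.id_apply, ← algebraMap_smul UAffine c (j w), ← mul_smul,
                ← Algebra.commutes, mul_smul, algebraMap_smul] }
        map_add' := fun u v => LinearMap.ext fun w => add_smul _ _ _
        map_smul' := fun u v => LinearMap.ext fun w => mul_smul _ _ _ })
    (by
      rw [balanced, Submodule.span_le]
      rintro _ ⟨u, b, m, rfl⟩
      change _ = _
      rw [map_sub, TensorProduct.AlgebraTensorModule.lift_tmul,
        TensorProduct.AlgebraTensorModule.lift_tmul, sub_eq_zero]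
      change (u * inclU nonneg b) • j m = u • j (levelOneU ρ b m)
      rw [mul_smul, h.inclU_smul])

theorem IsTop.toFock_vec (h : IsTop ρ j) (w : M) : h.toFock (GenVerma.vec ρ w) = j w := by
  change (1 : UAffine) • j w = j w
  rw [one_smul]

theorem IsTop.toFock_mode (h : IsTop ρ j) (a : Sl2) (m : ℤ) (v : GenVerma ρ) :
    h.toFock (mode a m v) = current m a (h.toFock v) := by
  rw [mode_apply, map_smul, ← mode_apply, mode_fock]

/-- The orthogonal complement `O` of the image of `S` contains the top, because `S` has positive
energy, and by unitarity it is stable under all modes. Hence `O` contains the whole image of the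
Verma module. In particular the image of `S` is orthogonal to itself, so it is zero. -/
theorem IsTop.le_ker (h : IsTop ρ j) {c : ℂ} (hc : HasCasimir ρ c) (hirr : IsIrred ρ)
    {S : Submodule UAffine (GenVerma ρ)} (hS : S ≠ ⊤) : S ≤ LinearMap.ker h.toFock := by
  let O : Submodule ℂ Fock :=
    { carrier := {y | ∀ s ∈ S, herm y (h.toFock s) = 0}
      zero_mem' := fun s _ => herm_zero_left _
      add_mem' := fun {y z} hy hz s hs => by rw [herm_add_left, hy s hs, hz s hs, add_zero]
      smul_mem' := fun c y hy s hs => by rw [herm_smul_left, hy s hs, mul_zero] }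
  have htop : ∀ w, j w ∈ O := by
    intro w s hs
    let g : GenVerma ρ →ₗ[ℂ] ℂ :=
      { toFun := fun v => herm (j w) (h.toFock v)
        map_add' := fun u v => by rw [map_add, herm_add_right]
        map_smul' := fun c v => by
          rw [LinearMap.map_smul_of_tower, herm_smul_right]; rfl }
    have hg : ⨆ d, energy ρ (d + 1) ≤ LinearMap.ker g := by
      refine iSup_le fun d => energy_succ_le ρ fun x v _ => ?_
      change herm (j w) (h.toFock (mode x (-1) v)) = 0
      rw [h.toFock_mode, ← (isAdj_current x (-1)).symm, neg_neg, h _ 1 (by omega),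
        if_neg (by omega), herm_zero_left]
    exact hg (le_of_ne_top ρ hc hirr hS hs)
  have hO : ∀ a m, ∀ y ∈ O, mode a m y ∈ O := by
    intro a m y hy s hs
    rw [mode_fock, isAdj_current a m, ← h.toFock_mode]
    exact hy _ (S.smul_mem _ hs)
  have hall : O.comap (h.toFock.restrictScalars ℂ) = ⊤ := verma_eq_top ρ fun u w => by
    change h.toFock (u • GenVerma.vec ρ w) ∈ O
    rw [map_smul, h.toFock_vec]
    exact smul_mem_of_mode levelOne_fock hO u (htop w)
  intro s hs
  have hsO : s ∈ O.comap (h.toFock.restrictScalars ℂ) := hall ▸ Submodule.mem_top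
  exact eq_zero_of_herm_self (hsO s hs)

/-- The maximal proper submodule is the kernel of the map to Fock space. -/
theorem IsTop.maxProper_eq (h : IsTop ρ j) {c : ℂ} (hc : HasCasimir ρ c) (hirr : IsIrred ρ)
    {w : M} (hw : j w ≠ 0) : maxProper ρ = LinearMap.ker h.toFock := by
  refine le_antisymm (sSup_le fun S hS => h.le_ker hc hirr hS) (le_sSup ?_)
  -- The kernel is one of the proper submodules in the supremum, since `toFock` does not vanish on
  -- the vector over `w`.
  intro htop
  have : GenVerma.vec ρ w ∈ LinearMap.ker h.toFock := htop ▸ Submodule.mem_top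
  exact hw (by rw [← h.toFock_vec]; exact this)

end Realization

/-! ### The two standard modules -/

theorem vac_ne_zero : vac ≠ 0 := fun h => by
  have h1 : herm vac vac = 1 := by rw [vac, herm_state, if_pos rfl]
  rw [h, herm_zero_left] at h1
  exact zero_ne_one h1

theorem isIrred_trivialRep : IsIrred trivialRep := fun W _ hW =>
  (eq_bot_or_eq_top W).resolve_left hW

theorem hasCasimir_trivialRep : HasCasimir trivialRep 0 := fun w => by
  simp [trivialRep]

theorem isIrred_vectorRep : IsIrred vectorRep := by
  intro W hW hne
  obtain ⟨w, hw, hw0⟩ := W.ne_bot_iff.1 hne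
  have hE : ∀ w ∈ W, ![w 1, 0] ∈ W := fun w hw => by
    have := hW xAlpha w hw
    rw [vectorRep_apply, coe_xAlpha] at this
    convert this using 1
    ext i; fin_cases i <;> simp [Matrix.mulVec, dotProduct, Fin.sum_univ_two]
  have hF : ∀ w ∈ W, ![0, w 0] ∈ W := fun w hw => by
    have := hW sl2F w hw
    rw [vectorRep_apply, coe_sl2F] at this
    convert this using 1
    ext i; fin_cases i <;> simp [Matrix.mulVec, dotProduct, Fin.sum_univ_two]
  have h0 : ∃ c : ℂ, c ≠ 0 ∧ ![c, 0] ∈ W := by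
    by_cases h1 : w 1 = 0
    · refine ⟨w 0, fun h => hw0 ?_, ?_⟩
      · ext i; fin_cases i <;> simp [h, h1]
      · convert hw using 1
        ext i; fin_cases i <;> simp [h1]
    · exact ⟨w 1, h1, hE w hw⟩
  obtain ⟨c, hc, h0⟩ := h0
  have h1 := hF _ h0
  rw [eq_top_iff]
  rintro v -
  have hv : v = (v 0 / c) • ![c, 0] + (v 1 / c) • ![0, (![c, 0] : Fin 2 → ℂ) 0] := by
    ext i; fin_cases i <;> simp [hc]
  rw [hv]
  exact W.add_mem (W.smul_mem _ h0) (W.smul_mem _ h1)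

theorem hasCasimir_vectorRep : HasCasimir vectorRep (3 / 2) := by
  intro w
  simp only [Fin.sum_univ_three, basisL, basisR, Matrix.cons_val_zero, Matrix.cons_val_one,
    Matrix.cons_val]
  rw [map_smul, LinearMap.smul_apply]
  simp only [vectorRep_apply, coe_xAlpha, coe_sl2F, coe_sl2H]
  ext i
  fin_cases i <;> simp [dotProduct, Fin.sum_univ_two] <;> ring

/-- The top of `L(Λ₀)` in Fock space. -/
def top0 : ℂ →ₗ[ℂ] Fock := LinearMap.toSpanSingleton ℂ Fock vac

/-- The top of `L(Λ₁)` in Fock space. -/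
def top1 : (Fin 2 → ℂ) →ₗ[ℂ] Fock := Fintype.linearCombination ℂ fun a => P a 1 vac

theorem isTop0 : IsTop trivialRep top0 := by
  intro a m hm w
  have : current m a vac = 0 := by
    simp [current_apply, J_vac _ _ hm]
  simp [top0, trivialRep, this]

/-- Nonnegative currents kill the vacuum, so they act only on the single particle; for `m ≥ 1` they
lower it to a filled level, where `P` vanishes on the vacuum. -/
theorem isTop1 : IsTop vectorRep top1 := by
  intro a m hm w
  have h : ∀ c, current m a (P c 1 vac) = ∑ b, a.1 b c • P b (1 - m) vac := by
    intro c
    have : ∀ b d, J b d m (P c 1 vac) = delta d c • P b (1 - m) vac := fun b d => by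
      rw [← Module.End.mul_apply, J_mul_P, LinearMap.add_apply, Module.End.mul_apply,
        J_vac _ _ hm, map_zero, zero_add]
      rfl
    simp only [current_apply, LinearMap.sum_apply, LinearMap.smul_apply, this, delta, ite_smul,
      one_smul, zero_smul, smul_ite, smul_zero, Finset.sum_ite_eq', Finset.mem_univ, if_true]
  simp only [top1, Fintype.linearCombination_apply, map_sum, map_smul, h]
  split_ifs with h0
  · subst h0
    rw [vectorRep_apply]
    simp [Fin.sum_univ_two, Matrix.mulVec, dotProduct]
    module
  · simp [P_vac _ (show 1 - m ≤ 0 by omega)]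

theorem top0_one : top0 1 = vac := by simp [top0]

theorem top1_one : top1 ![1, 0] = P 0 1 vac := by
  simp [top1, Fintype.linearCombination_apply, Fin.sum_univ_two]

theorem P_vac_ne_zero : P 0 1 vac ≠ 0 := fun h => vac_ne_zero (by
  rw [← trans_zero_P_vac, h, map_zero])

theorem maxProper0 : maxProper trivialRep = LinearMap.ker isTop0.toFock :=
  isTop0.maxProper_eq hasCasimir_trivialRep isIrred_trivialRep (w := 1)
    (by rw [top0_one]; exact vac_ne_zero)

theorem maxProper1 : maxProper vectorRep = LinearMap.ker isTop1.toFock :=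
  isTop1.maxProper_eq hasCasimir_vectorRep isIrred_vectorRep (w := ![1, 0])
    (by rw [top1_one]; exact P_vac_ne_zero)

/-- `a · v_{Λ₀} = 0` can be tested on the vacuum. -/
theorem smul_v0_eq_zero (u : UAffine) : u • v0 = 0 ↔ u • vac = 0 := by
  rw [v0, ← map_smul, Pi0, toStandard, Submodule.mkQ_apply, Submodule.Quotient.mk_eq_zero,
    maxProper0, LinearMap.mem_ker, map_smul, vN0, isTop0.toFock_vec, top0_one]

theorem smul_v1_eq_zero (u : UAffine) : u • v1 = 0 ↔ u • P 0 1 vac = 0 := by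
  rw [v1, ← map_smul, Pi1, toStandard, Submodule.mkQ_apply, Submodule.Quotient.mk_eq_zero,
    maxProper1, LinearMap.mem_ker, map_smul, vN1, isTop1.toFock_vec, top1_one]

/-! ### The enveloping algebras of the nilpotent subalgebras -/

theorem lie_nilSub {S : Set ℤ} (x y : nilSub S) : ⁅x, y⁆ = 0 := by
  apply Subtype.ext
  obtain ⟨x, hx⟩ := x
  obtain ⟨y, hy⟩ := y
  change ⁅x, y⁆ = 0
  have hx' : x ∈ Submodule.span ℂ (monomial xAlpha '' S) := hx
  have hy' : y ∈ Submodule.span ℂ (monomial xAlpha '' S) := hy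
  refine Submodule.span_induction₂ (p := fun x y _ _ => ⁅x, y⁆ = 0)
      ?_ ?_ ?_ ?_ ?_ ?_ ?_ hx' hy'
  · rintro _ _ ⟨m, -, rfl⟩ ⟨n, -, rfl⟩
    have h : form xAlpha xAlpha = 0 := by
      simp [form_apply, xAlpha]
    have h0 : monomial 0 (m + n) = 0 := by
      simpa using monomial_smul 0 0 (m + n)
    rw [lie_monomial, lie_self, h, h0]
    simp
  · intro y _; exact zero_lie y
  · intro y _; exact lie_zero y
  · intro x y z _ _ _ h h'; rw [add_lie, h, h', add_zero]
  · intro x y z _ _ _ h h'; rw [lie_add, h, h', add_zero]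
  · intro c x y _ _ h; rw [smul_lie, h, smul_zero]
  · intro c x y _ _ h; rw [lie_smul, h, smul_zero]

theorem nilSub_mul_comm {S : Set ℤ} (a b : UniversalEnvelopingAlgebra ℂ (nilSub S)) :
    a * b = b * a := by
  have h1 : ∀ (x : nilSub S) (b : UniversalEnvelopingAlgebra ℂ (nilSub S)),
      UniversalEnvelopingAlgebra.ι ℂ x * b = b * UniversalEnvelopingAlgebra.ι ℂ x := by
    intro x b
    have : b ∈ Subalgebra.centralizer ℂ {UniversalEnvelopingAlgebra.ι ℂ x} := by
      rw [subalgebra_eq_top (Subalgebra.centralizer ℂ _) fun y => ?_]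
      · trivial
      · rw [Subalgebra.mem_centralizer_iff]
        rintro _ rfl
        have h := (UniversalEnvelopingAlgebra.ι ℂ (L := nilSub S)).map_lie x y
        rw [lie_nilSub, map_zero, LieRing.of_associative_ring_bracket] at h
        exact sub_eq_zero.1 h.symm
    exact Subalgebra.mem_centralizer_iff ℂ |>.1 this _ rfl
  have : a ∈ Subalgebra.centralizer ℂ {b} := by
    rw [subalgebra_eq_top (Subalgebra.centralizer ℂ _) fun y => ?_]
    · trivial
    · rw [Subalgebra.mem_centralizer_iff]
      rintro _ rfl
      exact (h1 y _).symm
  exact (Subalgebra.mem_centralizer_iff ℂ |>.1 this _ rfl).symm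

-- Commutativity is what allows evaluating `MvPolynomial` in these enveloping algebras.
local instance (S : Set ℤ) : CommRing (UniversalEnvelopingAlgebra ℂ (nilSub S)) :=
  { (inferInstance : Ring (UniversalEnvelopingAlgebra ℂ (nilSub S))) with
    mul_comm := nilSub_mul_comm }

/-- The map from the polynomial ring onto `U(𝔫̄_{≤ j})`, sending `X k` to `x_α(j-k)`. -/
def polyMap (j : ℤ) : Poly →ₐ[ℂ] UniversalEnvelopingAlgebra ℂ (nLe j) :=
  MvPolynomial.aeval fun k : ℕ => gen j (j - k) (by omega)

theorem polyMap_X (j : ℤ) (k : ℕ) :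
    polyMap j (MvPolynomial.X k) = gen j (j - k) (by omega) := by
  rw [polyMap, MvPolynomial.aeval_X]

theorem gen_congr {j m n : ℤ} (h : m = n) (hm : m ≤ j) (hn : n ≤ j) : gen j m hm = gen j n hn := by
  subst h; rfl

/-- Surjectivity suffices for the comparison of ideals: both sides are pulled back to `Poly` and
compared there. -/
theorem polyMap_surjective (j : ℤ) : Function.Surjective (polyMap j) := by
  intro a
  have h : (polyMap j).range = ⊤ := by
    refine subalgebra_eq_top _ ?_
    rintro ⟨x, hx⟩
    have hx' : x ∈ Submodule.span ℂ (monomial xAlpha '' Set.Iic j) := hx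
    refine Submodule.span_induction (p := fun x hx =>
      UniversalEnvelopingAlgebra.ι ℂ (⟨x, hx⟩ : nLe j) ∈ (polyMap j).range) ?_ ?_ ?_ ?_ hx'
    · rintro _ ⟨m, hm, rfl⟩
      refine ⟨MvPolynomial.X (j - m).toNat, ?_⟩
      have hm' : m ≤ j := hm
      refine (polyMap_X j _).trans ?_
      exact gen_congr (by omega) _ hm'
    · have := map_zero (UniversalEnvelopingAlgebra.ι ℂ (L := nLe j))
      exact this ▸ Subalgebra.zero_mem _
    · intro x y hx hy h1 h2
      have := map_add (UniversalEnvelopingAlgebra.ι ℂ (L := nLe j)) ⟨x, hx⟩ ⟨y, hy⟩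
      exact this ▸ Subalgebra.add_mem _ h1 h2
    · intro c x hx h1
      have := map_smul (UniversalEnvelopingAlgebra.ι ℂ (L := nLe j)) c ⟨x, hx⟩
      exact this ▸ Subalgebra.smul_mem _ h1 c
  have ha : a ∈ (polyMap j).range := h ▸ Algebra.mem_top
  exact ha

theorem polyMap_rel (j : ℤ) (n : ℕ) : polyMap j (rel n) = quad j (-2 * j + n) := by
  rw [rel, map_sum, quad]
  refine Finset.sum_bij (fun p hp => ⟨j - p.1, by
      rw [Finset.HasAntidiagonal.mem_antidiagonal] at hp
      rw [Finset.mem_Icc]; omega⟩) (fun _ _ => Finset.mem_attach _ _) ?_ ?_ ?_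
  · intro p hp q hq h
    rw [Finset.HasAntidiagonal.mem_antidiagonal] at hp hq
    have : j - (p.1 : ℤ) = j - q.1 := congrArg Subtype.val h
    ext <;> omega
  · rintro ⟨m, hm⟩ -
    have hm' := Finset.mem_Icc.1 hm
    refine ⟨((j - m).toNat, (n - (j - m)).toNat), ?_, ?_⟩
    · rw [Finset.HasAntidiagonal.mem_antidiagonal]; dsimp only; omega
    · apply Subtype.ext
      dsimp only
      omega
  · intro p hp
    rw [Finset.HasAntidiagonal.mem_antidiagonal] at hp
    rw [map_mul, polyMap_X, polyMap_X]
    congr 1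
    exact gen_congr (by dsimp only; omega) _ _

theorem quad_eq_polyMap {j t : ℤ} (h : -2 * j ≤ t) :
    quad j t = polyMap j (rel (t + 2 * j).toNat) := by
  rw [polyMap_rel]
  congr 1
  omega

theorem polyMap_mem {j : ℤ} {I : Ideal (UniversalEnvelopingAlgebra ℂ (nLe j))}
    (h : ∀ t, -2 * j ≤ t → quad j t ∈ I) {a : Poly} (ha : a ∈ relIdeal) : polyMap j a ∈ I := by
  induction ha using Submodule.span_induction with
  | mem x hx =>
    obtain ⟨n, rfl⟩ := hx
    rw [polyMap_rel]
    exact h _ (by omega)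
  | zero => rw [map_zero]; exact I.zero_mem
  | add x y _ _ hx hy => rw [map_add]; exact I.add_mem hx hy
  | smul c x _ hx => rw [smul_eq_mul, map_mul]; exact I.mul_mem_left _ hx

/-! ### The action of the polynomial ring on Fock space -/

/-- The action of the polynomial ring on Fock space. -/
def fockPoly : Poly →ₐ[ℂ] Module.End ℂ Fock :=
  ((UniversalEnvelopingAlgebra.lift ℂ fockRep).comp (inclU (nLe (-1)))).comp (polyMap (-1))

theorem lift_inclU_gen (j m : ℤ) (h : m ≤ j) :
    UniversalEnvelopingAlgebra.lift ℂ fockRep (inclU (nLe j) (gen j m h)) = J 0 1 m := by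
  rw [inclU, gen, UniversalEnvelopingAlgebra.lift_ι_apply]
  change UniversalEnvelopingAlgebra.lift ℂ fockRep
    (UniversalEnvelopingAlgebra.ι ℂ (monomial xAlpha m)) = _
  rw [UniversalEnvelopingAlgebra.lift_ι_apply, fockRep_apply, fockLin_monomial, current_xAlpha]

theorem fockPoly_X (k : ℕ) : fockPoly (MvPolynomial.X k) = J 0 1 (-1 - k) := by
  rw [fockPoly, AlgHom.comp_apply, polyMap_X, AlgHom.comp_apply, lift_inclU_gen]

theorem inclU_polyMap_smul (a : Poly) (v : Fock) :
    inclU (nLe (-1)) (polyMap (-1) a) • v = fockPoly a v := rfl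

theorem inclU_polyMap_smul' (a : Poly) (v : Fock) :
    inclU (nLe (-2)) (polyMap (-2) a) • v = fockPoly (up a) v := by
  have h : ((UniversalEnvelopingAlgebra.lift ℂ fockRep).comp (inclU (nLe (-2)))).comp
      (polyMap (-2)) = fockPoly.comp up := by
    refine MvPolynomial.algHom_ext fun k => ?_
    rw [AlgHom.comp_apply, polyMap_X, AlgHom.comp_apply, lift_inclU_gen, AlgHom.comp_apply, up_X,
      fockPoly_X]
    congr 1
    push_cast
    ring
  exact LinearMap.congr_fun (DFunLike.congr_fun h a) v

theorem fockPoly_mul_X (a : Poly) (k : ℕ) (v : Fock) :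
    fockPoly (a * MvPolynomial.X k) v = J 0 1 (-1 - k) (fockPoly a v) := by
  rw [mul_comm, map_mul, fockPoly_X]; rfl

theorem commute_fockPoly {A : Module.End ℂ Fock} (h : ∀ m, Commute (J 0 1 m) A) (a : Poly) :
    Commute (fockPoly a) A := by
  induction a using MvPolynomial.induction_on with
  | C c =>
    rw [← MvPolynomial.algebraMap_eq, AlgHom.commutes]
    exact Algebra.commutes c A
  | add a b ha hb => rw [map_add]; exact ha.add_left hb
  | mul_X a k ha => rw [map_mul, fockPoly_X]; exact ha.mul_left (h _)

theorem fockPoly_apply_comm {A : Module.End ℂ Fock} (h : ∀ m, Commute (J 0 1 m) A) (a : Poly)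
    (v : Fock) : fockPoly a (A v) = A (fockPoly a v) :=
  LinearMap.congr_fun (commute_fockPoly h a) v

/-! ### Translation operators and lowering of indices -/

theorem J_fockPoly_vac {m : ℤ} (hm : 0 ≤ m) (a : Poly) : J 0 1 m (fockPoly a vac) = 0 := by
  rw [← fockPoly_apply_comm fun n => commute_J n m, J_vac 0 1 hm, map_zero]

/-- The rule `down (X 0) = 0` matches the vanishing of x_α(0) on the orbit of the vacuum. -/
theorem J_fockPoly_down (a : Poly) (k : ℕ) :
    J 0 1 (-k) (fockPoly (down a) vac) = fockPoly (down (a * MvPolynomial.X k)) vac := by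
  rw [map_mul]
  cases k with
  | zero => rw [down_X_zero, mul_zero, map_zero, J_fockPoly_vac (by simp)]; rfl
  | succ k =>
    rw [down_X_succ, fockPoly_mul_X]
    congr 2
    push_cast
    ring

theorem trans_zero_fockPoly (a : Poly) :
    trans 0 (fockPoly a (P 0 1 vac)) = fockPoly (down a) vac := by
  induction a using MvPolynomial.induction_on with
  | C c =>
    rw [← MvPolynomial.algebraMap_eq, AlgHom.commutes, AlgHom.commutes, AlgHom.commutes,
      Module.algebraMap_end_apply, Module.algebraMap_end_apply, map_smul, trans_zero_P_vac]
  | add a b ha hb => simp only [map_add, LinearMap.add_apply, ha, hb]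
  | mul_X a k ha =>
    rw [fockPoly_mul_X, ← Module.End.mul_apply, trans_zero_mul_J, Module.End.mul_apply, ha,
      show (-1 - k + 1 : ℤ) = -k by ring, J_fockPoly_down]

theorem fockPoly_trans_one (a : Poly) :
    fockPoly a (trans 1 vac) = trans 1 (fockPoly (down a) vac) := by
  induction a using MvPolynomial.induction_on with
  | C c =>
    rw [← MvPolynomial.algebraMap_eq, AlgHom.commutes, AlgHom.commutes, AlgHom.commutes,
      Module.algebraMap_end_apply, Module.algebraMap_end_apply, map_smul]
  | add a b ha hb => simp only [map_add, LinearMap.add_apply, ha, hb]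
  | mul_X a k ha =>
    have h := LinearMap.congr_fun (trans_one_mul_J (-k)) (fockPoly (down a) vac)
    simp only [Module.End.mul_apply] at h
    rw [fockPoly_mul_X, ha, ← J_fockPoly_down, h, show (-k - 1 : ℤ) = -1 - k by ring]

/-- The annihilator of the vacuum. -/
def vacIdeal : Ideal Poly where
  carrier := {a | fockPoly a vac = 0}
  zero_mem' := by change fockPoly 0 vac = 0; rw [map_zero]; rfl
  add_mem' {a b} ha hb := by
    change fockPoly (a + b) vac = 0
    rw [map_add, LinearMap.add_apply, ha, hb, add_zero]
  smul_mem' c a ha := by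
    change fockPoly (c * a) vac = 0
    rw [map_mul, Module.End.mul_apply, ha, map_zero]

theorem mem_vacIdeal {a : Poly} : a ∈ vacIdeal ↔ fockPoly a vac = 0 := Iff.rfl

theorem relIdeal_le_vacIdeal : relIdeal ≤ vacIdeal := by
  refine Ideal.span_le.2 ?_
  rintro _ ⟨t, rfl⟩
  change fockPoly (rel t) vac = 0
  rw [rel, map_sum, LinearMap.sum_apply]
  refine Eq.trans (Finset.sum_congr rfl fun p _ => ?_) (sum_J_vac t)
  rw [map_mul, fockPoly_X, fockPoly_X]; rfl

/-- Since `P 0 1` commutes with the currents, `a` also kills `P 0 1 vac`, which `trans 0` carries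
back to the vacuum while lowering indices. -/
theorem down_mem_vacIdeal {a : Poly} (h : a ∈ vacIdeal) : down a ∈ vacIdeal := by
  rw [mem_vacIdeal, ← trans_zero_fockPoly, fockPoly_apply_comm fun m => commute_J_P m 1,
    mem_vacIdeal.1 h, map_zero, map_zero]

theorem vacIdeal_eq : vacIdeal = relIdeal := by
  refine le_antisymm (le_relIdeal relIdeal_le_vacIdeal ?_ (fun a ha => down_mem_vacIdeal ha) ?_)
    relIdeal_le_vacIdeal
  · intro c hc
    rw [mem_vacIdeal, ← MvPolynomial.algebraMap_eq, AlgHom.commutes,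
      Module.algebraMap_end_apply] at hc
    by_contra h
    refine vac_ne_zero ?_
    rw [← one_smul ℂ vac, ← inv_mul_cancel₀ h, mul_smul, hc, smul_zero]
  -- Here x_α(-1) sends the vacuum to `P 0 1 (Q 1 0 vac)`. Removing `P 0 1` by `trans 0` lowers `c`
  -- once; `Q 1 0 vac` is `-trans 1 vac`, and pulling out the injective `trans 1` lowers it a second
  -- time.
  · intro c hc
    have hPQ : P 0 1 (Q 1 0 vac) = -Q 1 0 (P 0 1 vac) := by
      have := Q_mul_P 1 0 0 1
      rw [delta_of_ne (by decide), zero_mul, zero_smul, zero_sub] at this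
      have h2 := LinearMap.congr_fun this vac
      simp only [Module.End.mul_apply, LinearMap.neg_apply] at h2
      rw [h2, neg_neg]
    rw [mem_vacIdeal, map_mul, Module.End.mul_apply, fockPoly_X, Nat.cast_zero, sub_zero,
      J_neg_one_vac, hPQ, map_neg, neg_eq_zero,
      fockPoly_apply_comm fun m => commute_J_Q m 0] at hc
    have h1 := congrArg (trans 0) hc
    rw [← Module.End.mul_apply, trans_mul_Q_of_ne (by decide), LinearMap.neg_apply,
      Module.End.mul_apply, trans_zero_fockPoly, map_zero, neg_eq_zero,
      ← fockPoly_apply_comm fun m => commute_J_Q m 0] at h1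
    have h2 : fockPoly (down c) (trans 1 vac) = 0 := by
      rw [trans_one_vac, map_neg, h1, neg_zero]
    rw [fockPoly_trans_one] at h2
    exact trans_injective 1 (h2.trans (map_zero _).symm)

theorem fockPoly_vac_eq_zero {a : Poly} : fockPoly a vac = 0 ↔ a ∈ relIdeal := by
  rw [← vacIdeal_eq, mem_vacIdeal]

theorem mem_sup_of_down_mem {a : Poly} (h : down a ∈ relIdeal) :
    a ∈ relIdeal ⊔ Ideal.span {(MvPolynomial.X 0 : Poly)} := by
  have h2 : a - up (down a) ∈ relIdeal ⊔ Ideal.span {(MvPolynomial.X 0 : Poly)} :=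
    Ideal.mem_sup_right (sub_up_down_mem a)
  have := Ideal.add_mem _ (up_mem h) h2
  rwa [add_sub_cancel] at this

/-- One direction applies `trans 0`. For the other, `a` is a combination of relations plus a
multiple of `X 0`, and x_α(-1) kills `P 0 1 vac` because `P 0 1` squares to zero. -/
theorem fockPoly_P_vac_eq_zero {a : Poly} : fockPoly a (P 0 1 vac) = 0 ↔ down a ∈ relIdeal := by
  constructor
  · intro h
    rw [← fockPoly_vac_eq_zero, ← trans_zero_fockPoly, h, map_zero]
  · intro h
    obtain ⟨i, hi, e, he, rfl⟩ := Submodule.mem_sup.1 (mem_sup_of_down_mem h)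
    obtain ⟨d, rfl⟩ := Ideal.mem_span_singleton'.1 he
    have hPP : P 0 1 (P 0 1 (Q 1 0 vac)) = 0 := by
      rw [← Module.End.mul_apply, eq_zero_of_eq_neg (P_mul_P 0 0 1 1)]; rfl
    have hX : fockPoly (d * MvPolynomial.X 0) (P 0 1 vac) = 0 := by
      have h2 := LinearMap.congr_fun (commute_J_P (-1) 1) vac
      simp only [Module.End.mul_apply] at h2
      rw [map_mul, Module.End.mul_apply, fockPoly_X, Nat.cast_zero, sub_zero, h2, J_neg_one_vac,
        hPP, map_zero]
    rw [map_add, LinearMap.add_apply, hX, add_zero, fockPoly_apply_comm fun m => commute_J_P m 1,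
      fockPoly_vac_eq_zero.2 hi, map_zero]

/-! ### Annihilators -/

section Annihilator

variable {V V' : Type} [AddCommGroup V] [Module ℂ V] [Module UAffine V]
  [IsScalarTower ℂ UAffine V] [AddCommGroup V'] [Module ℂ V'] [Module UAffine V']
  [IsScalarTower ℂ UAffine V']

/-- The annihilator of `v` in `U(𝔰)`. -/
def annIdeal (s : LieSubalgebra ℂ Affine) (v : V) : Ideal (UniversalEnvelopingAlgebra ℂ s) where
  carrier := {a | inclU s a • v = 0}
  zero_mem' := by change inclU s 0 • v = 0; rw [map_zero, zero_smul]
  add_mem' {a b} ha hb := by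
    change inclU s (a + b) • v = 0
    rw [map_add, add_smul, ha, hb, add_zero]
  smul_mem' c a ha := by
    change inclU s (c * a) • v = 0
    rw [map_mul, mul_smul, ha, smul_zero]

theorem mem_annIdeal {s : LieSubalgebra ℂ Affine} {v : V} {a : UniversalEnvelopingAlgebra ℂ s} :
    a ∈ annIdeal s v ↔ inclU s a • v = 0 := Iff.rfl

theorem ker_orbitMap {s s' : LieSubalgebra ℂ Affine} (h : s ≤ s') (v : V) :
    LinearMap.ker (orbitMap h v) = (annIdeal s v).restrictScalars ℂ := by
  ext a
  rw [LinearMap.mem_ker, Submodule.restrictScalars_mem, mem_annIdeal, ← Subtype.val_inj]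
  rfl

/-- By `hs` every vector of the domain is `a · v` with `a ∈ U(r)`, so the kernel is read off from
the annihilator of `P v`. -/
theorem ker_orbitProj {r s s' : LieSubalgebra ℂ Affine} (hr : r ≤ s) (h : s ≤ s')
    (P : V →ₗ[UAffine] V') (v : V) {I : Ideal (UniversalEnvelopingAlgebra ℂ r)}
    (hI : annIdeal r (P v) = I) (hs : orbit s v ≤ orbit r v) :
    LinearMap.ker (orbitProj h P v) = (I.restrictScalars ℂ).map (orbitMap hr v) := by
  subst hI
  ext ⟨y, hy⟩
  have key : ∀ a, P (inclU r a • v) = 0 ↔ a ∈ annIdeal r (P v) := fun a => by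
    rw [map_smul, mem_annIdeal]
  constructor
  · intro h0
    obtain ⟨a, rfl⟩ := hs hy
    refine ⟨a, (key a).1 ?_, rfl⟩
    exact congrArg Subtype.val h0
  · rintro ⟨a, ha, hay⟩
    obtain rfl : inclU r a • v = y := congrArg Subtype.val hay
    exact Subtype.ext ((key a).2 ha)

theorem map_annIdeal_le {r s : LieSubalgebra ℂ Affine} (hr : r ≤ s)
    (P : V →ₗ[UAffine] V') (v : V) {I : Ideal (UniversalEnvelopingAlgebra ℂ r)}
    (hI : annIdeal r (P v) = I) :
    ((I.restrictScalars ℂ).map (orbitMap hr v)).map (Submodule.subtype _) ≤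
      (LinearMap.ker P).restrictScalars ℂ := by
  subst hI
  rintro _ ⟨_, ⟨a, ha, rfl⟩, rfl⟩
  change P (inclU r a • v) = 0
  rw [map_smul]
  exact ha

/-- The nonnegative modes commute with U(𝔫̄₋) and kill `v`, hence they kill its whole orbit. -/
theorem orbit_nBar_le {v : V} (h : ∀ m : ℤ, 0 ≤ m → mode xAlpha m v = 0) :
    orbit nBar v ≤ orbit (nLe (-1)) v := by
  have hle := nLe_le_nBar (-1)
  have hstab : ∀ m : ℤ, ∀ w ∈ orbit (nLe (-1)) v, mode xAlpha m w ∈ orbit (nLe (-1)) v := by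
    rintro m _ ⟨a, rfl⟩
    rcases le_or_gt 0 m with hm | hm
    · have hmem : monomial xAlpha m ∈ nBar := Submodule.subset_span ⟨m, trivial, rfl⟩
      have hcomm : UniversalEnvelopingAlgebra.ι ℂ (monomial xAlpha m) * inclU (nLe (-1)) a =
          inclU (nLe (-1)) a * UniversalEnvelopingAlgebra.ι ℂ (monomial xAlpha m) := by
        have hι : UniversalEnvelopingAlgebra.ι ℂ (monomial xAlpha m) =
            inclU nBar (UniversalEnvelopingAlgebra.ι ℂ ⟨monomial xAlpha m, hmem⟩) := by
          rw [inclU, UniversalEnvelopingAlgebra.lift_ι_apply]; rfl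
        rw [hι, ← inclU_inclULe hle a, ← map_mul, ← map_mul, nilSub_mul_comm]
      have : mode xAlpha m (inclU (nLe (-1)) a • v) = 0 := by
        rw [mode_apply, ← mul_smul, hcomm, mul_smul, ← mode_apply, h m hm, smul_zero]
      change mode xAlpha m (inclU (nLe (-1)) a • v) ∈ _
      rw [this]
      exact Submodule.zero_mem _
    · refine ⟨gen (-1) m (by omega) * a, ?_⟩
      change inclU (nLe (-1)) (gen (-1) m (by omega) * a) • v =
        mode xAlpha m (inclU (nLe (-1)) a • v)
      rw [map_mul, mul_smul, mode_apply, inclU, gen, UniversalEnvelopingAlgebra.lift_ι_apply]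
      rfl
  rintro _ ⟨u, rfl⟩
  have hu : u ∈ (stabilizer (orbit (nLe (-1)) v)).comap (inclU nBar) := by
    rw [subalgebra_eq_top (Subalgebra.comap _ _) ?_]
    · trivial
    rintro ⟨x, hx⟩ w hw
    change inclU nBar (UniversalEnvelopingAlgebra.ι ℂ ⟨x, hx⟩) • w ∈ _
    rw [inclU, UniversalEnvelopingAlgebra.lift_ι_apply]
    change UniversalEnvelopingAlgebra.ι ℂ x • w ∈ _
    have hx' : x ∈ Submodule.span ℂ (monomial xAlpha '' Set.univ) := hx
    clear hx
    induction hx' using Submodule.span_induction with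
    | mem x hx => obtain ⟨m, -, rfl⟩ := hx; exact hstab m w hw
    | zero => rw [map_zero, zero_smul]; exact Submodule.zero_mem _
    | add x y _ _ hx hy => rw [map_add, add_smul]; exact Submodule.add_mem _ hx hy
    | smul c x _ hx => rw [map_smul, smul_assoc]; exact Submodule.smul_mem _ c hx
  exact hu v ⟨1, by change inclU _ 1 • v = v; rw [map_one, one_smul]⟩

end Annihilator

/-! ### Annihilators of the highest weight vectors -/

theorem R0_mem {t : ℤ} (ht : 2 ≤ t) : quad (-1) t ∈ Ideal.span (R0 '' Set.Ici 2) :=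
  Ideal.subset_span (Set.mem_image_of_mem R0 ht)

theorem R1_mem {t : ℤ} (ht : 4 ≤ t) : quad (-2) t ∈ Ideal.span (R1 '' Set.Ici 4) :=
  Ideal.subset_span (Set.mem_image_of_mem R1 ht)

theorem annIdeal_v0 : annIdeal (nLe (-1)) v0 = I0 := by
  have key : ∀ a, polyMap (-1) a ∈ annIdeal (nLe (-1)) v0 ↔ a ∈ relIdeal := fun a => by
    rw [mem_annIdeal, smul_v0_eq_zero, inclU_polyMap_smul, fockPoly_vac_eq_zero]
  refine le_antisymm (fun b hb => ?_) (Ideal.span_le.2 ?_)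
  · obtain ⟨a, rfl⟩ := polyMap_surjective (-1) b
    exact polyMap_mem (fun t ht => R0_mem (by simpa using ht)) ((key a).1 hb)
  · rintro _ ⟨t, ht, rfl⟩
    rw [R0, quad_eq_polyMap (by simpa using ht)]
    exact (key _).2 (Ideal.subset_span ⟨_, rfl⟩)

theorem annIdeal_v1 : annIdeal (nLe (-1)) v1 = I1 := by
  have key : ∀ a, polyMap (-1) a ∈ annIdeal (nLe (-1)) v1 ↔ down a ∈ relIdeal := fun a => by
    rw [mem_annIdeal, smul_v1_eq_zero, inclU_polyMap_smul, fockPoly_P_vac_eq_zero]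
  have hX : polyMap (-1) (MvPolynomial.X 0) = gen (-1) (-1) le_rfl := by
    rw [polyMap_X]; exact gen_congr (by simp) _ _
  refine le_antisymm (fun b hb => ?_) (sup_le (Ideal.span_le.2 ?_) (Ideal.span_le.2 ?_))
  · obtain ⟨a, rfl⟩ := polyMap_surjective (-1) b
    obtain ⟨i, hi, e, he, rfl⟩ := Submodule.mem_sup.1 (mem_sup_of_down_mem ((key a).1 hb))
    obtain ⟨d, rfl⟩ := Ideal.mem_span_singleton'.1 he
    rw [map_add, map_mul, hX]
    refine Ideal.add_mem _ (Ideal.mem_sup_left ?_) (Ideal.mem_sup_right ?_)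
    · exact polyMap_mem (fun t ht => R0_mem (by simpa using ht)) hi
    · exact Ideal.mul_mem_left _ _ (Ideal.subset_span rfl)
  · rintro _ ⟨t, ht, rfl⟩
    rw [R0, quad_eq_polyMap (by simpa using ht)]
    refine (key _).2 ?_
    rw [← vacIdeal_eq]
    exact down_mem_vacIdeal (relIdeal_le_vacIdeal (Ideal.subset_span ⟨_, rfl⟩))
  · rintro _ rfl
    rw [← hX]
    refine (key _).2 ?_
    rw [down_X_zero]
    exact Ideal.zero_mem _

/-- Starting at mode -2 inserts `up`, and `down (up a) = a` turns the Λ₁ condition into the plain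
ideal of relations. -/
theorem annIdeal_v1' : annIdeal (nLe (-2)) v1 = I1' := by
  have key : ∀ a, polyMap (-2) a ∈ annIdeal (nLe (-2)) v1 ↔ a ∈ relIdeal := fun a => by
    rw [mem_annIdeal, smul_v1_eq_zero, inclU_polyMap_smul', fockPoly_P_vac_eq_zero, down_up]
  refine le_antisymm (fun b hb => ?_) (Ideal.span_le.2 ?_)
  · obtain ⟨a, rfl⟩ := polyMap_surjective (-2) b
    exact polyMap_mem (fun t ht => R1_mem (by simpa using ht)) ((key a).1 hb)
  · rintro _ ⟨t, ht, rfl⟩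
    rw [R1, quad_eq_polyMap (by simpa using ht)]
    exact (key _).2 (Ideal.subset_span ⟨_, rfl⟩)

theorem mode_vN0 {m : ℤ} (hm : 0 ≤ m) : mode xAlpha m vN0 = 0 := by
  have := mode_vec trivialRep xAlpha hm 1
  refine this.trans ?_
  split_ifs
  · exact map_zero _
  · rfl

theorem mode_vN1 {m : ℤ} (hm : 0 ≤ m) : mode xAlpha m vN1 = 0 := by
  have := mode_vec vectorRep xAlpha hm ![1, 0]
  refine this.trans ?_
  split_ifs
  · have h : vectorRep xAlpha ![1, 0] = 0 := by
      rw [vectorRep_apply, coe_xAlpha]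
      ext i; fin_cases i <;> simp
    rw [h, map_zero]
  · rfl

end AffineSl2

end

theorem mainTheorem1 :
    -- the kernels of `f_{Λ₀}`, `f'_{Λ₁}` and `f_{Λ₁}`
    (LinearMap.ker AffineSl2.f0 = AffineSl2.I0.restrictScalars ℂ ∧
      LinearMap.ker AffineSl2.f1' = AffineSl2.I1'.restrictScalars ℂ ∧
      LinearMap.ker AffineSl2.f1 = AffineSl2.I1.restrictScalars ℂ) ∧
    -- the kernels of `π_{Λ₀}`, `π'_{Λ₁}` and `π_{Λ₁}`, which lie in `N¹(Λ₀)` and `N¹(Λ₁)`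
    ((LinearMap.ker AffineSl2.pi0 = AffineSl2.I0vN ∧
        AffineSl2.I0vN.map (Submodule.subtype _) ≤ AffineSl2.kerPi0) ∧
      (LinearMap.ker AffineSl2.pi1' = AffineSl2.I1'vN ∧
        AffineSl2.I1'vN.map (Submodule.subtype _) ≤ AffineSl2.kerPi1) ∧
      (LinearMap.ker AffineSl2.pi1 = AffineSl2.I1vN ∧
        AffineSl2.I1vN.map (Submodule.subtype _) ≤ AffineSl2.kerPi1)) := by
  open AffineSl2 in
  refine ⟨⟨?_, ?_, ?_⟩, ⟨?_, ?_⟩, ⟨?_, ?_⟩, ⟨?_, ?_⟩⟩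
  · rw [← annIdeal_v0]; exact ker_orbitMap _ _
  · rw [← annIdeal_v1']; exact ker_orbitMap _ _
  · rw [← annIdeal_v1]; exact ker_orbitMap _ _
  · exact ker_orbitProj _ le_rfl Pi0 vN0 annIdeal_v0 (orbit_nBar_le fun _ => mode_vN0)
  · exact map_annIdeal_le (nLe_le_nBar (-1)) Pi0 vN0 annIdeal_v0
  · exact ker_orbitProj (r := nLe (-2)) (s := nLe (-2)) (s' := nBar) le_rfl (nLe_le_nBar (-2))
      Pi1 vN1 annIdeal_v1' le_rfl
  · exact map_annIdeal_le (r := nLe (-2)) (s := nLe (-2)) le_rfl Pi1 vN1 annIdeal_v1'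
  · exact ker_orbitProj _ le_rfl Pi1 vN1 annIdeal_v1 (orbit_nBar_le fun _ => mode_vN1)
  · exact map_annIdeal_le (nLe_le_nBar (-1)) Pi1 vN1 annIdeal_v1
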